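/- **Setting.** Let $\mathsf k$ be a field and $n\ge 0$ an integer. *Freehedra.* A nice $n$-expression is $s=s_l][s_{l+1}]\ldots[s_k]\,|\,[s_0]\ldots[s_{l-1}]$ with $0\le l\le k$, where the stretches $s_i$ are nonempty subsets of $\{0,\dots,n\}$, $\max s_i=\min s_{i+1}$, $|s_i|\ge 2$ for $i\ne l$, $\min s_0=0$ and $\max s_k=n$. These expressions label the faces of Saneblidze's freehedron $\mathcal F_n$; the face $s$ has codimension $k+L$, where $L$ is the number of elements of $\{0,\dots,n\}$ that do not occur in $s$. The codimension one subfaces of $s$ are obtained by the following transformations, where $s_j^{\le x}=\{a\in s_j: a\le x\}$ and $s_j^{\ge x}=\{a\in s_j: a\ge x\}$: - *drop*: remove from some $s_j$ an $x\in s_j$ with $\min s_j<x<\max s_j$; - *inner break*: for $j\neq l$ and $x\in s_j$ with $\min s_j<x<\max s_j$, replace $[s_j]$ by $[s_j^{\le x}][s_j^{\ge x}]$; - *right outer break*: for $x\in s_l$ with $x<\max s_l$, replace $s_l]$ by $s_l^{\le x}][s_l^{\ge x}]$; - *left outer break*: for $x\in s_l$ with $x>\min s_l$, replace $s_l]$ by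 $s_l^{\ge x}]$ and append $[s_l^{\le x}]$ at the end of the expression. $C_*(\mathcal F_n)$ is the cellular chain complex with coefficients in $\mathsf k$: it has the faces as a basis, and its differential is given by incidence numbers of a choice of orientations of the faces, that is, by integers $[s:s']$ which are $\pm1$ if $s'$ is a codimension one subface of $s$ and $0$ otherwise, such that the differential squares to zero (over $\mathbb Z$) and the two end points of every edge have opposite signs. *The bimodule $T$.* $A_\infty^{\mathrm{Col}}$ is the DG operad with colours $\mathbf a,\mathbf m$, free as an operad on $\mu^{\mathbf a}_i\in A_\infty^{\mathrm{Col}}(\mathbf a^i;\mathbf a)$ and $\mu^{\mathbf m}_i\in A_\infty^{\mathrm{Col}}(\mathbf a^{i-1},\mathbf m;\mathbf m)$, $i\ge2$, of degree $2-i$; $M_\infty^{\mathrm{Col}}$ is the DG bimodule over it, free as a bimodule on $f^{\mathbf a}_i\in M_\infty^{\mathrm{Col}}(\mathbf a^i;\mathbf a)$ and $f^{\mathbf m}_i\in M_\infty^{\mathrm{Col}}(\mathbf a^{i-1},\mathbf m;\mathbf m)$, $i\ge1$, of degree $1-i$. The differentials are, with the colours that the inputs force, $$d\mu_i=-\sum_{\substack{r+s+t=i\\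 2\le s<i}}(-1)^{r+st}\mu_{r+1+t}(\mathrm{id}^{\otimes r}\otimes\mu_s\otimes\mathrm{id}^{\otimes t}),$$ $$df_i=\sum_{\substack{r+s+t=i\\ s\ge2}}(-1)^{r+st}f_{r+1+t}(\mathrm{id}^{\otimes r}\otimes\mu_s\otimes\mathrm{id}^{\otimes t})-\sum_{\substack{i_1+\dots+i_r=i\\ r\ge2,\ i_q\ge1}}(-1)^{\sum_q(r-q)(i_q-1)}\mu_r(f_{i_1}\otimes\dots\otimes f_{i_r}).$$ $T$ is the quotient of $M_\infty^{\mathrm{Col}}$ by the DG sub-bimodule generated by the action of $\mu^{\mathbf a}_i$, $i>2$, and by $f^{\mathbf a}_i$, $i>1$. A tree $t=(t_1,\dots,t_b)$ has depth two, $b$ branches numbered from left to right, and $t_j\ge 1$ leaves on its $j$-th branch; the trivial tree with $b=0$ is denoted $1$. A short forest is a finite, possibly empty, sequence of such trees with $b\ge1$, and $\circ$ is concatenation. A triple $(F,T,G)$ consists of two short forests $F,G$ and a tree $T$, possibly $1$. A triple with $n$ leaves in total gives an element of $T(\mathbf a^n,\mathbf m;\mathbf m)$: a tree $t$ of $F$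 or of $G$ gives $\mu^{\mathbf m}_{b+1}((\mu_2^{\mathbf a})^{t_1-1},\dots,(\mu_2^{\mathbf a})^{t_b-1},-)$, the tree $T$ gives $f^{\mathbf m}_{b+1}((\mu_2^{\mathbf a})^{t_1-1},\dots,(\mu_2^{\mathbf a})^{t_b-1},-)$, these are composed in the order of the triple with the first one outermost, and $f_1^{\mathbf a}$ is applied to the inputs of colour $\mathbf a$ of the trees of $F$. Here $(\mu_2^{\mathbf a})^{r}$ is the iterated product of $r+1$ factors. *The map $I$.* For a stretch $u=\{a_1<\dots<a_m\}$ let $\iota(u)$ be the tree with $m-1$ branches whose $j$-th branch, counted from the right, has $a_{j+1}-a_j$ leaves. Put $$I(s)=(\iota(s_k)\circ\dots\circ\iota(s_{l+1}),\ \iota(s_l),\ \iota(s_{l-1})\circ\dots\circ\iota(s_0)).$$ **Statement.** $I$ is a bijection from the nice $n$-expressions to the triples with $n$ leaves. The faces of $\mathcal F_n$ can be oriented, and for every choice of orientations there are signs $\varepsilon(s)\in\{1,-1\}$ such that $s\mapsto\varepsilon(s)I(s)$ defines an isomorphism of chain complexes $$C_*(\mathcal F_n)\simeq T(\mathbf a^n,\mathbf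 m;\mathbf m)$$ that takes chains of dimension $p$ to elements of degree $-p$. Moreover, let $s,s'$ be nice $n$-expressions and $I(s)=(F,T,G)$. Then 1. $s'$ is obtained from $s$ by a drop if and only if $I(s')$ is obtained from $I(s)$ by uniting two neighbouring branches of a tree of $F$, of $T$ or of a tree of $G$ to one branch (a term $U$); 2. $s'$ is obtained from $s$ by an inner break at some $s_i$ with $i>l$ (respectively $i<l$) if and only if $I(s')$ is obtained from $I(s)$ by separating a tree of $F$ (respectively of $G$) between two neighbouring branches into two trees; 3. $s'$ is obtained from $s$ by a right outer break if and only if $I(s')=(F\circ T_l,T_r,G)$ for a separation of $T$ between two neighbouring branches into a left part $T_l$ and a right part $T_r$ (a term $S_l$), or $T\neq1$ and $I(s')=(F\circ T,1,G)$; 4. $s'$ is obtained from $s$ by a left outer break if and only if $I(s')=(F,T_l,T_r\circ G)$ for such a separation (a term $S_r$), or $T\ne1$ and $I(s')=(F,1,T\circ G)$. -/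

import Mathlib

namespace Freehedra

/-! ## Nice expressions and the freehedron -/

/-- An expression `s_l] [s_{l+1}] … [s_k] | [s_0] … [s_{l-1}]`. -/
structure NExpr where
  /-- the stretches `s_{l+1}, …, s_k`, between the first stretch and the bar -/
  left : List (Finset ℕ)
  /-- the stretch `s_l`, which has no opening bracket -/
  active : Finset ℕ
  /-- the stretches `s_0, …, s_{l-1}`, to the right of the bar -/
  right : List (Finset ℕ)

namespace NExpr

/-- The stretches in the order `s_0, …, s_k`. -/
def stretches (s : NExpr) : List (Finset ℕ) := s.right ++ s.active :: s.left

/-- Nice `n`-expressions. -/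
structure IsNice (n : ℕ) (s : NExpr) : Prop where
  subset : ∀ t ∈ s.stretches, t ⊆ Finset.range (n + 1)
  nonempty : ∀ t ∈ s.stretches, t.Nonempty
  consecutive : s.stretches.IsChain
    (fun t u => ∃ x, IsGreatest (t : Set ℕ) x ∧ IsLeast (u : Set ℕ) x)
  two_le_left : ∀ t ∈ s.left, 2 ≤ t.card
  two_le_right : ∀ t ∈ s.right, 2 ≤ t.card
  first : ∀ t ∈ s.stretches.head?, IsLeast (t : Set ℕ) 0
  last : ∀ t ∈ s.stretches.getLast?, IsGreatest (t : Set ℕ) n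

/-- The codimension of the face labelled `s`: one for each stretch besides `s_l` (there are `k`
of them), plus the number of elements of `{0, …, n}` that do not occur in `s`. -/
def codim (n : ℕ) (s : NExpr) : ℕ :=
  s.left.length + s.right.length +
    ((Finset.range (n + 1)).filter (fun i => ∀ t ∈ s.stretches, i ∉ t)).card

end NExpr

/-- `x` is an element of the stretch `t` with `min t < x < max t`. -/
def IsInner (t : Finset ℕ) (x : ℕ) : Prop := x ∈ t ∧ (∃ y ∈ t, y < x) ∧ (∃ z ∈ t, x < z)

/-- `{a ∈ t | a ≤ x}` -/
def lower (t : Finset ℕ) (x : ℕ) : Finset ℕ := t.filter (fun a => a ≤ x)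

/-- `{a ∈ t | x ≤ a}` -/
def upper (t : Finset ℕ) (x : ℕ) : Finset ℕ := t.filter (fun a => x ≤ a)

/-- `Drop s s'`: `s'` is obtained from `s` by a drop, at any of the stretches. -/
inductive Drop : NExpr → NExpr → Prop
  | left (A B : List (Finset ℕ)) (t a : Finset ℕ) (R : List (Finset ℕ)) (x : ℕ) :
      IsInner t x → Drop ⟨A ++ t :: B, a, R⟩ ⟨A ++ t.erase x :: B, a, R⟩
  | active (L : List (Finset ℕ)) (a : Finset ℕ) (R : List (Finset ℕ)) (x : ℕ) :
      IsInner a x → Drop ⟨L, a, R⟩ ⟨L, a.erase x, R⟩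
  | right (L : List (Finset ℕ)) (a t : Finset ℕ) (A B : List (Finset ℕ)) (x : ℕ) :
      IsInner t x → Drop ⟨L, a, A ++ t :: B⟩ ⟨L, a, A ++ t.erase x :: B⟩

/-- Inner breaks at a stretch `s_i` with `i > l`. -/
inductive InnerBreakLeft : NExpr → NExpr → Prop
  | mk (A B : List (Finset ℕ)) (t a : Finset ℕ) (R : List (Finset ℕ)) (x : ℕ) :
      IsInner t x →
      InnerBreakLeft ⟨A ++ t :: B, a, R⟩ ⟨A ++ lower t x :: upper t x :: B, a, R⟩

/-- Inner breaks at a stretch `s_i` with `i < l`. -/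
inductive InnerBreakRight : NExpr → NExpr → Prop
  | mk (L : List (Finset ℕ)) (a t : Finset ℕ) (A B : List (Finset ℕ)) (x : ℕ) :
      IsInner t x →
      InnerBreakRight ⟨L, a, A ++ t :: B⟩ ⟨L, a, A ++ lower t x :: upper t x :: B⟩

/-- Right outer breaks: `s_l]` is replaced by `s_l¹] [s_l²]`, at some `x < max s_l`. -/
inductive RightOuterBreak : NExpr → NExpr → Prop
  | mk (L : List (Finset ℕ)) (a : Finset ℕ) (R : List (Finset ℕ)) (x : ℕ) :
      x ∈ a → (∃ z ∈ a, x < z) →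
      RightOuterBreak ⟨L, a, R⟩ ⟨upper a x :: L, lower a x, R⟩

/-- Left outer breaks: the upper part of `s_l` stays, the lower part becomes the last stretch of
the whole expression, at some `x > min s_l`. -/
inductive LeftOuterBreak : NExpr → NExpr → Prop
  | mk (L : List (Finset ℕ)) (a : Finset ℕ) (R : List (Finset ℕ)) (x : ℕ) :
      x ∈ a → (∃ y ∈ a, y < x) →
      LeftOuterBreak ⟨L, a, R⟩ ⟨L, upper a x, R ++ [lower a x]⟩

/-- The faces of the freehedron `F_n`: nice `n`-expressions. -/
abbrev Face (n : ℕ) : Type := {s : NExpr // s.IsNice n}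

/-- `Facet s s'`: the face labelled `s'` is a codimension one subface of the face labelled `s`. -/
def Facet (s s' : NExpr) : Prop :=
  Drop s s' ∨ InnerBreakLeft s s' ∨ InnerBreakRight s s' ∨
    RightOuterBreak s s' ∨ LeftOuterBreak s s'

/-- The dimension of a face of `F_n`. -/
def Face.dim {n : ℕ} (s : Face n) : ℤ := (n : ℤ) - (s.1.codim n : ℤ)

/-- A system of incidence numbers on the cells of a regular cell complex: this is what a choice of
an orientation of every cell amounts to. `bd s` is the cellular boundary of the cell `s`. All
coefficients at codimension one subfaces are `±1`, all others vanish, the two end points of an edge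
have opposite signs, and the square of the boundary is zero. -/
structure Orientation {X : Type*} (facet : X → X → Prop) (dim : X → ℤ) where
  bd : X → X →₀ ℤ
  bd_facet : ∀ s s', facet s s' → bd s s' = 1 ∨ bd s s' = -1
  bd_not_facet : ∀ s s', ¬ facet s s' → bd s s' = 0
  bd_edge : ∀ s, dim s = 1 → ((bd s).sum fun _ c => c) = 0
  bd_bd : ∀ s, ((bd s).sum fun s' c => c • bd s') = 0

/-- Orientations of the freehedron `F_n`. -/
abbrev FreehedronOrientation (n : ℕ) : Type :=
  Orientation (X := Face n) (fun s s' => Facet s.1 s'.1) Face.dim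

/-- Cellular chains of `F_n` with coefficients in `k`, in all degrees. -/
abbrev Chains (k : Type*) [Field k] (n : ℕ) : Type _ := Face n →₀ k

/-- Cellular chains of dimension `p`. -/
def chainsOfDim (k : Type*) [Field k] (n : ℕ) (p : ℤ) : Submodule k (Chains k n) :=
  Finsupp.supported k k {s : Face n | s.dim = p}

/-- The cellular boundary operator of `F_n` for given orientations of the faces. -/
noncomputable def boundary (k : Type*) [Field k] {n : ℕ} (o : FreehedronOrientation n) :
    Chains k n →ₗ[k] Chains k n :=
  Finsupp.linearCombination k
    (fun s => (o.bd s).mapRange (fun z : ℤ => (z : k)) Int.cast_zero)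

/-! ## Forest-tree-forest triples -/

/-- A triple `(F, T, G)`. A tree of depth two is given by the list, from left to right, of the
numbers of leaves on its branches; a short forest is a list of such trees, from left to right.
The trivial tree `1` is `[]`. -/
structure Triple where
  F : List (List ℕ)
  T : List ℕ
  G : List (List ℕ)

/-- Triples with `n` leaves: every tree of `F` and `G` has a branch (whereas `T` may be trivial),
and every branch has a leaf. -/
structure Triple.IsTriple (n : ℕ) (τ : Triple) : Prop where
  ne_nil_F : ∀ t ∈ τ.F, t ≠ []
  ne_nil_G : ∀ t ∈ τ.G, t ≠ []
  pos : ∀ t ∈ τ.F ++ τ.T :: τ.G, ∀ c ∈ t, 0 < c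
  leaves : ((τ.F ++ τ.T :: τ.G).map List.sum).sum = n

/-- For a stretch `a_1 < … < a_m`, the tree with `m - 1` branches whose `j`-th branch, counted from
the right, has `a_{j+1} - a_j` leaves. -/
def treeOfStretch (t : Finset ℕ) : List ℕ :=
  let l := t.sort (· ≤ ·)
  (List.zipWith (fun x y => y - x) l l.tail).reverse

/-- The map `I`. -/
def mapI (s : NExpr) : Triple where
  F := (s.left.map treeOfStretch).reverse
  T := treeOfStretch s.active
  G := (s.right.map treeOfStretch).reverse

/-- `UTerm τ τ'`: `τ' = U(τ, B)` for a pair `B` of neighbouring branches of a tree of `τ`. -/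
inductive UTerm : Triple → Triple → Prop
  | F (A B : List (List ℕ)) (u v : List ℕ) (p q : ℕ) (T : List ℕ) (G : List (List ℕ)) :
      UTerm ⟨A ++ (u ++ p :: q :: v) :: B, T, G⟩ ⟨A ++ (u ++ (p + q) :: v) :: B, T, G⟩
  | T (F : List (List ℕ)) (u v : List ℕ) (p q : ℕ) (G : List (List ℕ)) :
      UTerm ⟨F, u ++ p :: q :: v, G⟩ ⟨F, u ++ (p + q) :: v, G⟩
  | G (F : List (List ℕ)) (T : List ℕ) (A B : List (List ℕ)) (u v : List ℕ) (p q : ℕ) :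
      UTerm ⟨F, T, A ++ (u ++ p :: q :: v) :: B⟩ ⟨F, T, A ++ (u ++ (p + q) :: v) :: B⟩

/-- `τ' = (S(F, B), T, G)` for a pair `B` of neighbouring branches of a tree of `F`. -/
inductive SepF : Triple → Triple → Prop
  | mk (A B : List (List ℕ)) (tl tr : List ℕ) (T : List ℕ) (G : List (List ℕ)) :
      tl ≠ [] → tr ≠ [] → SepF ⟨A ++ (tl ++ tr) :: B, T, G⟩ ⟨A ++ tl :: tr :: B, T, G⟩

/-- `τ' = (F, T, S(G, B))` for a pair `B` of neighbouring branches of a tree of `G`. -/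
inductive SepG : Triple → Triple → Prop
  | mk (F : List (List ℕ)) (T : List ℕ) (A B : List (List ℕ)) (tl tr : List ℕ) :
      tl ≠ [] → tr ≠ [] → SepG ⟨F, T, A ++ (tl ++ tr) :: B⟩ ⟨F, T, A ++ tl :: tr :: B⟩

/-- `τ' = S_l(τ, B) = (F ∘ T_l, T_r, G)` for a pair `B` of neighbouring branches of `T`. -/
inductive SepLeft : Triple → Triple → Prop
  | mk (F : List (List ℕ)) (tl tr : List ℕ) (G : List (List ℕ)) :
      tl ≠ [] → tr ≠ [] → SepLeft ⟨F, tl ++ tr, G⟩ ⟨F ++ [tl], tr, G⟩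

/-- `τ' = S_r(τ, B) = (F, T_l, T_r ∘ G)` for a pair `B` of neighbouring branches of `T`. -/
inductive SepRight : Triple → Triple → Prop
  | mk (F : List (List ℕ)) (tl tr : List ℕ) (G : List (List ℕ)) :
      tl ≠ [] → tr ≠ [] → SepRight ⟨F, tl ++ tr, G⟩ ⟨F, tl, tr :: G⟩

/-- `τ' = (F ∘ T, 1, G)`, for `T ≠ 1`. -/
inductive MoveLeft : Triple → Triple → Prop
  | mk (F : List (List ℕ)) (T : List ℕ) (G : List (List ℕ)) :
      T ≠ [] → MoveLeft ⟨F, T, G⟩ ⟨F ++ [T], [], G⟩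

/-- `τ' = (F, 1, T ∘ G)`, for `T ≠ 1`. -/
inductive MoveRight : Triple → Triple → Prop
  | mk (F : List (List ℕ)) (T : List ℕ) (G : List (List ℕ)) :
      T ≠ [] → MoveRight ⟨F, T, G⟩ ⟨F, [], T :: G⟩

/-! ## The free two-coloured operad and bimodule -/

/-- The two colours: `a` for algebra and `m` for module. -/
inductive Col
  | a
  | m

/-- Raw planar monomials. `inp c` is an input (the identity) of colour `c`, `mu c ts` is the
operation `μ^c_i` and `f c ts` the operation `f^c_i` applied to the `i` monomials in the list `ts`.
As an element of an operad, a monomial is composed according to the Koszul rule from its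
operations in prefix order: `mu c [t₁, …, tᵢ]` is `μ^c_i ∘ (t₁ ⊗ … ⊗ tᵢ)`. -/
inductive Mon
  | inp (c : Col)
  | mu (c : Col) (ts : List Mon)
  | f (c : Col) (ts : List Mon)

namespace Mon

/-- The output colour. -/
def out : Mon → Col
  | inp c => c
  | mu c _ => c
  | f c _ => c

mutual
/-- The input colours, from left to right. -/
def inputs : Mon → List Col
  | inp c => [c]
  | mu _ ts => inputsL ts
  | f _ ts => inputsL ts
/-- The input colours of a list of monomials. -/
def inputsL : List Mon → List Col
  | [] => []
  | t :: ts => inputs t ++ inputsL ts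
end

mutual
/-- The (cohomological) degree: `μ_i` has degree `2 - i` and `f_i` has degree `1 - i`. -/
def deg : Mon → ℤ
  | inp _ => 0
  | mu _ ts => (2 - (ts.length : ℤ)) + degL ts
  | f _ ts => (1 - (ts.length : ℤ)) + degL ts
/-- The degree of the tensor product of a list of monomials. -/
def degL : List Mon → ℤ
  | [] => 0
  | t :: ts => deg t + degL ts
end

/-- The list `ts` can be plugged into `μ^c_i` or `f^c_i` with `i = ts.length`: the colours of the
inputs of these operations are `a, …, a, c`. -/
def Fits (c : Col) (ts : List Mon) : Prop :=
  ts.map out = List.replicate (ts.length - 1) Col.a ++ [c]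

/-- The monomials that form the basis of the free operad `A_∞^Col` on the operations `μ^a_i` and
`μ^m_i`, `i ≥ 2`. -/
inductive IsOp : Mon → Prop
  | inp (c : Col) : IsOp (inp c)
  | mu (c : Col) (ts : List Mon) : 2 ≤ ts.length → Fits c ts → (∀ t ∈ ts, IsOp t) → IsOp (mu c ts)

/-- The monomials that form the basis of the free bimodule `M_∞^Col` over `A_∞^Col` on the
operations `f^a_i` and `f^m_i`, `i ≥ 1`: operations `μ` after operations `f` after operations
`μ`. -/
inductive IsBi : Mon → Prop
  | f (c : Col) (ts : List Mon) : 1 ≤ ts.length → Fits c ts → (∀ t ∈ ts, IsOp t) → IsBi (f c ts)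
  | mu (c : Col) (ts : List Mon) : 2 ≤ ts.length → Fits c ts → (∀ t ∈ ts, IsBi t) → IsBi (mu c ts)

/-- The monomial contains some `μ^a_i` with `i > 2` or some `f^a_i` with `i > 1`. -/
inductive Killed : Mon → Prop
  | mu (ts : List Mon) : 2 < ts.length → Killed (mu Col.a ts)
  | f (ts : List Mon) : 1 < ts.length → Killed (f Col.a ts)
  | in_mu (c : Col) (ts : List Mon) (t : Mon) : t ∈ ts → Killed t → Killed (mu c ts)
  | in_f (c : Col) (ts : List Mon) (t : Mon) : t ∈ ts → Killed t → Killed (f c ts)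

/-- The output colour of the operation `μ_i` or `f_i` that can be applied to the list `ts`: the
colour of the last input. -/
def colL (ts : List Mon) : Col := (ts.getLast?.map out).getD Col.a

end Mon

/-! ## The differential -/

section Differential

variable (k : Type*) [Field k]

/-- The sign `(-1)^e` in `k`. -/
def sgn (e : ℤ) : k := ((e.negOnePow : ℤ) : k)

/-- The monomial `op (id^{⊗i} ⊗ μ_j ⊗ id^{⊗l})` applied to the list `ts` of length `i + j + l`,
up to the sign. -/
def plug (op : List Mon → Mon) (ts : List Mon) (i j : ℕ) : Mon :=
  op (ts.take i ++
    Mon.mu (Mon.colL ((ts.drop i).take j)) ((ts.drop i).take j) :: ts.drop (i + j))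

/-- The exponent of the sign `(-1)^{i + j l}` of `op (id^{⊗i} ⊗ μ_j ⊗ id^{⊗l})` in the defining
relations, plus the exponent of the Koszul sign that comes from moving `μ_j` past the first `i`
monomials of the list `ts`. -/
def plugExp (ts : List Mon) (i j : ℕ) : ℤ :=
  (i : ℤ) + (j : ℤ) * ((ts.length : ℤ) - i - j) + (2 - (j : ℤ)) * Mon.degL (ts.take i)

/-- `(d μ^c_n)(ts)`, where `n = ts.length` and
`d μ_n = - ∑ (-1)^{i + j l} μ_{i+1+l} (id^{⊗i} ⊗ μ_j ⊗ id^{⊗l})`,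
the sum over `i + j + l = n` with `2 ≤ j < n`. -/
noncomputable def dMu (c : Col) (ts : List Mon) : Mon →₀ k :=
  ∑ i ∈ Finset.range ts.length,
    ∑ j ∈ (Finset.Ico 2 ts.length).filter (fun j => i + j ≤ ts.length),
      Finsupp.single (plug (Mon.mu c) ts i j) (- sgn k (plugExp ts i j))

/-- The exponent of the sign of `μ_r (f_{i_1} ⊗ … ⊗ f_{i_r})`, which is
`(r-1)(i_1-1) + (r-2)(i_2-1) + … + (i_{r-1}-1)`,
plus the exponent of the Koszul sign that comes from applying `f_{i_1} ⊗ … ⊗ f_{i_r}` to a list of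
monomials that is cut into blocks of sizes `i_1, …, i_r`. -/
def blockExp : List (List Mon) → ℤ
  | [] => 0
  | b :: bs => (bs.length : ℤ) * ((b.length : ℤ) - 1)
      + Mon.degL b * (bs.map (fun b' => 1 - (b'.length : ℤ))).sum + blockExp bs

/-- `(d f^c_n)(ts)`, where `n = ts.length` and
`d f_n = ∑ (-1)^{i + j l} f_{i+1+l} (id^{⊗i} ⊗ μ_j ⊗ id^{⊗l}) - ∑ ± μ_r (f_{i_1} ⊗ … ⊗ f_{i_r})`,
the first sum over `i + j + l = n` with `2 ≤ j`, the second over `i_1 + … + i_r = n` with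
`2 ≤ r`. -/
noncomputable def dF (c : Col) (ts : List Mon) : Mon →₀ k :=
  (∑ i ∈ Finset.range ts.length,
    ∑ j ∈ (Finset.Icc 2 ts.length).filter (fun j => i + j ≤ ts.length),
      Finsupp.single (plug (Mon.f c) ts i j) (sgn k (plugExp ts i j)))
  - ∑ r ∈ (Finset.univ : Finset (Composition ts.length)).filter (fun r => 2 ≤ r.length),
      Finsupp.single
        (Mon.mu c ((ts.splitWrtComposition r).map (fun b => Mon.f (Mon.colL b) b)))
        (sgn k (blockExp (ts.splitWrtComposition r)))

mutual
/-- The differential of a monomial, by the graded Leibniz rule from the differentials of `μ_n` and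
`f_n`. -/
noncomputable def diff : Mon → (Mon →₀ k)
  | Mon.inp _ => 0
  | Mon.mu c ts => dMu k c ts
      + sgn k (2 - (ts.length : ℤ)) • Finsupp.mapDomain (fun us => Mon.mu c us) (diffL ts)
  | Mon.f c ts => dF k c ts
      + sgn k (1 - (ts.length : ℤ)) • Finsupp.mapDomain (fun us => Mon.f c us) (diffL ts)
/-- The differential of the tensor product of a list of monomials. -/
noncomputable def diffL : List Mon → (List Mon →₀ k)
  | [] => 0
  | t :: ts => Finsupp.mapDomain (fun u => u :: ts) (diff t)
      + sgn k (Mon.deg t) • Finsupp.mapDomain (fun us => t :: us) (diffL ts)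
end

/-! ## The complex `T(a^n, m; m)` -/

/-- The monomials in `M_∞^Col(a^n, m; m)`. -/
def biSet (n : ℕ) : Set Mon :=
  {t | t.IsBi ∧ t.out = Col.m ∧ t.inputs = List.replicate n Col.a ++ [Col.m]}

/-- The vector space `M_∞^Col(a^n, m; m)`. -/
abbrev MInf (n : ℕ) : Type _ := (biSet n : Set Mon) →₀ k

/-- The differential of `M_∞^Col(a^n, m; m)`. The differential of a monomial in `biSet n` is a
combination of monomials in `biSet n`, so `Finsupp.lsubtypeDomain`, which views it as an element
of `MInf k n`, does not discard anything. -/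
noncomputable def dMInf (n : ℕ) : MInf k n →ₗ[k] MInf k n :=
  Finsupp.linearCombination k
    (fun t : (biSet n : Set Mon) => Finsupp.lsubtypeDomain (R := k) (biSet n) (diff k t.1))

/-- The part in `M_∞^Col(a^n, m; m)` of the DG sub-bimodule of `M_∞^Col` generated by the action
of the ideal `I ⊂ A_∞^Col` generated by all `μ^a_i`, `i > 2`, and by all `f^a_i`, `i > 1`. The
sub-bimodule generated by these operations is spanned by the monomials that contain one of them,
and the DG sub-bimodule is the smallest subspace that contains it and is closed under the
differential. -/
noncomputable def relations (n : ℕ) : Submodule k (MInf k n) :=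
  sInf {N | Submodule.span k {x | ∃ t : (biSet n : Set Mon), t.1.Killed ∧ x = Finsupp.single t 1} ≤ N
    ∧ N ≤ N.comap (dMInf k n)}

theorem relations_le_comap (n : ℕ) : relations k n ≤ (relations k n).comap (dMInf k n) := by
  intro x hx
  simp only [relations, Submodule.mem_comap, Submodule.mem_sInf] at hx ⊢
  exact fun N hN => hN.2 (hx N hN)

/-- The vector space `T(a^n, m; m)`. -/
abbrev TComplex (n : ℕ) : Type _ := MInf k n ⧸ relations k n

/-- The differential of `T(a^n, m; m)`. -/
noncomputable def dT (n : ℕ) : TComplex k n →ₗ[k] TComplex k n :=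
  (relations k n).mapQ (relations k n) (dMInf k n) (relations_le_comap k n)

/-- The part of `T(a^n, m; m)` of (cohomological) degree `p`. -/
noncomputable def tOfDegree (n : ℕ) (p : ℤ) : Submodule k (TComplex k n) :=
  (Finsupp.supported k k {t : (biSet n : Set Mon) | t.1.deg = p}).map (relations k n).mkQ

/-- The class in `T(a^n, m; m)` of a monomial of `M_∞^Col(a^n, m; m)`. -/
noncomputable def classT (n : ℕ) (t : Mon) : TComplex k n :=
  (relations k n).mkQ (Finsupp.lsubtypeDomain (R := k) (biSet n) (Finsupp.single t (1 : k)))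

end Differential

/-! ## The operation of a forest-tree-forest triple -/

/-- `(μ^a_2)^r` with all `r + 1` inputs equal to `x`. -/
def comb (x : Mon) : ℕ → Mon
  | 0 => x
  | r + 1 => Mon.mu Col.a [x, comb x r]

/-- `μ^m_{b+1}((μ^a_2)^{t_1 - 1}, …, (μ^a_2)^{t_b - 1}, y)` for a tree `t = (t_1, …, t_b)`, where
`x` is plugged into all the inputs of colour `a`. -/
def muTree (x : Mon) (t : List ℕ) (y : Mon) : Mon :=
  Mon.mu Col.m (t.map (fun c => comb x (c - 1)) ++ [y])

/-- `f^m_{b+1}((μ^a_2)^{t_1 - 1}, …, (μ^a_2)^{t_b - 1}, y)` for a tree `t = (t_1, …, t_b)`. -/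
def fTree (t : List ℕ) (y : Mon) : Mon :=
  Mon.f Col.m (t.map (fun c => comb (Mon.inp Col.a) (c - 1)) ++ [y])

/-- The operation of a triple `(F, T, G)`: the trees of `F` and `G` give operations `μ^m`, the tree
`T` gives an operation `f^m`, and they are composed in the order in which they appear in the
triple, the first one being the outermost. The inputs of colour `a` of the trees in `F` come after
the map, so they are `f^a_1` of an input. -/
def Triple.mon (τ : Triple) : Mon :=
  τ.F.foldr (muTree (Mon.f Col.a [Mon.inp Col.a]))
    (fTree τ.T (τ.G.foldr (muTree (Mon.inp Col.a)) (Mon.inp Col.m)))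

end Freehedra

/-!
# Faces of the freehedron and short forest-tree-forest triples

A stretch is determined by its minimum and the gaps between its neighbouring elements, and the gaps
are the numbers of leaves on the branches of the tree of the stretch. In a nice expression each
stretch begins where the one before it ends, so the gaps determine the expression: this is the
inverse `Triple.expr` of `mapI` (`bijOn_mapI`). In terms of gaps a drop adds two neighbouring gaps,
and a break cuts a list of gaps in two, which gives the correspondence of transformations
(`transformations_iff`).

For the chain complexes, a triple with `n` leaves is recorded as a word with `n + 1` letters, one for
each position before, between or after the leaves. On words there is a differential `dF'` which is
defined by recursion on the word and acts on one letter at a time, except that moving an end of the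
tree `T` changes two letters. Its terms are the words of the facets, all coefficients are `±1`, and
its square is zero by a direct calculation (`dF_dF`). Hence it is an orientation of the freehedron
(`wordOrientation`). The same calculation without signs shows that at most two faces lie between a
face and a face of codimension two (`cF_thin`). Together with the connectedness of the boundaries of
faces (`conn_F`) this implies, by induction on the dimension, that any two orientations differ by
signs of the faces (`exists_sign_freehedron`). So it suffices to find an isomorphism for
`wordOrientation`.

The monomials that contain no `μ^a_i` with `i > 2` and no `f^a_i` with `i > 1` have a word, which
forgets how the operations `μ^a_2` are bracketed and whether they come before or after `f^a_1`. This
gives a linear map `opF` from the free bimodule to combinations of words; it is compatible with the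
differentials (`linearCombination_opF_diff`). In the differential of an operation `μ^m` or `f^m` only
those terms survive that contain an operation `μ^a_2`, which unites two branches, or another
operation of output `m`, which separates a tree; the differential of a monomial of colour `a`
contributes nothing, because its surviving terms express associativity of `μ^a_2` or multiplicativity
of `f^a_1` and cancel (`linearCombination_wt_diff`). So `opF` induces a map `opT` from `T` to
combinations of words.

Conversely, the differentials of `μ^a_3` and `f^a_2` in any context show that associativity and
multiplicativity hold in `T` (`step_assoc`, `step_mul`, `Step.congr`). With these every monomial that
is not zero in `T` can be rewritten as the operation of a triple (`exists_red_mon`). Hence the map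
from chains to `T` that sends a face to the operation of its triple is surjective, and it is
injective because its composition with `opT` sends different faces to different words.
-/

namespace Freehedra

/-! ### Stretches with prescribed gaps -/

/-- The sequence `a, a + g₁, a + g₁ + g₂, …` of partial sums of a list of gaps. -/
def pts : ℕ → List ℕ → List ℕ
  | a, [] => [a]
  | a, g :: gs => a :: pts (a + g) gs

/-- The stretch with minimum `a` and the given gaps between neighbouring elements. -/
def stretch (a : ℕ) (gs : List ℕ) : Finset ℕ := (pts a gs).toFinset

theorem stretch_nil (a : ℕ) : stretch a [] = {a} := by simp [stretch, pts]

theorem stretch_cons (a g : ℕ) (gs : List ℕ) :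
    stretch a (g :: gs) = insert a (stretch (a + g) gs) := by simp [stretch, pts]

theorem mem_stretch {a x : ℕ} {gs : List ℕ} :
    x ∈ stretch a gs ↔ ∃ u v, gs = u ++ v ∧ x = a + u.sum := by
  induction gs generalizing a with
  | nil =>
    simp only [stretch_nil, Finset.mem_singleton]
    constructor
    · rintro rfl; exact ⟨[], [], rfl, rfl⟩
    · rintro ⟨u, v, h, rfl⟩
      have := List.append_eq_nil_iff.1 h.symm
      simp [this.1]
  | cons g gs ih =>
    rw [stretch_cons, Finset.mem_insert, ih]
    constructor
    · rintro (rfl | ⟨u, v, rfl, rfl⟩)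
      · exact ⟨[], g :: gs, rfl, rfl⟩
      · exact ⟨g :: u, v, rfl, by simp [add_assoc]⟩
    · rintro ⟨u, v, h, rfl⟩
      cases u with
      | nil => exact Or.inl rfl
      | cons b u =>
        obtain ⟨rfl, rfl⟩ := List.cons.inj h
        exact Or.inr ⟨u, v, rfl, by simp [add_assoc]⟩

theorem le_of_mem_stretch {a x : ℕ} {gs : List ℕ} (h : x ∈ stretch a gs) : a ≤ x := by
  obtain ⟨u, v, -, rfl⟩ := mem_stretch.1 h; omega

theorem le_sum_of_mem_stretch {a x : ℕ} {gs : List ℕ} (h : x ∈ stretch a gs) :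
    x ≤ a + gs.sum := by
  obtain ⟨u, v, rfl, rfl⟩ := mem_stretch.1 h; simp

theorem start_mem_stretch (a : ℕ) (gs : List ℕ) : a ∈ stretch a gs :=
  mem_stretch.2 ⟨[], gs, rfl, rfl⟩

theorem end_mem_stretch (a : ℕ) (gs : List ℕ) : a + gs.sum ∈ stretch a gs :=
  mem_stretch.2 ⟨gs, [], by simp, rfl⟩

theorem isLeast_stretch (a : ℕ) (gs : List ℕ) : IsLeast (stretch a gs : Set ℕ) a :=
  ⟨start_mem_stretch a gs, fun _ h => le_of_mem_stretch h⟩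

theorem isGreatest_stretch (a : ℕ) (gs : List ℕ) :
    IsGreatest (stretch a gs : Set ℕ) (a + gs.sum) :=
  ⟨end_mem_stretch a gs, fun _ h => le_sum_of_mem_stretch h⟩

theorem stretch_append (a : ℕ) (u v : List ℕ) :
    stretch a (u ++ v) = stretch a u ∪ stretch (a + u.sum) v := by
  induction u generalizing a with
  | nil =>
    simp only [List.nil_append, stretch_nil, List.sum_nil, add_zero]
    rw [Finset.union_eq_right.2]
    simpa using start_mem_stretch a v
  | cons g u ih =>
    simp only [List.cons_append, stretch_cons, ih, List.sum_cons, Finset.insert_union, add_assoc]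

theorem lower_stretch (a : ℕ) (u v : List ℕ) :
    lower (stretch a (u ++ v)) (a + u.sum) = stretch a u := by
  ext x
  simp only [lower, Finset.mem_filter, stretch_append, Finset.mem_union]
  constructor
  · rintro ⟨h | h, hx⟩
    · exact h
    · obtain rfl := le_antisymm hx (le_of_mem_stretch h)
      exact end_mem_stretch _ _
  · exact fun h => ⟨Or.inl h, le_sum_of_mem_stretch h⟩

theorem upper_stretch (a : ℕ) (u v : List ℕ) :
    upper (stretch a (u ++ v)) (a + u.sum) = stretch (a + u.sum) v := by
  ext x
  simp only [upper, Finset.mem_filter, stretch_append, Finset.mem_union]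
  constructor
  · rintro ⟨h | h, hx⟩
    · obtain rfl := le_antisymm hx (le_sum_of_mem_stretch h)
      exact start_mem_stretch _ _
    · exact h
  · exact fun h => ⟨Or.inr h, le_of_mem_stretch h⟩

theorem erase_stretch (a p q : ℕ) (u v : List ℕ) (hp : 0 < p) (hq : 0 < q) :
    (stretch a (u ++ p :: q :: v)).erase (a + (u.sum + p)) = stretch a (u ++ (p + q) :: v) := by
  ext x
  simp only [Finset.mem_erase, stretch_append, Finset.mem_union, stretch_cons, Finset.mem_insert]
  constructor
  · rintro ⟨hx, h | h | h | h⟩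
    · exact Or.inl h
    · exact Or.inr (Or.inl h)
    · omega
    · exact Or.inr (Or.inr (by simpa [add_assoc] using h))
  · rintro (h | h | h)
    · have := le_sum_of_mem_stretch h
      exact ⟨by omega, Or.inl h⟩
    · exact ⟨by omega, Or.inr (Or.inl h)⟩
    · have := le_of_mem_stretch h
      exact ⟨by omega, Or.inr (Or.inr (Or.inr (by simpa [add_assoc] using h)))⟩

theorem isInner_stretch (a p q : ℕ) (u v : List ℕ) (hp : 0 < p) (hq : 0 < q) :
    IsInner (stretch a (u ++ p :: q :: v)) (a + (u.sum + p)) :=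
  ⟨mem_stretch.2 ⟨u ++ [p], q :: v, by simp, by simp⟩, ⟨a, start_mem_stretch _ _, by omega⟩,
    ⟨_, end_mem_stretch _ _, by simp; omega⟩⟩

theorem exists_of_isInner {a x : ℕ} {gs : List ℕ} (h : IsInner (stretch a gs) x) :
    ∃ u p q v, gs = u ++ p :: q :: v ∧ x = a + (u.sum + p) := by
  obtain ⟨hx, ⟨y, hy, hyx⟩, ⟨z, hz, hxz⟩⟩ := h
  obtain ⟨u, v, rfl, rfl⟩ := mem_stretch.1 hx
  have h1 := le_of_mem_stretch hy
  have h2 := le_sum_of_mem_stretch hz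
  rcases List.eq_nil_or_concat u with rfl | ⟨u, p, rfl⟩
  · simp at hyx; omega
  · cases v with
    | nil => simp at h2 hxz; omega
    | cons q v => exact ⟨u, p, q, v, by simp, by simp⟩

theorem pairwise_pts (a : ℕ) (gs : List ℕ) (h : ∀ g ∈ gs, 0 < g) :
    (pts a gs).Pairwise (· < ·) := by
  induction gs generalizing a with
  | nil => simp [pts]
  | cons g gs ih =>
    simp only [pts, List.pairwise_cons]
    refine ⟨fun x hx => ?_, ih _ fun g hg => h g (List.mem_cons_of_mem _ hg)⟩
    have := le_of_mem_stretch (List.mem_toFinset.2 hx)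
    have := h g (by simp)
    omega

theorem zipWith_pts (a : ℕ) (gs : List ℕ) :
    List.zipWith (fun x y => y - x) (pts a gs) (pts a gs).tail = gs := by
  induction gs generalizing a with
  | nil => simp [pts]
  | cons g gs ih =>
    have key : ∀ b, List.zipWith (fun x y => y - x) (a :: pts b gs) (pts b gs) =
        (b - a) :: List.zipWith (fun x y => y - x) (pts b gs) (pts b gs).tail := by
      intro b; cases gs <;> simp [pts]
    simp only [pts, List.tail_cons]
    rw [key, ih]
    simp

theorem sort_stretch (a : ℕ) (gs : List ℕ) (h : ∀ g ∈ gs, 0 < g) :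
    (stretch a gs).sort (· ≤ ·) = pts a gs := by
  have := pairwise_pts a gs h
  exact (List.toFinset_sort (r := (· ≤ ·)) (this.imp (fun h => h.ne))).2 (this.imp fun h => h.le)

theorem treeOfStretch_stretch (a : ℕ) (gs : List ℕ) (h : ∀ g ∈ gs, 0 < g) :
    treeOfStretch (stretch a gs) = gs.reverse := by
  simp only [treeOfStretch, sort_stretch a gs h, zipWith_pts]

theorem exists_pts (a : ℕ) (l : List ℕ) (h : (a :: l).Pairwise (· < ·)) :
    ∃ gs, (∀ g ∈ gs, 0 < g) ∧ a :: l = pts a gs := by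
  induction l generalizing a with
  | nil => exact ⟨[], by simp, rfl⟩
  | cons b l ih =>
    obtain ⟨gs, h1, h2⟩ := ih b (List.pairwise_cons.1 h).2
    have hab : a < b := (List.pairwise_cons.1 h).1 b (by simp)
    refine ⟨(b - a) :: gs, ?_, ?_⟩
    · simpa using ⟨hab, h1⟩
    · simp only [pts, h2]; congr 2; omega

theorem exists_eq_stretch (t : Finset ℕ) (ht : t.Nonempty) :
    ∃ a gs, (∀ g ∈ gs, 0 < g) ∧ t = stretch a gs := by
  have h1 : (t.sort (· ≤ ·)).Pairwise (· < ·) := t.sortedLT_sort.pairwise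
  have h2 : (t.sort (· ≤ ·)).toFinset = t := t.sort_toFinset _
  cases h : t.sort (· ≤ ·) with
  | nil => rw [h] at h2; simp at h2; simp [← h2] at ht
  | cons a l =>
    rw [h] at h1 h2
    obtain ⟨gs, h3, h4⟩ := exists_pts a l h1
    exact ⟨a, gs, h3, by rw [stretch, ← h4, h2]⟩

theorem card_stretch (a : ℕ) (gs : List ℕ) (h : ∀ g ∈ gs, 0 < g) :
    (stretch a gs).card = gs.length + 1 := by
  rw [← Finset.length_sort (· ≤ ·), sort_stretch a gs h]
  clear h
  induction gs generalizing a with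
  | nil => rfl
  | cons g gs ih => simp [pts, ih]

/-- Consecutive stretches with prescribed gaps; each begins where the one before it ends. -/
def stretchesOf : ℕ → List (List ℕ) → List (Finset ℕ)
  | _, [] => []
  | a, gs :: gss => stretch a gs :: stretchesOf (a + gs.sum) gss

theorem stretchesOf_append (a : ℕ) (A B : List (List ℕ)) :
    stretchesOf a (A ++ B) = stretchesOf a A ++ stretchesOf (a + (A.map List.sum).sum) B := by
  induction A generalizing a with
  | nil => simp [stretchesOf]
  | cons g A ih => simp [stretchesOf, ih, add_assoc]

theorem length_stretchesOf (a : ℕ) (A : List (List ℕ)) : (stretchesOf a A).length = A.length := by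
  induction A generalizing a with
  | nil => simp [stretchesOf]
  | cons g A ih => simp [stretchesOf, ih]

theorem map_treeOfStretch_stretchesOf (a : ℕ) (A : List (List ℕ))
    (h : ∀ gs ∈ A, ∀ g ∈ gs, 0 < g) :
    (stretchesOf a A).map treeOfStretch = A.map List.reverse := by
  induction A generalizing a with
  | nil => simp [stretchesOf]
  | cons g A ih =>
    simp only [stretchesOf, List.map_cons, treeOfStretch_stretch a g (h g (by simp))]
    rw [ih _ fun gs hgs => h gs (List.mem_cons_of_mem _ hgs)]

theorem isChain_coe_iff {S : List (Finset ℕ)} :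
    List.IsChain (fun t u : Set ℕ => ∃ x, IsGreatest t x ∧ IsLeast u x)
      (do let a ← S; pure (a : Set ℕ)) ↔
    S.IsChain (fun t u : Finset ℕ => ∃ x, IsGreatest (t : Set ℕ) x ∧ IsLeast (u : Set ℕ) x) := by
  have : (do let a ← S; pure (a : Set ℕ)) = S.map (fun a : Finset ℕ => (a : Set ℕ)) := by
    induction S with
    | nil => rfl
    | cons t S ih => simpa using ih
  rw [this, List.isChain_map]

/-- A chain of nonempty stretches is determined by its first element and its gaps. -/
theorem exists_eq_stretchesOf (S : List (Finset ℕ)) (a : ℕ) (hne : ∀ t ∈ S, t.Nonempty)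
    (hc : S.IsChain (fun t u : Finset ℕ => ∃ x, IsGreatest (t : Set ℕ) x ∧ IsLeast (u : Set ℕ) x))
    (h0 : ∀ t ∈ S.head?, IsLeast (t : Set ℕ) a) :
    ∃ gss : List (List ℕ), (∀ gs ∈ gss, ∀ g ∈ gs, 0 < g) ∧ S = stretchesOf a gss := by
  induction S generalizing a with
  | nil => exact ⟨[], by simp, rfl⟩
  | cons t S ih =>
    obtain ⟨b, gs, hgs, rfl⟩ := exists_eq_stretch t (hne t (by simp))
    obtain rfl : b = a := (isLeast_stretch b gs).unique (h0 _ (by simp))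
    obtain ⟨gss, h1, h2⟩ := ih (b + gs.sum) (fun t ht => hne t (List.mem_cons_of_mem _ ht))
      hc.tail (by
        intro u hu
        cases S with
        | nil => simp at hu
        | cons v S =>
          obtain ⟨x, hx, hx'⟩ := (List.isChain_cons_cons.1 hc).1
          simp only [List.head?_cons, Option.mem_def, Option.some.injEq] at hu
          subst hu
          rwa [(isGreatest_stretch b gs).unique hx])
    refine ⟨gs :: gss, ?_, by rw [h2]; rfl⟩
    simpa using ⟨hgs, h1⟩

theorem head_stretchesOf (a : ℕ) (gss : List (List ℕ)) :
    ∀ t ∈ (stretchesOf a gss).head?, IsLeast (t : Set ℕ) a := by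
  cases gss with
  | nil => simp [stretchesOf]
  | cons g gss => simpa [stretchesOf] using isLeast_stretch a g

theorem getLast_stretchesOf (a : ℕ) (gss : List (List ℕ)) :
    ∀ t ∈ (stretchesOf a gss).getLast?, IsGreatest (t : Set ℕ) (a + (gss.map List.sum).sum) := by
  rcases List.eq_nil_or_concat gss with rfl | ⟨A, g, rfl⟩
  · simp [stretchesOf]
  · intro t ht
    simp only [List.concat_eq_append, stretchesOf_append, stretchesOf] at ht
    simp only [List.getLast?_append, List.getLast?_singleton, Option.some_or, Option.mem_def,
      Option.some.injEq] at ht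
    subst ht
    simpa [add_assoc] using isGreatest_stretch (a + (A.map List.sum).sum) g

theorem isChain_stretchesOf (a : ℕ) (gss : List (List ℕ)) : (stretchesOf a gss).IsChain
    (fun t u : Finset ℕ => ∃ x, IsGreatest (t : Set ℕ) x ∧ IsLeast (u : Set ℕ) x) := by
  induction gss generalizing a with
  | nil => simp [stretchesOf]
  | cons g gss ih =>
    cases gss with
    | nil => simp [stretchesOf]
    | cons g' gss =>
      simp only [stretchesOf, List.isChain_cons_cons]
      exact ⟨⟨_, isGreatest_stretch a g, isLeast_stretch _ _⟩, ih (a + g.sum)⟩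

theorem exists_of_mem_stretchesOf {a : ℕ} {gss : List (List ℕ)} {t : Finset ℕ}
    (h : t ∈ stretchesOf a gss) : ∃ b, ∃ gs ∈ gss, t = stretch b gs ∧
      b + gs.sum ≤ a + (gss.map List.sum).sum := by
  induction gss generalizing a with
  | nil => simp [stretchesOf] at h
  | cons g gss ih =>
    rcases List.mem_cons.1 h with rfl | h
    · exact ⟨a, g, by simp, rfl, by simp⟩
    · obtain ⟨b, gs, h1, h2, h3⟩ := ih h
      refine ⟨b, gs, List.mem_cons_of_mem _ h1, h2, ?_⟩
      simpa [add_assoc] using h3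

/-! ### The inverse of the map `I` -/

/-- The gaps, in increasing order, of the stretches that a short forest comes from. -/
def gapsOf (F : List (List ℕ)) : List (List ℕ) := (F.map List.reverse).reverse

/-- The nice expression of a triple: the inverse of `mapI`. -/
def Triple.expr (τ : Triple) : NExpr where
  right := stretchesOf 0 (gapsOf τ.G)
  active := stretch (τ.G.map List.sum).sum τ.T.reverse
  left := stretchesOf ((τ.G.map List.sum).sum + τ.T.sum) (gapsOf τ.F)

theorem sum_gapsOf (F : List (List ℕ)) :
    ((gapsOf F).map List.sum).sum = (F.map List.sum).sum := by
  simp [gapsOf, List.map_reverse, List.sum_reverse, Function.comp_def]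

theorem gapsOf_append (A B : List (List ℕ)) : gapsOf (A ++ B) = gapsOf B ++ gapsOf A := by
  simp [gapsOf]

theorem gapsOf_cons (t : List ℕ) (B : List (List ℕ)) :
    gapsOf (t :: B) = gapsOf B ++ [t.reverse] := by
  simp [gapsOf]

theorem gapsOf_gapsOf (F : List (List ℕ)) : gapsOf (gapsOf F) = F := by
  simp [gapsOf, List.map_reverse]

theorem mem_gapsOf {F : List (List ℕ)} {t : List ℕ} : t ∈ gapsOf F ↔ t.reverse ∈ F := by
  simp only [gapsOf, List.mem_reverse, List.mem_map]
  constructor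
  · rintro ⟨x, hx, rfl⟩; simpa
  · exact fun h => ⟨_, h, by simp⟩

theorem stretches_expr (τ : Triple) : τ.expr.stretches =
    stretchesOf 0 (gapsOf (τ.F ++ τ.T :: τ.G)) := by
  simp [NExpr.stretches, Triple.expr, gapsOf_append, gapsOf_cons, stretchesOf_append,
    stretchesOf, sum_gapsOf]

theorem pos_gapsOf {F : List (List ℕ)} (h : ∀ t ∈ F, ∀ c ∈ t, 0 < c) :
    ∀ t ∈ gapsOf F, ∀ c ∈ t, 0 < c := by
  intro t ht c hc
  exact h _ (mem_gapsOf.1 ht) c (by simpa using hc)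

theorem mapI_expr {n : ℕ} {τ : Triple} (h : τ.IsTriple n) : mapI τ.expr = τ := by
  obtain ⟨F, T, G⟩ := τ
  have hp := h.pos
  simp only [List.mem_append, List.mem_cons] at hp
  have e : ∀ F : List (List ℕ), (List.map List.reverse (gapsOf F)).reverse = F := by
    intro F; simp [gapsOf, List.map_reverse]
  simp only [mapI, Triple.expr]
  rw [map_treeOfStretch_stretchesOf _ _ (pos_gapsOf fun t ht => hp t (Or.inl ht)),
    map_treeOfStretch_stretchesOf _ _ (pos_gapsOf fun t ht => hp t (Or.inr (Or.inr ht))),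
    treeOfStretch_stretch _ _ (by simpa using hp T (Or.inr (Or.inl rfl))), e, e]
  simp

theorem isNice_expr {n : ℕ} {τ : Triple} (h : τ.IsTriple n) : τ.expr.IsNice n := by
  have hp := pos_gapsOf h.pos
  have hl : ((gapsOf (τ.F ++ τ.T :: τ.G)).map List.sum).sum = n := by
    rw [sum_gapsOf, h.leaves]
  have card : ∀ (F : List (List ℕ)) (a : ℕ), (∀ t ∈ F, ∀ c ∈ t, 0 < c) → (∀ t ∈ F, t ≠ []) →
      ∀ t ∈ stretchesOf a (gapsOf F), 2 ≤ t.card := by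
    intro F a hF hF' t ht
    obtain ⟨b, gs, h1, rfl, -⟩ := exists_of_mem_stretchesOf ht
    rw [card_stretch _ _ (pos_gapsOf hF gs h1)]
    have h2 := hF' _ (mem_gapsOf.1 h1)
    have := List.length_pos_iff.2 h2
    rw [List.length_reverse] at this
    omega
  have hpos := h.pos
  simp only [List.mem_append, List.mem_cons] at hpos
  constructor
  · intro t ht x hx
    rw [stretches_expr] at ht
    obtain ⟨b, gs, h1, rfl, h3⟩ := exists_of_mem_stretchesOf ht
    have := le_sum_of_mem_stretch hx
    rw [hl] at h3
    simp; omega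
  · intro t ht
    rw [stretches_expr] at ht
    obtain ⟨b, gs, h1, rfl, h3⟩ := exists_of_mem_stretchesOf ht
    exact ⟨b, start_mem_stretch _ _⟩
  · rw [stretches_expr, isChain_coe_iff]; exact isChain_stretchesOf _ _
  · exact card _ _ (fun t ht => hpos t (Or.inl ht)) h.ne_nil_F
  · exact card _ _ (fun t ht => hpos t (Or.inr (Or.inr ht))) h.ne_nil_G
  · rw [stretches_expr]; exact head_stretchesOf _ _
  · rw [stretches_expr]
    have := getLast_stretchesOf 0 (gapsOf (τ.F ++ τ.T :: τ.G))
    rwa [hl, zero_add] at this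

theorem exists_expr_of_isNice {n : ℕ} {s : NExpr} (h : s.IsNice n) :
    ∃ τ : Triple, τ.IsTriple n ∧ s = τ.expr := by
  obtain ⟨gss, hpos, hS⟩ := exists_eq_stretchesOf _ 0 h.nonempty
    (isChain_coe_iff.1 h.consecutive) h.first
  obtain ⟨L, a, R⟩ := s
  have hsum := h.last
  rw [hS] at hsum
  simp only [NExpr.stretches] at hS
  have hlen : gss.length = R.length + (L.length + 1) := by
    rw [← length_stretchesOf 0 gss, ← hS]; simp
  obtain ⟨A, B', rfl, hA⟩ : ∃ A B', gss = A ++ B' ∧ A.length = R.length :=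
    ⟨gss.take R.length, gss.drop R.length, by simp, by simp; omega⟩
  obtain ⟨g, B, rfl⟩ : ∃ g B, B' = g :: B := by
    cases B' with
    | nil => simp at hlen; omega
    | cons g B => exact ⟨g, B, rfl⟩
  have hgood : stretchesOf 0 (A ++ g :: B) = R ++ a :: L := hS.symm
  rw [stretchesOf_append] at hgood
  obtain ⟨rfl, h2⟩ := List.append_inj hgood (by rw [length_stretchesOf, hA])
  simp only [stretchesOf, List.cons.injEq] at h2
  obtain ⟨rfl, rfl⟩ := h2
  have hne : ∀ (a : ℕ) (C : List (List ℕ)), (∀ gs ∈ C, ∀ g ∈ gs, 0 < g) →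
      (∀ t ∈ stretchesOf a C, 2 ≤ t.card) → ∀ t ∈ gapsOf C, t ≠ [] := by
    intro a C
    induction C generalizing a with
    | nil => simp [gapsOf]
    | cons g C ih =>
      intro h1 h2 t ht
      rw [gapsOf_cons, List.mem_append, List.mem_singleton] at ht
      rcases ht with ht | rfl
      · exact ih _ (fun gs hgs => h1 gs (List.mem_cons_of_mem _ hgs))
          (fun t ht => h2 t (List.mem_cons_of_mem _ ht)) t ht
      · have := h2 (stretch a g) (by simp [stretchesOf])
        rw [card_stretch _ _ (h1 g (by simp))] at this
        intro h3
        simp at h3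
        simp [h3] at this
  simp only [List.mem_append, List.mem_cons] at hpos
  refine ⟨⟨gapsOf B, g.reverse, gapsOf A⟩, ⟨?_, ?_, ?_, ?_⟩, ?_⟩
  · exact hne _ B (fun gs hgs => hpos gs (Or.inr (Or.inr hgs))) h.two_le_left
  · exact hne _ A (fun gs hgs => hpos gs (Or.inl hgs)) h.two_le_right
  · intro t ht
    simp only [List.mem_append, List.mem_cons] at ht
    rcases ht with ht | rfl | ht
    · exact pos_gapsOf (fun gs hgs => hpos gs (Or.inr (Or.inr hgs))) t ht
    · simpa using hpos g (Or.inr (Or.inl rfl))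
    · exact pos_gapsOf (fun gs hgs => hpos gs (Or.inl hgs)) t ht
  · have key := getLast_stretchesOf 0 (A ++ g :: B)
    have hex : ∃ t, t ∈ (stretchesOf 0 (A ++ g :: B)).getLast? := by
      have : stretchesOf 0 (A ++ g :: B) ≠ [] := by
        intro h0
        have := congrArg List.length h0
        simp [length_stretchesOf] at this
      exact ⟨_, List.getLast?_eq_some_getLast this⟩
    obtain ⟨t, ht⟩ := hex
    have := (key t ht).unique (hsum t ht)
    rw [← this, show gapsOf B ++ g.reverse :: gapsOf A = gapsOf (A ++ g :: B) by
      simp [gapsOf_append, gapsOf_cons], sum_gapsOf]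
    simp
  · simp [Triple.expr, gapsOf_gapsOf, sum_gapsOf, List.sum_reverse]

theorem expr_mapI {n : ℕ} {s : NExpr} (h : s.IsNice n) : (mapI s).expr = s := by
  obtain ⟨τ, hτ, rfl⟩ := exists_expr_of_isNice h
  rw [mapI_expr hτ]

theorem isTriple_mapI {n : ℕ} {s : NExpr} (h : s.IsNice n) : (mapI s).IsTriple n := by
  obtain ⟨τ, hτ, rfl⟩ := exists_expr_of_isNice h
  rwa [mapI_expr hτ]

theorem bijOn_mapI (n : ℕ) :
    Set.BijOn mapI {s | s.IsNice n} {τ | τ.IsTriple n} :=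
  ⟨fun _ h => isTriple_mapI h,
    fun s hs s' hs' h => by rw [← expr_mapI hs, ← expr_mapI hs', h],
    fun τ hτ => ⟨τ.expr, isNice_expr hτ, mapI_expr hτ⟩⟩

/-! ### Face transformations and terms of the differential -/

theorem treeOfStretch_erase {t : Finset ℕ} {x : ℕ} (hx : IsInner t x) :
    ∃ u p q v, treeOfStretch t = u ++ p :: q :: v ∧
      treeOfStretch (t.erase x) = u ++ (p + q) :: v := by
  obtain ⟨a, gs, hgs, rfl⟩ := exists_eq_stretch t ⟨x, hx.1⟩
  obtain ⟨u, p, q, v, rfl, rfl⟩ := exists_of_isInner hx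
  simp only [List.mem_append, List.mem_cons] at hgs
  have hp := hgs p (by simp)
  have hq := hgs q (by simp)
  refine ⟨v.reverse, q, p, u.reverse, ?_, ?_⟩
  · rw [treeOfStretch_stretch _ _ (by simpa using hgs)]; simp
  · rw [erase_stretch _ _ _ _ _ hp hq, treeOfStretch_stretch]
    · simp [add_comm]
    · intro g hg
      simp only [List.mem_append, List.mem_cons] at hg
      rcases hg with hg | rfl | hg
      · exact hgs g (by simp [hg])
      · omega
      · exact hgs g (by simp [hg])

theorem treeOfStretch_break {t : Finset ℕ} {x : ℕ} (hx : x ∈ t) :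
    treeOfStretch t = treeOfStretch (upper t x) ++ treeOfStretch (lower t x) ∧
      ((∃ z ∈ t, x < z) → treeOfStretch (upper t x) ≠ []) ∧
      ((∃ y ∈ t, y < x) → treeOfStretch (lower t x) ≠ []) := by
  obtain ⟨a, gs, hgs, rfl⟩ := exists_eq_stretch t ⟨x, hx⟩
  obtain ⟨u, v, rfl, rfl⟩ := mem_stretch.1 hx
  simp only [List.mem_append] at hgs
  rw [upper_stretch, lower_stretch, treeOfStretch_stretch _ _ (by simpa using hgs),
    treeOfStretch_stretch _ _ fun g hg => hgs g (Or.inl hg),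
    treeOfStretch_stretch _ _ fun g hg => hgs g (Or.inr hg)]
  refine ⟨by simp, ?_, ?_⟩
  · rintro ⟨z, hz, hxz⟩ h
    have := le_sum_of_mem_stretch hz
    simp at h
    simp [h] at this
    omega
  · rintro ⟨z, hz, hxz⟩ h
    have := le_of_mem_stretch hz
    simp at h
    simp [h] at hxz
    omega

theorem uTerm_of_drop {s s' : NExpr} (h : Drop s s') : UTerm (mapI s) (mapI s') := by
  induction h with
  | left A B t a R x hx =>
    obtain ⟨u, p, q, v, h1, h2⟩ := treeOfStretch_erase hx
    simp only [mapI, List.map_append, List.map_cons, List.reverse_append, List.reverse_cons,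
      List.append_assoc, h1, h2]
    exact UTerm.F _ _ _ _ _ _ _ _
  | active L a R x hx =>
    obtain ⟨u, p, q, v, h1, h2⟩ := treeOfStretch_erase hx
    simp only [mapI, h1, h2]
    exact UTerm.T _ _ _ _ _ _
  | right L a t A B x hx =>
    obtain ⟨u, p, q, v, h1, h2⟩ := treeOfStretch_erase hx
    simp only [mapI, List.map_append, List.map_cons, List.reverse_append, List.reverse_cons,
      List.append_assoc, h1, h2]
    exact UTerm.G _ _ _ _ _ _ _ _

theorem sepF_of_innerBreakLeft {s s' : NExpr} (h : InnerBreakLeft s s') :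
    SepF (mapI s) (mapI s') := by
  induction h with
  | mk A B t a R x hx =>
    obtain ⟨h1, h2, h3⟩ := treeOfStretch_break hx.1
    simp only [mapI, List.map_append, List.map_cons, List.reverse_append, List.reverse_cons,
      List.append_assoc, h1]
    exact SepF.mk _ _ _ _ _ _ (h2 hx.2.2) (h3 hx.2.1)

theorem sepG_of_innerBreakRight {s s' : NExpr} (h : InnerBreakRight s s') :
    SepG (mapI s) (mapI s') := by
  induction h with
  | mk L a t A B x hx =>
    obtain ⟨h1, h2, h3⟩ := treeOfStretch_break hx.1
    simp only [mapI, List.map_append, List.map_cons, List.reverse_append, List.reverse_cons,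
      List.append_assoc, h1]
    exact SepG.mk _ _ _ _ _ _ (h2 hx.2.2) (h3 hx.2.1)

theorem sepLeft_or_moveLeft_of_rightOuterBreak {s s' : NExpr} (h : RightOuterBreak s s') :
    SepLeft (mapI s) (mapI s') ∨ MoveLeft (mapI s) (mapI s') := by
  induction h with
  | mk L a R x hx hz =>
    obtain ⟨h1, h2, -⟩ := treeOfStretch_break hx
    simp only [mapI, List.map_cons, List.reverse_cons, h1]
    by_cases h : treeOfStretch (lower a x) = []
    · rw [h, List.append_nil]
      exact Or.inr (MoveLeft.mk _ _ _ (h2 hz))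
    · exact Or.inl (SepLeft.mk _ _ _ _ (h2 hz) h)

theorem sepRight_or_moveRight_of_leftOuterBreak {s s' : NExpr} (h : LeftOuterBreak s s') :
    SepRight (mapI s) (mapI s') ∨ MoveRight (mapI s) (mapI s') := by
  induction h with
  | mk L a R x hx hz =>
    obtain ⟨h1, -, h2⟩ := treeOfStretch_break hx
    simp only [mapI, List.map_append, List.map_cons, List.map_nil, List.reverse_append,
      List.reverse_cons, List.reverse_nil, List.nil_append, List.cons_append, h1]
    by_cases h : treeOfStretch (upper a x) = []
    · rw [h, List.nil_append]
      exact Or.inr (MoveRight.mk _ _ _ (h2 hz))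
    · exact Or.inl (SepRight.mk _ _ _ _ h (h2 hz))

theorem stretchesOf_gapsOf_middle (a : ℕ) (A B : List (List ℕ)) (t : List ℕ) :
    stretchesOf a (gapsOf (A ++ t :: B)) = stretchesOf a (gapsOf B) ++
      stretch (a + (B.map List.sum).sum) t.reverse ::
        stretchesOf (a + (B.map List.sum).sum + t.sum) (gapsOf A) := by
  simp [gapsOf_append, gapsOf_cons, stretchesOf_append, stretchesOf, sum_gapsOf, List.sum_reverse,
    add_assoc]

theorem erase_stretch_reverse (a p q : ℕ) (u v : List ℕ) (hp : 0 < p) (hq : 0 < q) :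
    IsInner (stretch a (u ++ p :: q :: v).reverse) (a + (v.sum + q)) ∧
    (stretch a (u ++ p :: q :: v).reverse).erase (a + (v.sum + q)) =
      stretch a (u ++ (p + q) :: v).reverse := by
  have h1 := erase_stretch a q p v.reverse u.reverse hq hp
  have h2 := isInner_stretch a q p v.reverse u.reverse hq hp
  rw [List.sum_reverse] at h1 h2
  simp only [List.reverse_append, List.reverse_cons, List.append_assoc, List.cons_append,
    List.nil_append, add_comm p q]
  exact ⟨h2, h1⟩

theorem sum_pos_of_ne_nil {t : List ℕ} (h : ∀ c ∈ t, 0 < c) (hne : t ≠ []) : 0 < t.sum := by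
  cases t with
  | nil => exact absurd rfl hne
  | cons c t => have := h c (by simp); simp; omega

theorem stretch_reverse_break (a : ℕ) (tl tr : List ℕ) :
    lower (stretch a (tl ++ tr).reverse) (a + tr.sum) = stretch a tr.reverse ∧
    upper (stretch a (tl ++ tr).reverse) (a + tr.sum) = stretch (a + tr.sum) tl.reverse ∧
    a + tr.sum ∈ stretch a (tl ++ tr).reverse ∧
    (tl.sum ≠ 0 → ∃ z ∈ stretch a (tl ++ tr).reverse, a + tr.sum < z) ∧
    (tr.sum ≠ 0 → ∃ y ∈ stretch a (tl ++ tr).reverse, y < a + tr.sum) := by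
  have h1 := lower_stretch a tr.reverse tl.reverse
  have h2 := upper_stretch a tr.reverse tl.reverse
  rw [List.sum_reverse] at h1 h2
  rw [List.reverse_append]
  refine ⟨h1, h2, mem_stretch.2 ⟨_, _, rfl, by rw [List.sum_reverse]⟩, fun h => ?_, fun h => ?_⟩
  · refine ⟨_, end_mem_stretch _ _, ?_⟩
    simp [List.sum_reverse]; omega
  · exact ⟨_, start_mem_stretch _ _, by omega⟩

theorem drop_expr {n : ℕ} {τ τ' : Triple} (hτ : τ.IsTriple n) (h : UTerm τ τ') :
    Drop τ.expr τ'.expr := by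
  have hpos := hτ.pos
  cases h with
  | F A B u v p q T G =>
    simp only [List.mem_append, List.mem_cons] at hpos
    have hp := hpos (u ++ p :: q :: v) (by simp) p (by simp)
    have hq := hpos (u ++ p :: q :: v) (by simp) q (by simp)
    simp only [Triple.expr, stretchesOf_gapsOf_middle]
    have h := erase_stretch_reverse ((G.map List.sum).sum + T.sum + (B.map List.sum).sum)
      p q u v hp hq
    rw [← h.2, show (u ++ (p + q) :: v).sum = (u ++ p :: q :: v).sum by simp [add_assoc]]
    exact Drop.left _ _ _ _ _ _ h.1
  | T F u v p q G =>
    simp only [List.mem_append, List.mem_cons] at hpos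
    have hp := hpos (u ++ p :: q :: v) (by simp) p (by simp)
    have hq := hpos (u ++ p :: q :: v) (by simp) q (by simp)
    simp only [Triple.expr]
    have h := erase_stretch_reverse (G.map List.sum).sum p q u v hp hq
    rw [← h.2, show (u ++ (p + q) :: v).sum = (u ++ p :: q :: v).sum by simp [add_assoc]]
    exact Drop.active _ _ _ _ h.1
  | G F T A B u v p q =>
    simp only [List.mem_append, List.mem_cons] at hpos
    have hp := hpos (u ++ p :: q :: v) (by simp) p (by simp)
    have hq := hpos (u ++ p :: q :: v) (by simp) q (by simp)
    simp only [Triple.expr, stretchesOf_gapsOf_middle]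
    have h := erase_stretch_reverse (0 + (B.map List.sum).sum) p q u v hp hq
    rw [← h.2]
    simp only [List.map_append, List.map_cons,
      show (u ++ (p + q) :: v).sum = (u ++ p :: q :: v).sum by simp [add_assoc]]
    exact Drop.right _ _ _ _ _ _ h.1

theorem innerBreakLeft_expr {n : ℕ} {τ τ' : Triple} (hτ : τ.IsTriple n) (h : SepF τ τ') :
    InnerBreakLeft τ.expr τ'.expr := by
  have hpos := hτ.pos
  cases h with
  | mk A B tl tr T G hl hr =>
    simp only [List.mem_append, List.mem_cons] at hpos
    have h0 := hpos (tl ++ tr) (by simp)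
    simp only [List.mem_append] at h0
    have h1 := sum_pos_of_ne_nil (fun c hc => h0 c (Or.inl hc)) hl
    have h2 := sum_pos_of_ne_nil (fun c hc => h0 c (Or.inr hc)) hr
    obtain ⟨e1, e2, e3, e4, e5⟩ := stretch_reverse_break
      ((G.map List.sum).sum + T.sum + (B.map List.sum).sum) tl tr
    have := InnerBreakLeft.mk (stretchesOf ((G.map List.sum).sum + T.sum) (gapsOf B))
      (stretchesOf ((G.map List.sum).sum + T.sum + (B.map List.sum).sum + (tl ++ tr).sum)
        (gapsOf A)) _ (stretch (G.map List.sum).sum T.reverse) (stretchesOf 0 (gapsOf G))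
      _ ⟨e3, e5 h2.ne', e4 h1.ne'⟩
    rw [e1, e2] at this
    simp only [Triple.expr, stretchesOf_gapsOf_middle]
    convert this using 2
    simp only [gapsOf_cons, stretchesOf_append, sum_gapsOf, stretchesOf, List.map_cons,
      List.sum_cons, List.sum_append, List.append_assoc, List.cons_append, List.nil_append]
    rw [show ((G.map List.sum).sum + T.sum) + (tr.sum + (B.map List.sum).sum) + tl.sum =
        ((G.map List.sum).sum + T.sum) + (B.map List.sum).sum + (tl.sum + tr.sum) by omega,
      show ((G.map List.sum).sum + T.sum) + (tr.sum + (B.map List.sum).sum) =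
        ((G.map List.sum).sum + T.sum) + (B.map List.sum).sum + tr.sum by omega]

theorem innerBreakRight_expr {n : ℕ} {τ τ' : Triple} (hτ : τ.IsTriple n) (h : SepG τ τ') :
    InnerBreakRight τ.expr τ'.expr := by
  have hpos := hτ.pos
  cases h with
  | mk F T A B tl tr hl hr =>
    simp only [List.mem_append, List.mem_cons] at hpos
    have h0 := hpos (tl ++ tr) (by simp)
    simp only [List.mem_append] at h0
    have h1 := sum_pos_of_ne_nil (fun c hc => h0 c (Or.inl hc)) hl
    have h2 := sum_pos_of_ne_nil (fun c hc => h0 c (Or.inr hc)) hr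
    obtain ⟨e1, e2, e3, e4, e5⟩ := stretch_reverse_break (0 + (B.map List.sum).sum) tl tr
    have := InnerBreakRight.mk
      (stretchesOf (((A ++ (tl ++ tr) :: B).map List.sum).sum + T.sum) (gapsOf F))
      (stretch ((A ++ (tl ++ tr) :: B).map List.sum).sum T.reverse) _
      (stretchesOf 0 (gapsOf B))
      (stretchesOf (0 + (B.map List.sum).sum + (tl ++ tr).sum) (gapsOf A))
      _ ⟨e3, e5 h2.ne', e4 h1.ne'⟩
    rw [e1, e2] at this
    have hs : ((A ++ tl :: tr :: B).map List.sum).sum =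
        ((A ++ (tl ++ tr) :: B).map List.sum).sum := by simp [add_assoc]
    simp only [Triple.expr, stretchesOf_gapsOf_middle, hs]
    convert this using 2
    simp only [gapsOf_cons, stretchesOf_append, sum_gapsOf, stretchesOf, List.map_cons,
      List.sum_cons, List.sum_append, List.append_assoc, List.cons_append, List.nil_append]
    rw [show 0 + (tr.sum + (B.map List.sum).sum) + tl.sum =
        0 + (B.map List.sum).sum + (tl.sum + tr.sum) by omega,
      show 0 + (tr.sum + (B.map List.sum).sum) =
        0 + (B.map List.sum).sum + tr.sum by omega]

theorem rightOuterBreak_expr {F G : List (List ℕ)} {tl tr : List ℕ} (h : tl.sum ≠ 0) :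
    RightOuterBreak (Triple.expr ⟨F, tl ++ tr, G⟩) (Triple.expr ⟨F ++ [tl], tr, G⟩) := by
  obtain ⟨e1, e2, e3, e4, e5⟩ := stretch_reverse_break (G.map List.sum).sum tl tr
  have := RightOuterBreak.mk
    (stretchesOf ((G.map List.sum).sum + (tl ++ tr).sum) (gapsOf F)) _
    (stretchesOf 0 (gapsOf G)) _ e3 (e4 h)
  rw [e1, e2] at this
  simp only [Triple.expr]
  convert this using 2
  simp [gapsOf, stretchesOf, List.sum_reverse, add_assoc, add_comm tl.sum]

theorem leftOuterBreak_expr {F G : List (List ℕ)} {tl tr : List ℕ} (h : tr.sum ≠ 0) :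
    LeftOuterBreak (Triple.expr ⟨F, tl ++ tr, G⟩) (Triple.expr ⟨F, tl, tr :: G⟩) := by
  obtain ⟨e1, e2, e3, e4, e5⟩ := stretch_reverse_break (G.map List.sum).sum tl tr
  have := LeftOuterBreak.mk
    (stretchesOf ((G.map List.sum).sum + (tl ++ tr).sum) (gapsOf F)) _
    (stretchesOf 0 (gapsOf G)) _ e3 (e5 h)
  rw [e1, e2] at this
  simp only [Triple.expr]
  convert this using 2
  · simp [add_assoc, add_comm]
  · simp [add_comm]
  · rw [gapsOf_cons, stretchesOf_append, sum_gapsOf]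
    simp [stretchesOf]

theorem rightOuterBreak_expr_of {n : ℕ} {τ τ' : Triple} (hτ : τ.IsTriple n)
    (h : SepLeft τ τ' ∨ MoveLeft τ τ') : RightOuterBreak τ.expr τ'.expr := by
  have hpos := hτ.pos
  rcases h with h | h
  · cases h with
    | mk F tl tr G hl hr =>
      refine rightOuterBreak_expr (sum_pos_of_ne_nil (fun c hc => ?_) hl).ne'
      exact hpos (tl ++ tr) (by simp) c (by simp [hc])
  · cases h with
    | mk F T G hT =>
      have := rightOuterBreak_expr (F := F) (G := G) (tl := T) (tr := [])
        (sum_pos_of_ne_nil (fun c hc => hpos T (by simp) c hc) hT).ne'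
      rwa [List.append_nil] at this

theorem leftOuterBreak_expr_of {n : ℕ} {τ τ' : Triple} (hτ : τ.IsTriple n)
    (h : SepRight τ τ' ∨ MoveRight τ τ') : LeftOuterBreak τ.expr τ'.expr := by
  have hpos := hτ.pos
  rcases h with h | h
  · cases h with
    | mk F tl tr G hl hr =>
      refine leftOuterBreak_expr (sum_pos_of_ne_nil (fun c hc => ?_) hr).ne'
      exact hpos (tl ++ tr) (by simp) c (by simp [hc])
  · cases h with
    | mk F T G hT =>
      exact leftOuterBreak_expr (F := F) (G := G) (tl := []) (tr := T)
        (sum_pos_of_ne_nil (fun c hc => hpos T (by simp) c hc) hT).ne'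

/-- The correspondence between face transformations and terms of the differential. -/
theorem transformations_iff {n : ℕ} (s s' : Face n) :
    (Drop s.1 s'.1 ↔ UTerm (mapI s.1) (mapI s'.1)) ∧
    (InnerBreakLeft s.1 s'.1 ↔ SepF (mapI s.1) (mapI s'.1)) ∧
    (InnerBreakRight s.1 s'.1 ↔ SepG (mapI s.1) (mapI s'.1)) ∧
    (RightOuterBreak s.1 s'.1 ↔
      SepLeft (mapI s.1) (mapI s'.1) ∨ MoveLeft (mapI s.1) (mapI s'.1)) ∧
    (LeftOuterBreak s.1 s'.1 ↔
      SepRight (mapI s.1) (mapI s'.1) ∨ MoveRight (mapI s.1) (mapI s'.1)) := by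
  have hτ := isTriple_mapI s.2
  have h1 := expr_mapI s.2
  have h2 := expr_mapI s'.2
  refine ⟨⟨uTerm_of_drop, fun h => ?_⟩, ⟨sepF_of_innerBreakLeft, fun h => ?_⟩,
    ⟨sepG_of_innerBreakRight, fun h => ?_⟩, ⟨sepLeft_or_moveLeft_of_rightOuterBreak, fun h => ?_⟩,
    ⟨sepRight_or_moveRight_of_leftOuterBreak, fun h => ?_⟩⟩
  · simpa only [h1, h2] using drop_expr hτ h
  · simpa only [h1, h2] using innerBreakLeft_expr hτ h
  · simpa only [h1, h2] using innerBreakRight_expr hτ h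
  · simpa only [h1, h2] using rightOuterBreak_expr_of hτ h
  · simpa only [h1, h2] using leftOuterBreak_expr_of hτ h

/-! ### The complex of words -/

/-- Letters for the positions before, between and after the leaves of a triple (the inputs of colour
`a`), from left to right. With `u` the neighbouring leaves lie on one branch, and with `b` they lie
on neighbouring branches of a tree. With `s` a tree of `F` begins or a tree of `G` ends. The tree
`T` begins at the letter `o` and ends at the letter `c`, and a trivial tree `T` sits at the letter
`oc`. -/
inductive Letter
  | u
  | b
  | s
  | o
  | c
  | oc

/-- Words in the letters. -/
abbrev Word : Type := List Letter

section Words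

open Letter

variable {R : Type*} [CommRing R]

/-- Put a letter in front of every word of a linear combination of words. -/
noncomputable def push (l : Letter) : (Word →₀ R) →ₗ[R] (Word →₀ R) :=
  Finsupp.lmapDomain R R (List.cons l)

/-- The linear combination that consists of one word. -/
noncomputable def wd (w : Word) : Word →₀ R := Finsupp.single w 1

/-- Linear extension of a map that is given on words. -/
noncomputable abbrev ext (f : Word → Word →₀ R) : (Word →₀ R) →ₗ[R] (Word →₀ R) :=
  Finsupp.linearCombination R f

/-- The differential of words without the letters `o`, `c` and `oc`: at a letter `b` two branches of
a tree are united, which gives `u`, or the tree is separated, which gives `s`. The parameter `η` is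
`-1` for the differential itself; the value `1` replaces all coefficients by their absolute
values. -/
noncomputable def dG (η : R) : Word → Word →₀ R
  | u :: w => push u (dG η w)
  | s :: w => push s (dG η w)
  | b :: w => η • push u (wd w) + push s (wd w) + η • push b (dG η w)
  | _ => 0

/-- Replace the letter `c` by `s`: the tree that ends there becomes a tree of `G`. -/
def closeT : Word → Word
  | c :: w => s :: w
  | l :: w => l :: closeT w
  | [] => []

/-- For the part of a word after the letter `o`: the sum of all ways to let `T` begin further to the
right. What lies to the left of the new beginning becomes a tree of `F`. -/
noncomputable def openT : Word → Word →₀ R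
  | u :: w => push u (openT w)
  | s :: w => push s (openT w)
  | b :: w => push o (wd w) + push b (openT w)
  | c :: w => push oc (wd w)
  | _ => 0

/-- The differential of the part of a word after the letter `o`: at a letter `b` two branches of `T`
are united, or `T` ends there and the rest of it becomes a tree of `G`. -/
noncomputable def dT' (η : R) : Word → Word →₀ R
  | u :: w => push u (dT' η w)
  | s :: w => push s (dT' η w)
  | b :: w => push u (wd w) + η • push c (wd (closeT w)) + η • push b (dT' η w)
  | c :: w => η • push c (dG η w)
  | _ => 0

/-- The differential of words. At the letter `o` either a left part of `T`, or all of it, becomes a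
tree of `F`, or all of `T` becomes a tree of `G`, or the differential acts inside `T`. -/
noncomputable def dF' (η : R) : Word → Word →₀ R
  | u :: w => push u (dF' η w)
  | s :: w => push s (dF' η w)
  | b :: w => η • push u (wd w) + push s (wd w) + η • push b (dF' η w)
  | o :: w => η • push s (openT w) + push oc (wd (closeT w)) + push o (dT' η w)
  | oc :: w => push oc (dG η w)
  | _ => 0

@[simp] theorem ext_wd (f : Word → Word →₀ R) (w : Word) : ext f (wd w) = f w := by
  simp [ext, wd]

@[simp] theorem push_nil (l : Letter) (x : Word →₀ R) : push l x [] = 0 :=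
  Finsupp.mapDomain_of_notMem_range _ _ (by simp)

@[simp] theorem push_cons_self (l : Letter) (x : Word →₀ R) (w : Word) :
    push l x (l :: w) = x w :=
  Finsupp.mapDomain_apply (List.cons_injective) _ _

@[simp] theorem push_cons_ne {l l' : Letter} (h : l ≠ l') (x : Word →₀ R) (w : Word) :
    push l x (l' :: w) = 0 :=
  Finsupp.mapDomain_of_notMem_range _ _ (by rintro ⟨y, hy⟩; exact h (List.cons.inj hy).1)

theorem push_wd (l : Letter) (w : Word) : push l (wd w : Word →₀ R) = wd (l :: w) := by
  simp [push, wd]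

theorem ext_push (f : Word → Word →₀ R) (l : Letter) (x : Word →₀ R) :
    ext f (push l x) = ext (fun w => f (l :: w)) x := by
  simp [ext, push, Finsupp.linearCombination_mapDomain, Function.comp_def]

theorem ext_add (f g : Word → Word →₀ R) (x : Word →₀ R) :
    ext (fun w => f w + g w) x = ext f x + ext g x := by
  simp [ext, Finsupp.linearCombination_apply, Finsupp.sum, smul_add, Finset.sum_add_distrib]

theorem ext_smul (f : Word → Word →₀ R) (a : R) (x : Word →₀ R) :
    ext (fun w => a • f w) x = a • ext f x := by
  simp [ext, Finsupp.linearCombination_apply, Finsupp.sum, Finset.smul_sum, smul_comm a]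

theorem ext_comp_push (f : Word → Word →₀ R) (l : Letter) (x : Word →₀ R) :
    ext (fun w => push l (f w)) x = push l (ext f x) := by
  simp [ext, Finsupp.linearCombination_apply, Finsupp.sum, map_sum]

theorem ext_wd_eq (x : Word →₀ R) : ext (fun w => wd w) x = x := by
  simp [ext, wd, Finsupp.linearCombination_apply]

/-- The linear extension of `closeT`. -/
noncomputable abbrev KT : (Word →₀ R) →ₗ[R] (Word →₀ R) := ext fun w => wd (closeT w)

variable {η : R}

/-- It does not matter whether `T` becomes a tree of `G` before or after the differential acts on
it. -/
theorem dG_closeT (hη : η * η = 1) (w : Word) :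
    dG η (closeT w) = η • KT (dT' η w) := by
  induction w with
  | nil => simp [closeT, dG, dT']
  | cons l w ih =>
    cases l <;>
      simp only [closeT, dG, dT', map_add, map_smul, ext_push, ← push_wd, ext_comp_push,
        ext_wd_eq, ext_wd, ih, smul_add, smul_smul, hη, one_smul, map_zero, smul_zero]

/-- All coefficients are `0`, `1` or `-1`. -/
def Bdd (x : Word →₀ ℤ) : Prop := ∀ t, |x t| ≤ 1

theorem bdd_zero : Bdd 0 := by intro t; simp

theorem bdd_wd (w : Word) : Bdd (wd w) := by
  intro t
  by_cases h : w = t <;> simp [wd, h]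

theorem bdd_push {x : Word →₀ ℤ} (h : Bdd x) (l : Letter) : Bdd (push l x) := by
  intro t
  rcases t with _ | ⟨l', t⟩
  · simp
  · by_cases hl : l = l'
    · subst hl; simpa using h t
    · simp [hl]

theorem bdd_smul {η : ℤ} (hη : η * η = 1) {x : Word →₀ ℤ} (h : Bdd x) : Bdd (η • x) := by
  intro t
  have : |η| = 1 := by
    rcases Int.mul_eq_one_iff_eq_one_or_neg_one.1 hη with h | h <;> simp [h.1]
  simpa [abs_mul, this] using h t

/-- Combinations of words that begin with different letters have no words in common. -/
theorem bdd_push_add {x y z w : Word →₀ ℤ} (hx : Bdd x) (hy : Bdd y) (hz : Bdd z) (hw : Bdd w)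
    {l₁ l₂ l₃ l₄ : Letter} (h : [l₁, l₂, l₃, l₄].Pairwise (· ≠ ·)) :
    Bdd (push l₁ x + push l₂ y + push l₃ z + push l₄ w) := by
  simp only [List.pairwise_cons, List.mem_cons, List.not_mem_nil, or_false, forall_eq_or_imp,
    forall_eq, IsEmpty.forall_iff, implies_true, List.Pairwise.nil, and_true] at h
  obtain ⟨⟨h12, h13, h14⟩, ⟨h23, h24⟩, h34⟩ := h
  intro t
  rcases t with _ | ⟨l', t⟩
  · simp
  · by_cases h1 : l₁ = l'
    · subst h1; simpa [h12.symm, h13.symm, h14.symm] using hx t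
    · by_cases h2 : l₂ = l'
      · subst h2; simpa [h1, h23.symm, h24.symm] using hy t
      · by_cases h3 : l₃ = l'
        · subst h3; simpa [h1, h2, h34.symm] using hz t
        · by_cases h4 : l₄ = l'
          · subst h4; simpa [h1, h2, h3] using hw t
          · simp [h1, h2, h3, h4]

theorem bdd_push_add₃ {x y z : Word →₀ ℤ} (hx : Bdd x) (hy : Bdd y) (hz : Bdd z)
    {l₁ l₂ l₃ l₄ : Letter} (h : [l₁, l₂, l₃, l₄].Pairwise (· ≠ ·)) :
    Bdd (push l₁ x + push l₂ y + push l₃ z) := by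
  simpa using bdd_push_add hx hy hz bdd_zero h

theorem bdd_dG {η : ℤ} (hη : η * η = 1) (w : Word) : Bdd (dG η w) := by
  induction w with
  | nil => exact bdd_zero
  | cons l w ih =>
    cases l <;> simp only [dG]
    case u => exact bdd_push ih _
    case s => exact bdd_push ih _
    case b =>
      simp only [← map_smul]
      exact bdd_push_add₃ (bdd_smul hη (bdd_wd w)) (bdd_wd w) (bdd_smul hη ih) (l₄ := o)
        (by simp)
    all_goals exact bdd_zero

theorem bdd_openT (w : Word) : Bdd (openT w) := by
  induction w with
  | nil => exact bdd_zero
  | cons l w ih =>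
    cases l <;> simp only [openT]
    case u => exact bdd_push ih _
    case s => exact bdd_push ih _
    case c => exact bdd_push (bdd_wd w) _
    case b =>
      simpa using bdd_push_add₃ (bdd_wd w) ih bdd_zero (l₁ := o) (l₂ := b) (l₃ := u) (l₄ := s)
        (by simp)
    all_goals exact bdd_zero

theorem bdd_dT {η : ℤ} (hη : η * η = 1) (w : Word) : Bdd (dT' η w) := by
  induction w with
  | nil => exact bdd_zero
  | cons l w ih =>
    cases l <;> simp only [dT']
    case u => exact bdd_push ih _
    case s => exact bdd_push ih _
    case c => exact bdd_smul hη (bdd_push (bdd_dG hη w) _)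
    case b =>
      simp only [← map_smul]
      exact bdd_push_add₃ (bdd_wd w) (bdd_smul hη (bdd_wd _)) (bdd_smul hη ih) (l₄ := o)
        (by simp)
    all_goals exact bdd_zero

theorem bdd_dF {η : ℤ} (hη : η * η = 1) (w : Word) : Bdd (dF' η w) := by
  induction w with
  | nil => exact bdd_zero
  | cons l w ih =>
    cases l <;> simp only [dF']
    case u => exact bdd_push ih _
    case s => exact bdd_push ih _
    case oc => exact bdd_push (bdd_dG hη w) _
    case b =>
      simp only [← map_smul]
      exact bdd_push_add₃ (bdd_smul hη (bdd_wd w)) (bdd_wd w) (bdd_smul hη ih) (l₄ := o)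
        (by simp)
    case o =>
      simp only [← map_smul]
      exact bdd_push_add₃ (bdd_smul hη (bdd_openT w)) (bdd_wd _) (bdd_dT hη w) (l₄ := u)
        (by simp)
    all_goals exact bdd_zero

/-- The square of the differential is `0` for `η = -1`, and for `η = 1` it counts every face of
codimension two at most twice. -/
theorem dG_dG {η : ℤ} (hη : η * η = 1) (w : Word) :
    ∃ e, Bdd e ∧ ext (dG η) (dG η w) = (1 + η) • e := by
  induction w with
  | nil => exact ⟨0, bdd_zero, by simp [dG]⟩
  | cons l w ih =>
    obtain ⟨e, he, h⟩ := ih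
    cases l <;> simp only [dG]
    case u => exact ⟨push u e, bdd_push he _, by simp [dG, ext_push, ext_comp_push, h]⟩
    case s => exact ⟨push s e, bdd_push he _, by simp [dG, ext_push, ext_comp_push, h]⟩
    case b =>
      refine ⟨push u (dG η w) + push s (dG η w) + push b e,
        bdd_push_add₃ (bdd_dG hη w) (bdd_dG hη w) he (l₄ := o) (by simp), ?_⟩
      simp only [map_add, map_smul, ext_push, dG, ext_comp_push, ext_wd, ext_add, ext_smul,
        ext_wd_eq, h, smul_add, smul_smul, hη]
      rw [← mul_assoc, hη]
      module
    all_goals exact ⟨0, bdd_zero, by simp⟩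

theorem dT_dT {η : ℤ} (hη : η * η = 1) (w : Word) :
    ∃ e, Bdd e ∧ ext (dT' η) (dT' η w) = (1 + η) • e := by
  induction w with
  | nil => exact ⟨0, bdd_zero, by simp [dT']⟩
  | cons l w ih =>
    obtain ⟨e, he, h⟩ := ih
    cases l <;> simp only [dT']
    case u => exact ⟨push u e, bdd_push he _, by simp [dT', ext_push, ext_comp_push, h]⟩
    case s => exact ⟨push s e, bdd_push he _, by simp [dT', ext_push, ext_comp_push, h]⟩
    case b =>
      refine ⟨push u (dT' η w) + push c (KT (dT' η w)) + push b e,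
        bdd_push_add₃ (bdd_dT hη w) ?_ he (l₄ := o) (by simp), ?_⟩
      · have := bdd_smul hη (bdd_dG hη (closeT w))
        rwa [dG_closeT hη, smul_smul, hη, one_smul] at this
      · simp only [map_add, map_smul, ext_push, dT', ext_comp_push, ext_wd, ext_add, ext_smul,
          ext_wd_eq, h, dG_closeT hη, smul_add, smul_smul, hη]
        rw [← mul_assoc, hη]
        module
    case c =>
      obtain ⟨e, he, h⟩ := dG_dG hη w
      refine ⟨push c e, bdd_push he _, ?_⟩
      simp only [map_smul, ext_push, dT', ext_comp_push, ext_smul, h, smul_smul]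
      rw [← mul_assoc, hη, one_mul]
    all_goals exact ⟨0, bdd_zero, by simp⟩

/-- The terms in which first a left part of `T` becomes a tree of `F` and those in which this happens
last cancel in the square of the differential. -/
theorem dF_openT {η : ℤ} (hη : η * η = 1) (w : Word) :
    ∃ e, Bdd e ∧ ext (dF' η) (openT w) + ext openT (dT' η w) = (1 + η) • e := by
  induction w with
  | nil => exact ⟨0, bdd_zero, by simp [dT', openT]⟩
  | cons l w ih =>
    obtain ⟨e, he, h⟩ := ih
    cases l <;> simp only [dT', openT]
    case u =>
      refine ⟨push u e, bdd_push he _, ?_⟩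
      simp only [ext_push, dF', openT, ext_comp_push, ← map_add, h, map_smul]
    case s =>
      refine ⟨push s e, bdd_push he _, ?_⟩
      simp only [ext_push, dF', openT, ext_comp_push, ← map_add, h, map_smul]
    case b =>
      refine ⟨push u (openT w) + push s (openT w) + push oc (wd (closeT w)) +
        push o (dT' η w) + η • push b e, ?_, ?_⟩
      · rintro (_ | ⟨l, t⟩)
        · simp
        · cases l
          case u => simpa using bdd_openT w t
          case s => simpa using bdd_openT w t
          case oc => simpa using bdd_wd (closeT w) t
          case o => simpa using bdd_dT hη w t
          case b => simpa using bdd_smul hη he t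
          case c => simp
      · have h' : ext (dF' η) (openT w) = (1 + η) • e - ext openT (dT' η w) :=
          eq_sub_of_add_eq h
        simp only [map_add, map_smul, ext_push, dF', openT, ext_comp_push, ext_wd, ext_add,
          ext_smul, ext_wd_eq, h', map_sub, smul_add, smul_sub, smul_smul]
        module
    case c =>
      refine ⟨push oc (dG η w), bdd_push (bdd_dG hη w) _, ?_⟩
      simp only [ext_push, dF', openT, ext_comp_push, map_smul, ext_wd, ext_wd_eq]
      module
    all_goals exact ⟨0, bdd_zero, by simp⟩

/-- The statement of `dG_dG` for all words. -/
theorem dF_dF {η : ℤ} (hη : η * η = 1) (w : Word) :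
    ∃ e, Bdd e ∧ ext (dF' η) (dF' η w) = (1 + η) • e := by
  induction w with
  | nil => exact ⟨0, bdd_zero, by simp [dF']⟩
  | cons l w ih =>
    obtain ⟨e, he, h⟩ := ih
    cases l <;> simp only [dF']
    case u => exact ⟨push u e, bdd_push he _, by simp [dF', ext_push, ext_comp_push, h]⟩
    case s => exact ⟨push s e, bdd_push he _, by simp [dF', ext_push, ext_comp_push, h]⟩
    case b =>
      refine ⟨push u (dF' η w) + push s (dF' η w) + push b e,
        bdd_push_add₃ (bdd_dF hη w) (bdd_dF hη w) he (l₄ := o) (by simp), ?_⟩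
      simp only [map_add, map_smul, ext_push, dF', ext_comp_push, ext_wd, ext_add, ext_smul,
        ext_wd_eq, h, smul_add, smul_smul, hη]
      rw [← mul_assoc, hη]
      module
    case o =>
      obtain ⟨e₁, he₁, h₁⟩ := dF_openT hη w
      obtain ⟨e₂, he₂, h₂⟩ := dT_dT hη w
      refine ⟨push s (η • e₁) + push oc (KT (dT' η w)) + push o e₂,
        bdd_push_add₃ (bdd_smul hη he₁) ?_ he₂ (l₄ := u) (by simp), ?_⟩
      · have := bdd_smul hη (bdd_dG hη (closeT w))
        rwa [dG_closeT hη, smul_smul, hη, one_smul] at this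
      · have h' : ext (dF' η) (openT w) = (1 + η) • e₁ - ext openT (dT' η w) :=
          eq_sub_of_add_eq h₁
        simp only [map_add, map_smul, ext_push, dF', ext_comp_push, ext_wd, ext_add, ext_smul,
          h', h₂, dG_closeT hη, smul_add, map_sub, smul_sub, smul_smul]
        module
    case oc =>
      obtain ⟨e, he, h⟩ := dG_dG hη w
      exact ⟨push oc e, bdd_push he _, by simp [dF', ext_push, ext_comp_push, h]⟩
    all_goals exact ⟨0, bdd_zero, by simp⟩

/-! ### Faces of words -/

theorem ext_neg_one_dF_dF (w : Word) : ext (dF' (-1 : ℤ)) (dF' (-1) w) = 0 := by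
  obtain ⟨e, -, h⟩ := dF_dF (η := -1) (by norm_num) w
  simpa using h

theorem ext_one_dF_dF_le (w t : Word) : ext (dF' (1 : ℤ)) (dF' 1 w) t ≤ 2 := by
  obtain ⟨e, he, h⟩ := dF_dF (η := 1) (by norm_num) w
  have := abs_le.1 (he t)
  rw [h]
  simp
  omega

theorem closeT_u (w : Word) : closeT (u :: w) = u :: closeT w := by simp [closeT]

theorem closeT_b (w : Word) : closeT (b :: w) = b :: closeT w := by simp [closeT]

theorem closeT_c (w : Word) : closeT (c :: w) = s :: w := by simp [closeT]

theorem abs_wd (w t : Word) : |(wd w t : ℤ)| = wd w t := by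
  by_cases h : w = t <;> simp [wd, h]

theorem abs_dG (w t : Word) : |dG (-1 : ℤ) w t| = dG 1 w t := by
  induction w generalizing t with
  | nil => simp [dG]
  | cons l w ih =>
    rcases t with _ | ⟨l', t⟩
    · cases l <;> simp [dG]
    · cases l <;> cases l' <;> simp [dG, ih, abs_wd]

theorem abs_openT (w t : Word) : |(openT w t : ℤ)| = openT w t := by
  induction w generalizing t with
  | nil => simp [openT]
  | cons l w ih =>
    rcases t with _ | ⟨l', t⟩
    · cases l <;> simp [openT]
    · cases l <;> cases l' <;> simp [openT, ih, abs_wd]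

theorem abs_dT (w t : Word) : |dT' (-1 : ℤ) w t| = dT' 1 w t := by
  induction w generalizing t with
  | nil => simp [dT']
  | cons l w ih =>
    rcases t with _ | ⟨l', t⟩
    · cases l <;> simp [dT']
    · cases l <;> cases l' <;> simp [dT', ih, abs_wd, abs_dG]

theorem abs_dF (w t : Word) : |dF' (-1 : ℤ) w t| = dF' 1 w t := by
  induction w generalizing t with
  | nil => simp [dF']
  | cons l w ih =>
    rcases t with _ | ⟨l', t⟩
    · cases l <;> simp [dF']
    · cases l <;> cases l' <;> simp [dF', ih, abs_wd, abs_dG, abs_openT, abs_dT]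

/-- The words that occur in `dG`. -/
def CG (w t : Word) : Prop := dG (1 : ℤ) w t ≠ 0
/-- The words that occur in `openT`. -/
def CL (w t : Word) : Prop := (openT w t : ℤ) ≠ 0
/-- The words that occur in `dT'`. -/
def CT (w t : Word) : Prop := dT' (1 : ℤ) w t ≠ 0
/-- The words that occur in the differential `dF'`. -/
def CF (w t : Word) : Prop := dF' (1 : ℤ) w t ≠ 0

theorem wd_ne_zero {w t : Word} : (wd w t : ℤ) ≠ 0 ↔ t = w := by
  by_cases h : w = t
  · simp [wd, h]
  · simp [wd, Ne.symm h]

theorem cG_nil {t : Word} : ¬ CG [] t := by simp [CG, dG]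
theorem cG_u {w t : Word} : CG (u :: w) t ↔ ∃ t', t = u :: t' ∧ CG w t' := by
  rcases t with _ | ⟨_ | _, t⟩ <;> simp [CG, dG]
theorem cG_s {w t : Word} : CG (s :: w) t ↔ ∃ t', t = s :: t' ∧ CG w t' := by
  rcases t with _ | ⟨_ | _, t⟩ <;> simp [CG, dG]
theorem cG_b {w t : Word} :
    CG (b :: w) t ↔ t = u :: w ∨ t = s :: w ∨ ∃ t', t = b :: t' ∧ CG w t' := by
  rcases t with _ | ⟨_ | _, t⟩ <;> simp [CG, dG, wd_ne_zero]

theorem cL_u {w t : Word} : CL (u :: w) t ↔ ∃ t', t = u :: t' ∧ CL w t' := by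
  rcases t with _ | ⟨_ | _, t⟩ <;> simp [CL, openT]
theorem cL_b {w t : Word} : CL (b :: w) t ↔ t = o :: w ∨ ∃ t', t = b :: t' ∧ CL w t' := by
  rcases t with _ | ⟨_ | _, t⟩ <;> simp [CL, openT, wd_ne_zero]
theorem cL_c {w t : Word} : CL (c :: w) t ↔ t = oc :: w := by
  rcases t with _ | ⟨_ | _, t⟩ <;> simp [CL, openT, wd_ne_zero]

theorem cT_u {w t : Word} : CT (u :: w) t ↔ ∃ t', t = u :: t' ∧ CT w t' := by
  rcases t with _ | ⟨_ | _, t⟩ <;> simp [CT, dT']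
theorem cT_b {w t : Word} :
    CT (b :: w) t ↔ t = u :: w ∨ t = c :: closeT w ∨ ∃ t', t = b :: t' ∧ CT w t' := by
  rcases t with _ | ⟨_ | _, t⟩ <;> simp [CT, dT', wd_ne_zero]
theorem cT_c {w t : Word} : CT (c :: w) t ↔ ∃ t', t = c :: t' ∧ CG w t' := by
  rcases t with _ | ⟨_ | _, t⟩ <;> simp [CT, dT', CG]

theorem cF_u {w t : Word} : CF (u :: w) t ↔ ∃ t', t = u :: t' ∧ CF w t' := by
  rcases t with _ | ⟨_ | _, t⟩ <;> simp [CF, dF']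
theorem cF_s {w t : Word} : CF (s :: w) t ↔ ∃ t', t = s :: t' ∧ CF w t' := by
  rcases t with _ | ⟨_ | _, t⟩ <;> simp [CF, dF']
theorem cF_b {w t : Word} :
    CF (b :: w) t ↔ t = u :: w ∨ t = s :: w ∨ ∃ t', t = b :: t' ∧ CF w t' := by
  rcases t with _ | ⟨_ | _, t⟩ <;> simp [CF, dF', wd_ne_zero]
theorem cF_o {w t : Word} :
    CF (o :: w) t ↔ (∃ t', t = s :: t' ∧ CL w t') ∨ t = oc :: closeT w ∨
      ∃ t', t = o :: t' ∧ CT w t' := by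
  rcases t with _ | ⟨_ | _, t⟩ <;> simp [CF, dF', wd_ne_zero, CL, CT]
theorem cF_oc {w t : Word} : CF (oc :: w) t ↔ ∃ t', t = oc :: t' ∧ CG w t' := by
  rcases t with _ | ⟨_ | _, t⟩ <;> simp [CF, dF', CG]

/-- No more than two faces lie between a face and a face of codimension two of it. -/
theorem cF_thin {w x y z t : Word} (hx : CF w x) (hxt : CF x t) (hy : CF w y) (hyt : CF y t)
    (hz : CF w z) (hzt : CF z t) (hxy : x ≠ y) : z = x ∨ z = y := by
  classical
  by_contra! hcon
  have h := ext_one_dF_dF_le w t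
  rw [ext, Finsupp.linearCombination_apply, Finsupp.sum, Finsupp.finsetSum_apply] at h
  have hnn : ∀ v v', 0 ≤ dF' (1 : ℤ) v v' := fun v v' => by rw [← abs_dF]; exact abs_nonneg _
  have hpos : ∀ {v v'}, CF v v' → 1 ≤ dF' (1 : ℤ) v v' := fun {v v'} hv =>
    lt_of_le_of_ne (hnn v v') (Ne.symm hv)
  have h3 : ∑ v ∈ ({x, y, z} : Finset Word), dF' (1 : ℤ) w v * dF' (1 : ℤ) v t ≤ 2 := by
    refine le_trans (Finset.sum_le_sum_of_subset_of_nonneg ?_ ?_) h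
    · intro v hv
      simp only [Finset.mem_insert, Finset.mem_singleton] at hv
      rw [Finsupp.mem_support_iff]
      rcases hv with rfl | rfl | rfl <;> assumption
    · intro v _ _
      exact mul_nonneg (hnn _ _) (hnn _ _)
  rw [Finset.sum_insert (by simp [hxy, hcon.1.symm]), Finset.sum_insert (by simp [hcon.2.symm]),
    Finset.sum_singleton] at h3
  have := one_le_mul_of_one_le_of_one_le (hpos hx) (hpos hxt)
  have := one_le_mul_of_one_le_of_one_le (hpos hy) (hpos hyt)
  have := one_le_mul_of_one_le_of_one_le (hpos hz) (hpos hzt)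
  linarith

/-- The dimension of a word: the number of its letters `b` and `o`. -/
def wdim : Word → ℕ
  | [] => 0
  | b :: w => wdim w + 1
  | o :: w => wdim w + 1
  | _ :: w => wdim w

/-- Words that can follow a trivial tree `T` or the end of `T`. -/
inductive VG : Word → Prop
  | nil : VG []
  | u {w} : VG w → VG (u :: w)
  | b {w} : VG w → VG (b :: w)
  | s {w} : VG w → VG (s :: w)

/-- Words that can follow the letter `o`. -/
inductive VT : Word → Prop
  | u {w} : VT w → VT (u :: w)
  | b {w} : VT w → VT (b :: w)
  | c {w} : VG w → VT (c :: w)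

/-- Words in which one tree `T` is marked. -/
inductive VF : Word → Prop
  | u {w} : VF w → VF (u :: w)
  | b {w} : VF w → VF (b :: w)
  | s {w} : VF w → VF (s :: w)
  | o {w} : VT w → VF (o :: w)
  | oc {w} : VG w → VF (oc :: w)

theorem wdim_closeT (w : Word) : wdim (closeT w) = wdim w := by
  induction w with
  | nil => rfl
  | cons l w ih => cases l <;> simp [closeT, wdim, ih]

theorem CG.wdim {w t : Word} (h : CG w t) (hw : VG w) : wdim w = wdim t + 1 := by
  induction hw generalizing t with
  | nil => exact absurd h cG_nil
  | u _ ih => obtain ⟨t', rfl, h'⟩ := cG_u.1 h; simpa [Freehedra.wdim] using ih h'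
  | s _ ih => obtain ⟨t', rfl, h'⟩ := cG_s.1 h; simpa [Freehedra.wdim] using ih h'
  | b _ ih =>
    rcases cG_b.1 h with rfl | rfl | ⟨t', rfl, h'⟩
    · rfl
    · rfl
    · simpa [Freehedra.wdim] using ih h'

theorem CL.wdim {w t : Word} (h : CL w t) (hw : VT w) : wdim w = wdim t := by
  induction hw generalizing t with
  | u _ ih => obtain ⟨t', rfl, h'⟩ := cL_u.1 h; simpa [Freehedra.wdim] using ih h'
  | c _ => rw [cL_c.1 h]; rfl
  | b _ ih =>
    rcases cL_b.1 h with rfl | ⟨t', rfl, h'⟩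
    · rfl
    · simpa [Freehedra.wdim] using ih h'

theorem CT.wdim {w t : Word} (h : CT w t) (hw : VT w) : wdim w = wdim t + 1 := by
  induction hw generalizing t with
  | u _ ih => obtain ⟨t', rfl, h'⟩ := cT_u.1 h; simpa [Freehedra.wdim] using ih h'
  | c hg => obtain ⟨t', rfl, h'⟩ := cT_c.1 h; simpa [Freehedra.wdim] using h'.wdim hg
  | b _ ih =>
    rcases cT_b.1 h with rfl | rfl | ⟨t', rfl, h'⟩
    · rfl
    · simp [Freehedra.wdim, wdim_closeT]
    · simpa [Freehedra.wdim] using ih h'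

theorem CF.wdim {w t : Word} (h : CF w t) (hw : VF w) : wdim w = wdim t + 1 := by
  induction hw generalizing t with
  | u _ ih => obtain ⟨t', rfl, h'⟩ := cF_u.1 h; simpa [Freehedra.wdim] using ih h'
  | s _ ih => obtain ⟨t', rfl, h'⟩ := cF_s.1 h; simpa [Freehedra.wdim] using ih h'
  | oc hg => obtain ⟨t', rfl, h'⟩ := cF_oc.1 h; simpa [Freehedra.wdim] using h'.wdim hg
  | b _ ih =>
    rcases cF_b.1 h with rfl | rfl | ⟨t', rfl, h'⟩
    · rfl
    · rfl
    · simpa [Freehedra.wdim] using ih h'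
  | o hw =>
    rcases cF_o.1 h with ⟨t', rfl, h'⟩ | rfl | ⟨t', rfl, h'⟩
    · simpa [Freehedra.wdim] using h'.wdim hw
    · simp [Freehedra.wdim, wdim_closeT]
    · simpa [Freehedra.wdim] using h'.wdim hw

theorem exists_cL {w : Word} (hw : VT w) : ∃ t, CL w t := by
  induction hw with
  | u _ ih => obtain ⟨t, h⟩ := ih; exact ⟨_, cL_u.2 ⟨t, rfl, h⟩⟩
  | b _ _ => exact ⟨_, cL_b.2 (Or.inl rfl)⟩
  | c _ => exact ⟨_, cL_c.2 rfl⟩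

theorem exists_cG {w : Word} (hw : VG w) (hd : wdim w ≠ 0) : ∃ t, CG w t := by
  induction hw with
  | nil => exact absurd rfl hd
  | u _ ih => obtain ⟨t, h⟩ := ih hd; exact ⟨_, cG_u.2 ⟨t, rfl, h⟩⟩
  | s _ ih => obtain ⟨t, h⟩ := ih hd; exact ⟨_, cG_s.2 ⟨t, rfl, h⟩⟩
  | b _ _ => exact ⟨_, cG_b.2 (Or.inl rfl)⟩

theorem exists_cF {w : Word} (hw : VF w) (hd : wdim w ≠ 0) : ∃ t, CF w t := by
  induction hw with
  | u _ ih => obtain ⟨t, h⟩ := ih hd; exact ⟨_, cF_u.2 ⟨t, rfl, h⟩⟩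
  | s _ ih => obtain ⟨t, h⟩ := ih hd; exact ⟨_, cF_s.2 ⟨t, rfl, h⟩⟩
  | b _ _ => exact ⟨_, cF_b.2 (Or.inl rfl)⟩
  | o _ => exact ⟨_, cF_o.2 (Or.inr (Or.inl rfl))⟩
  | oc hg => obtain ⟨t, h⟩ := exists_cG hg hd; exact ⟨_, cF_oc.2 ⟨t, rfl, h⟩⟩

/-! ### Edges -/

theorem dG_of_wdim_eq_zero {w : Word} (hw : VG w) (hd : wdim w = 0) : dG (-1 : ℤ) w = 0 := by
  induction hw with
  | nil => rfl
  | u _ ih => rw [dG, ih hd, map_zero]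
  | s _ ih => rw [dG, ih hd, map_zero]
  | b _ _ => simp [wdim] at hd

theorem dT_of_wdim_eq_zero {w : Word} (hw : VT w) (hd : wdim w = 0) : dT' (-1 : ℤ) w = 0 := by
  induction hw with
  | u _ ih => rw [dT', ih hd, map_zero]
  | b _ _ => simp [wdim] at hd
  | c hg => rw [dT', dG_of_wdim_eq_zero hg hd, map_zero, smul_zero]

theorem openT_of_wdim_eq_zero {w : Word} (hw : VT w) (hd : wdim w = 0) :
    ∃ t, (openT w : Word →₀ ℤ) = wd t := by
  induction hw with
  | u _ ih => obtain ⟨t, h⟩ := ih hd; exact ⟨_, by rw [openT, h, push_wd]⟩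
  | b _ _ => simp [wdim] at hd
  | c _ => exact ⟨_, by rw [openT, push_wd]⟩

theorem dF_of_wdim_eq_zero {w : Word} (hw : VF w) (hd : wdim w = 0) : dF' (-1 : ℤ) w = 0 := by
  induction hw with
  | u _ ih => rw [dF', ih hd, map_zero]
  | s _ ih => rw [dF', ih hd, map_zero]
  | b _ _ => simp [wdim] at hd
  | o _ => simp [wdim] at hd
  | oc hg => rw [dF', dG_of_wdim_eq_zero hg hd, map_zero]

theorem dG_edge {w : Word} (hw : VG w) (hd : wdim w = 1) :
    ∃ x y, x ≠ y ∧ dG (-1 : ℤ) w = wd x - wd y := by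
  induction hw with
  | nil => simp [wdim] at hd
  | u _ ih =>
    obtain ⟨x, y, hxy, h⟩ := ih hd
    exact ⟨u :: x, u :: y, by simpa using hxy, by rw [dG, h, map_sub, push_wd, push_wd]⟩
  | s _ ih =>
    obtain ⟨x, y, hxy, h⟩ := ih hd
    exact ⟨s :: x, s :: y, by simpa using hxy, by rw [dG, h, map_sub, push_wd, push_wd]⟩
  | @b w hw _ =>
    refine ⟨s :: w, u :: w, by simp, ?_⟩
    rw [dG, dG_of_wdim_eq_zero hw (by simpa [wdim] using hd), push_wd, push_wd]
    simp [sub_eq_neg_add]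

/-- The boundary of an edge is the difference of its two end points. -/
theorem dF_edge {w : Word} (hw : VF w) (hd : wdim w = 1) :
    ∃ x y, x ≠ y ∧ dF' (-1 : ℤ) w = wd x - wd y := by
  induction hw with
  | u _ ih =>
    obtain ⟨x, y, hxy, h⟩ := ih hd
    exact ⟨u :: x, u :: y, by simpa using hxy, by rw [dF', h, map_sub, push_wd, push_wd]⟩
  | s _ ih =>
    obtain ⟨x, y, hxy, h⟩ := ih hd
    exact ⟨s :: x, s :: y, by simpa using hxy, by rw [dF', h, map_sub, push_wd, push_wd]⟩
  | @b w hw _ =>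
    refine ⟨s :: w, u :: w, by simp, ?_⟩
    rw [dF', dF_of_wdim_eq_zero hw (by simpa [wdim] using hd), push_wd, push_wd]
    simp [sub_eq_neg_add]
  | @o w hw =>
    have hd' : wdim w = 0 := by simpa [wdim] using hd
    obtain ⟨t, ht⟩ := openT_of_wdim_eq_zero hw hd'
    refine ⟨oc :: closeT w, s :: t, by simp, ?_⟩
    rw [dF', dT_of_wdim_eq_zero hw hd', ht, push_wd, push_wd]
    simp [sub_eq_neg_add]
  | oc hg =>
    obtain ⟨x, y, hxy, h⟩ := dG_edge hg hd
    exact ⟨oc :: x, oc :: y, by simpa using hxy, by rw [dF', h, map_sub, push_wd, push_wd]⟩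

/-! ### Connectedness of boundaries -/

/-- The faces of `w`, where two faces are neighbours if they have a face in common, form a connected
graph: every function that agrees on neighbours is constant. -/
def Conn (C C' : Word → Word → Prop) (w : Word) : Prop :=
  ∀ h : Word → ℤ, (∀ x y t, C w x → C w y → C' x t → C' y t → h x = h y) →
    ∀ x y, C w x → C w y → h x = h y

theorem conn_G {w : Word} (hw : VG w) (hd : 2 ≤ wdim w) : Conn CG CG w := by
  induction hw with
  | nil => simp [wdim] at hd
  | u _ ih =>
    intro h hh x y hx hy
    obtain ⟨x, rfl, hx'⟩ := cG_u.1 hx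
    obtain ⟨y, rfl, hy'⟩ := cG_u.1 hy
    refine ih hd (fun x => h (u :: x)) (fun x y t hx hy hxt hyt => ?_) x y hx' hy'
    exact hh _ _ (u :: t) (cG_u.2 ⟨_, rfl, hx⟩) (cG_u.2 ⟨_, rfl, hy⟩) (cG_u.2 ⟨_, rfl, hxt⟩)
      (cG_u.2 ⟨_, rfl, hyt⟩)
  | s _ ih =>
    intro h hh x y hx hy
    obtain ⟨x, rfl, hx'⟩ := cG_s.1 hx
    obtain ⟨y, rfl, hy'⟩ := cG_s.1 hy
    refine ih hd (fun x => h (s :: x)) (fun x y t hx hy hxt hyt => ?_) x y hx' hy'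
    exact hh _ _ (s :: t) (cG_s.2 ⟨_, rfl, hx⟩) (cG_s.2 ⟨_, rfl, hy⟩) (cG_s.2 ⟨_, rfl, hxt⟩)
      (cG_s.2 ⟨_, rfl, hyt⟩)
  | @b w hw _ =>
    intro h hh
    obtain ⟨v, hv⟩ := exists_cG hw (by simp [wdim] at hd; omega)
    have hu : ∀ v, CG w v → h (b :: v) = h (u :: w) := fun v hv =>
      hh _ _ (u :: v) (cG_b.2 (Or.inr (Or.inr ⟨v, rfl, hv⟩))) (cG_b.2 (Or.inl rfl))
        (cG_b.2 (Or.inl rfl)) (cG_u.2 ⟨v, rfl, hv⟩)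
    have hs : h (b :: v) = h (s :: w) :=
      hh _ _ (s :: v) (cG_b.2 (Or.inr (Or.inr ⟨v, rfl, hv⟩))) (cG_b.2 (Or.inr (Or.inl rfl)))
        (cG_b.2 (Or.inr (Or.inl rfl))) (cG_s.2 ⟨v, rfl, hv⟩)
    have key : ∀ x, CG (b :: w) x → h x = h (u :: w) := by
      intro x hx
      rcases cG_b.1 hx with rfl | rfl | ⟨v', rfl, hv'⟩
      · rfl
      · rw [← hs, hu v hv]
      · exact hu v' hv'
    exact fun x y hx hy => by rw [key x hx, key y hy]

theorem conn_T {w : Word} (hw : VT w) (hd : 1 ≤ wdim w) : Conn CF CF (o :: w) := by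
  induction hw with
  | @u w _ ih =>
    -- The faces of `o :: u :: w` arise from those of `o :: w` by the insertion of `u`.
    have hs : ∀ {v t}, CL v t → CF (o :: v) (s :: t) := fun ht => cF_o.2 (Or.inl ⟨_, rfl, ht⟩)
    have ho : ∀ {v t}, CT v t → CF (o :: v) (o :: t) :=
      fun ht => cF_o.2 (Or.inr (Or.inr ⟨_, rfl, ht⟩))
    have hoc : ∀ {v}, CF (o :: v) (oc :: closeT v) := cF_o.2 (Or.inr (Or.inl rfl))
    let ι : Word → Word := fun v => match v with
      | l :: v => l :: u :: v
      | [] => []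
    have hι : ∀ v t, CF (o :: v) t → CF (o :: u :: v) (ι t) := by
      intro v t ht
      rcases cF_o.1 ht with ⟨t, rfl, ht'⟩ | rfl | ⟨t, rfl, ht'⟩
      · exact hs (cL_u.2 ⟨t, rfl, ht'⟩)
      · have := @hoc (u :: v)
        rwa [closeT_u] at this
      · exact ho (cT_u.2 ⟨t, rfl, ht'⟩)
    have hsurj : ∀ t, CF (o :: u :: w) t → ∃ t', CF (o :: w) t' ∧ t = ι t' := by
      intro t ht
      rcases cF_o.1 ht with ⟨t, rfl, ht'⟩ | rfl | ⟨t, rfl, ht'⟩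
      · obtain ⟨t, rfl, h'⟩ := cL_u.1 ht'
        exact ⟨_, hs h', rfl⟩
      · refine ⟨_, hoc, ?_⟩
        rw [closeT_u]
      · obtain ⟨t, rfl, h'⟩ := cT_u.1 ht'
        exact ⟨_, ho h', rfl⟩
    have hι' : ∀ x t, CF (o :: w) x → CF x t → CF (ι x) (ι t) := by
      intro x t hx hxt
      rcases cF_o.1 hx with ⟨x, rfl, hx'⟩ | rfl | ⟨x, rfl, hx'⟩
      · obtain ⟨t, rfl, hxt'⟩ := cF_s.1 hxt
        exact cF_s.2 ⟨_, rfl, cF_u.2 ⟨t, rfl, hxt'⟩⟩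
      · obtain ⟨t, rfl, hxt'⟩ := cF_oc.1 hxt
        exact cF_oc.2 ⟨_, rfl, cG_u.2 ⟨t, rfl, hxt'⟩⟩
      · exact hι _ _ hxt
    intro h hh x y hx hy
    obtain ⟨x, hx', rfl⟩ := hsurj x hx
    obtain ⟨y, hy', rfl⟩ := hsurj y hy
    refine ih hd (fun x => h (ι x)) (fun x y t hx hy hxt hyt => ?_) x y hx' hy'
    exact hh _ _ (ι t) (hι _ _ hx) (hι _ _ hy) (hι' _ _ hx hxt) (hι' _ _ hy hyt)
  | @b w hw _ =>
    intro h hh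
    have hs : ∀ {v t}, CL v t → CF (o :: v) (s :: t) := fun ht => cF_o.2 (Or.inl ⟨_, rfl, ht⟩)
    have ho : ∀ {v t}, CT v t → CF (o :: v) (o :: t) :=
      fun ht => cF_o.2 (Or.inr (Or.inr ⟨_, rfl, ht⟩))
    have hoc : ∀ {v}, CF (o :: v) (oc :: closeT v) := cF_o.2 (Or.inr (Or.inl rfl))
    have hK : closeT (b :: w) = b :: closeT w := closeT_b w
    have hoc' : CF (o :: b :: w) (oc :: b :: closeT w) := by
      have := @hoc (b :: w)
      rwa [hK] at this
    -- All faces are compared with the face `o :: u :: w`.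
    have hub : CF (o :: b :: w) (o :: u :: w) := ho (cT_b.2 (Or.inl rfl))
    have h1 : ∀ l, CL w l → h (s :: b :: l) = h (o :: u :: w) := fun l hl =>
      hh _ _ (s :: u :: l) (hs (cL_b.2 (Or.inr ⟨l, rfl, hl⟩))) hub
        (cF_s.2 ⟨_, rfl, cF_b.2 (Or.inl rfl)⟩) (hs (cL_u.2 ⟨l, rfl, hl⟩))
    have h2 : h (oc :: b :: closeT w) = h (o :: u :: w) := by
      refine hh _ _ (oc :: u :: closeT w) hoc' hub (cF_oc.2 ⟨_, rfl, cG_b.2 (Or.inl rfl)⟩) ?_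
      have := @hoc (u :: w)
      rwa [closeT_u] at this
    have h3 : ∀ v, CT w v → h (o :: b :: v) = h (o :: u :: w) := fun v hv =>
      hh _ _ (o :: u :: v) (ho (cT_b.2 (Or.inr (Or.inr ⟨v, rfl, hv⟩)))) hub
        (ho (cT_b.2 (Or.inl rfl))) (ho (cT_u.2 ⟨v, rfl, hv⟩))
    have h4 : h (s :: o :: w) = h (o :: u :: w) := by
      obtain ⟨l, hl⟩ := exists_cL hw
      rw [← h1 l hl]
      exact hh _ _ (s :: s :: l) (hs (cL_b.2 (Or.inl rfl))) (hs (cL_b.2 (Or.inr ⟨l, rfl, hl⟩)))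
        (cF_s.2 ⟨_, rfl, hs hl⟩) (cF_s.2 ⟨_, rfl, cF_b.2 (Or.inr (Or.inl rfl))⟩)
    have h5 : h (o :: c :: closeT w) = h (o :: u :: w) := by
      rw [← h2]
      refine hh _ _ (oc :: s :: closeT w) (ho (cT_b.2 (Or.inr (Or.inl rfl)))) hoc' ?_
        (cF_oc.2 ⟨_, rfl, cG_b.2 (Or.inr (Or.inl rfl))⟩)
      have := @hoc (c :: closeT w)
      rwa [closeT_c] at this
    have key : ∀ x, CF (o :: b :: w) x → h x = h (o :: u :: w) := by
      intro x hx
      rcases cF_o.1 hx with ⟨x, rfl, hx'⟩ | rfl | ⟨x, rfl, hx'⟩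
      · rcases cL_b.1 hx' with rfl | ⟨l, rfl, hl⟩
        · exact h4
        · exact h1 l hl
      · rw [hK, h2]
      · rcases cT_b.1 hx' with rfl | rfl | ⟨v, rfl, hv⟩
        · rfl
        · exact h5
        · exact h3 v hv
    exact fun x y hx hy => by rw [key x hx, key y hy]
  | @c w hw =>
    intro h hh
    obtain ⟨v, hv⟩ := exists_cG hw (by simp [wdim] at hd; omega)
    have hK : ∀ w, closeT (c :: w) = s :: w := closeT_c
    have hs : ∀ {v}, CF (o :: c :: v) (s :: oc :: v) :=
      cF_o.2 (Or.inl ⟨_, rfl, cL_c.2 rfl⟩)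
    have hoc : ∀ {v}, CF (o :: c :: v) (oc :: s :: v) := by
      intro v; exact cF_o.2 (Or.inr (Or.inl (by rw [hK])))
    have ho : ∀ {v t}, CG v t → CF (o :: c :: v) (o :: c :: t) :=
      fun ht => cF_o.2 (Or.inr (Or.inr ⟨_, rfl, cT_c.2 ⟨_, rfl, ht⟩⟩))
    have h1 : ∀ v, CG w v → h (o :: c :: v) = h (s :: oc :: w) := fun v hv =>
      hh _ _ (s :: oc :: v) (ho hv) hs hs (cF_s.2 ⟨_, rfl, cF_oc.2 ⟨v, rfl, hv⟩⟩)
    have h2 : h (o :: c :: v) = h (oc :: s :: w) :=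
      hh _ _ (oc :: s :: v) (ho hv) hoc hoc (cF_oc.2 ⟨_, rfl, cG_s.2 ⟨v, rfl, hv⟩⟩)
    have key : ∀ x, CF (o :: c :: w) x → h x = h (s :: oc :: w) := by
      intro x hx
      rcases cF_o.1 hx with ⟨x, rfl, hx'⟩ | rfl | ⟨x, rfl, hx'⟩
      · rw [cL_c.1 hx']
      · rw [hK, ← h2, h1 v hv]
      · obtain ⟨v', rfl, hv'⟩ := cT_c.1 hx'
        exact h1 v' hv'
    exact fun x y hx hy => by rw [key x hx, key y hy]

theorem conn_F {w : Word} (hw : VF w) (hd : 2 ≤ wdim w) : Conn CF CF w := by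
  induction hw with
  | u _ ih =>
    intro h hh x y hx hy
    obtain ⟨x, rfl, hx'⟩ := cF_u.1 hx
    obtain ⟨y, rfl, hy'⟩ := cF_u.1 hy
    refine ih hd (fun x => h (u :: x)) (fun x y t hx hy hxt hyt => ?_) x y hx' hy'
    exact hh _ _ (u :: t) (cF_u.2 ⟨_, rfl, hx⟩) (cF_u.2 ⟨_, rfl, hy⟩) (cF_u.2 ⟨_, rfl, hxt⟩)
      (cF_u.2 ⟨_, rfl, hyt⟩)
  | s _ ih =>
    intro h hh x y hx hy
    obtain ⟨x, rfl, hx'⟩ := cF_s.1 hx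
    obtain ⟨y, rfl, hy'⟩ := cF_s.1 hy
    refine ih hd (fun x => h (s :: x)) (fun x y t hx hy hxt hyt => ?_) x y hx' hy'
    exact hh _ _ (s :: t) (cF_s.2 ⟨_, rfl, hx⟩) (cF_s.2 ⟨_, rfl, hy⟩) (cF_s.2 ⟨_, rfl, hxt⟩)
      (cF_s.2 ⟨_, rfl, hyt⟩)
  | oc hg =>
    intro h hh x y hx hy
    obtain ⟨x, rfl, hx'⟩ := cF_oc.1 hx
    obtain ⟨y, rfl, hy'⟩ := cF_oc.1 hy
    refine conn_G hg hd (fun x => h (oc :: x)) (fun x y t hx hy hxt hyt => ?_) x y hx' hy'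
    exact hh _ _ (oc :: t) (cF_oc.2 ⟨_, rfl, hx⟩) (cF_oc.2 ⟨_, rfl, hy⟩)
      (cF_oc.2 ⟨_, rfl, hxt⟩) (cF_oc.2 ⟨_, rfl, hyt⟩)
  | @b w hw _ =>
    intro h hh
    obtain ⟨v, hv⟩ := exists_cF hw (by simp [wdim] at hd; omega)
    have hu : ∀ v, CF w v → h (b :: v) = h (u :: w) := fun v hv =>
      hh _ _ (u :: v) (cF_b.2 (Or.inr (Or.inr ⟨v, rfl, hv⟩))) (cF_b.2 (Or.inl rfl))
        (cF_b.2 (Or.inl rfl)) (cF_u.2 ⟨v, rfl, hv⟩)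
    have hs : h (b :: v) = h (s :: w) :=
      hh _ _ (s :: v) (cF_b.2 (Or.inr (Or.inr ⟨v, rfl, hv⟩))) (cF_b.2 (Or.inr (Or.inl rfl)))
        (cF_b.2 (Or.inr (Or.inl rfl))) (cF_s.2 ⟨v, rfl, hv⟩)
    have key : ∀ x, CF (b :: w) x → h x = h (u :: w) := by
      intro x hx
      rcases cF_b.1 hx with rfl | rfl | ⟨v', rfl, hv'⟩
      · rfl
      · rw [← hs, hu v hv]
      · exact hu v' hv'
    exact fun x y hx hy => by rw [key x hx, key y hy]
  | o hw => exact conn_T hw (by simp [wdim] at hd; omega)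

end Words

/-! ### Uniqueness of orientations -/

/-- Two orientations of a cell complex differ by signs of the cells if the boundaries of the cells
are connected and no more than two cells lie between a cell and one of codimension two. The signs
are found by induction on the dimension. -/
theorem Orientation.exists_sign {X : Type*} {facet : X → X → Prop} {dim : X → ℤ}
    (hdim : ∀ s s', facet s s' → dim s = dim s' + 1) (h0 : ∀ s, 0 ≤ dim s)
    {N : ℕ} (hN : ∀ s, dim s ≤ N)
    (hthin : ∀ w x y z t, facet w x → facet x t → facet w y → facet y t → facet w z → facet z t →
      x ≠ y → z = x ∨ z = y)
    (hconn : ∀ w, 2 ≤ dim w → ∀ h : X → ℤ,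
      (∀ x y t, facet w x → facet w y → facet x t → facet y t → h x = h y) →
      ∀ x y, facet w x → facet w y → h x = h y)
    (hedge : ∀ w, dim w = 1 → ∀ x y z, facet w x → facet w y → facet w z → x ≠ y → z = x ∨ z = y)
    (o o' : Orientation facet dim) :
    ∃ ε : X → ℤˣ, ∀ s s', o.bd s s' = ε s * ε s' * o'.bd s s' := by
  classical
  have hunit : ∀ (o : Orientation facet dim) {s s'}, facet s s' → o.bd s s' * o.bd s s' = 1 := by
    intro o s s' h
    rcases o.bd_facet s s' h with h | h <;> simp [h]
  have hne : ∀ (o : Orientation facet dim) {s s'}, o.bd s s' ≠ 0 → facet s s' := by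
    intro o s s' h
    by_contra hn
    exact h (o.bd_not_facet s s' hn)
  -- The two contributions to a face of codimension two cancel.
  have hcancel : ∀ (o : Orientation facet dim) {w x y t}, facet w x → facet x t → facet w y →
      facet y t → x ≠ y → o.bd w x * o.bd x t + o.bd w y * o.bd y t = 0 := by
    intro o w x y t hx hxt hy hyt hxy
    have h := DFunLike.congr_fun (o.bd_bd w) t
    rw [Finsupp.sum, Finsupp.finsetSum_apply] at h
    rw [← Finset.sum_subset (s₁ := {x, y}), Finset.sum_pair hxy] at h
    · simpa using h
    · intro v hv
      simp only [Finset.mem_insert, Finset.mem_singleton] at hv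
      rw [Finsupp.mem_support_iff]
      rcases hv with rfl | rfl
      · intro h; have := hunit o hx; simp [h] at this
      · intro h; have := hunit o hy; simp [h] at this
    · intro v hv hv'
      by_contra hcon
      simp only [Finsupp.smul_apply, smul_eq_mul, mul_eq_zero, not_or] at hcon
      simp only [Finset.mem_insert, Finset.mem_singleton] at hv'
      exact hv' (hthin w x y v t hx hxt hy hyt (hne o hcon.1) (hne o hcon.2) hxy)
  have hedge' : ∀ (o : Orientation facet dim) {w x y}, dim w = 1 → facet w x → facet w y → x ≠ y →
      o.bd w x + o.bd w y = 0 := by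
    intro o w x y hw hx hy hxy
    have h := o.bd_edge w hw
    rw [Finsupp.sum] at h
    rw [← Finset.sum_subset (s₁ := {x, y}), Finset.sum_pair hxy] at h
    · simpa using h
    · intro v hv
      simp only [Finset.mem_insert, Finset.mem_singleton] at hv
      rw [Finsupp.mem_support_iff]
      rcases hv with rfl | rfl
      · intro h; have := hunit o hx; simp [h] at this
      · intro h; have := hunit o hy; simp [h] at this
    · intro v hv hv'
      by_contra hcon
      simp only [Finset.mem_insert, Finset.mem_singleton] at hv'
      exact hv' (hedge w hw x y v hx hy (hne o hcon) hxy)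
  have main : ∀ m : ℕ, ∃ ε : X → ℤˣ, (∀ s, dim s = 0 → ε s = 1) ∧ ∀ s s', dim s ≤ m → facet s s' →
      o.bd s s' = ε s * ε s' * o'.bd s s' := by
    intro m
    induction m with
    | zero =>
      refine ⟨1, fun _ _ => rfl, fun s s' hs hf => ?_⟩
      have := hdim s s' hf
      have := h0 s'
      push_cast at hs
      omega
    | succ m ih =>
      obtain ⟨ε, hε0, hε⟩ := ih
      -- The sign of a cell `s` that is forced by its facet `s'`.
      let g : X → X → ℤ := fun s s' => ε s' * o.bd s s' * o'.bd s s'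
      have hεε : ∀ s, (ε s : ℤ) * ε s = 1 := fun s => by
        rw [← Units.val_mul, Int.units_mul_self, Units.val_one]
      have hm : ∀ s, dim s = m + 1 → ∀ x y, facet s x → facet s y → g s x = g s y := by
        intro s hs
        have hlow : ∀ x, facet s x → dim x ≤ m := fun x hx => by
          have := hdim s x hx; omega
        by_cases h1 : dim s = 1
        · have hconst : ∀ x y, facet s x → facet s y →
              (o.bd s x * o'.bd s x = o.bd s y * o'.bd s y) := by
            intro x y hx hy
            by_cases hxy : x = y
            · rw [hxy]
            · have e1 := hedge' o h1 hx hy hxy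
              have e2 := hedge' o' h1 hx hy hxy
              rw [eq_neg_of_add_eq_zero_left e1, eq_neg_of_add_eq_zero_left e2]
              ring
          intro x y hx hy
          have hx0 : ε x = 1 := hε0 x (by have := hdim s x hx; omega)
          have hy0 : ε y = 1 := hε0 y (by have := hdim s y hy; omega)
          simpa [g, hx0, hy0] using hconst x y hx hy
        · refine hconn s (by have := h0 s; omega) (g s) fun x y t hx hy hxt hyt => ?_
          by_cases hxy : x = y
          · rw [hxy]
          have e1 := hcancel o hx hxt hy hyt hxy
          have e2 := hcancel o' hx hxt hy hyt hxy
          rw [hε x t (hlow x hx) hxt, hε y t (hlow y hy) hyt] at e1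
          have u1 := hunit o' hxt
          have u2 := hunit o' hyt
          have u3 := hεε t
          simp only [g]
          linear_combination (o'.bd x t * o'.bd s x * ε t) * e1
            - (ε y * o.bd s y * o'.bd y t) * e2
            - (o'.bd s x * ε x * o.bd s x) * u1 + (ε y * o.bd s y * o'.bd s y) * u2
            - (o'.bd x t * o'.bd s x) *
              (ε x * o.bd s x * o'.bd x t + ε y * o.bd s y * o'.bd y t) * u3
      have hg : ∀ s s', facet s s' → ∃ e : ℤˣ, (e : ℤ) = g s s' := by
        intro s s' h
        have h1 : g s s' * g s s' = 1 := by
          simp only [g]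
          linear_combination (ε s' * ε s' * (o'.bd s s' * o'.bd s s')) * hunit o h +
            (ε s' * ε s' : ℤ) * hunit o' h + hεε s'
        exact ⟨⟨g s s', g s s', h1, h1⟩, rfl⟩
      have hex : ∀ s, ∃ e : ℤˣ, dim s = m + 1 → ∀ s', facet s s' → (e : ℤ) = g s s' := by
        intro s
        by_cases h : dim s = m + 1 ∧ ∃ x, facet s x
        · obtain ⟨hs, x, hx⟩ := h
          obtain ⟨e, he⟩ := hg s x hx
          exact ⟨e, fun _ s' h' => he.trans (hm s hs x s' hx h')⟩
        · exact ⟨1, fun hs s' h' => absurd ⟨hs, s', h'⟩ h⟩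
      choose e he using hex
      refine ⟨fun s => if dim s = m + 1 then e s else ε s, fun s hs => ?_, fun s s' hs hf => ?_⟩
      · have hs' : dim s ≠ m + 1 := by omega
        simpa [hs'] using hε0 s hs
      · have hd := hdim s s' hf
        push_cast at hs
        beta_reduce
        rw [if_neg (show dim s' ≠ m + 1 by omega)]
        split_ifs with h
        · rw [he s h s' hf]
          simp only [g]
          linear_combination -(o.bd s s') * (hunit o' hf) -
            (o.bd s s' * (o'.bd s s' * o'.bd s s')) * hεε s'
        · exact hε s s' (by omega) hf
  obtain ⟨ε, -, hε⟩ := main N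
  refine ⟨ε, fun s s' => ?_⟩
  by_cases h : facet s s'
  · exact hε s s' (hN s) h
  · rw [o.bd_not_facet s s' h, o'.bd_not_facet s s' h, mul_zero]

/-! ### Triples as words -/

section
open Letter

/-- The letters at the positions between the leaves of a tree. -/
def body : List ℕ → Word
  | [] => []
  | [n] => List.replicate (n - 1) u
  | n :: m :: t => List.replicate (n - 1) u ++ b :: body (m :: t)

/-- The word of the part of a triple to the right of `T`. -/
def wordG : List (List ℕ) → Word
  | [] => []
  | t :: G => body t ++ s :: wordG G

/-- The word of the part of a triple from `T` on. -/
def wordT : List ℕ → List (List ℕ) → Word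
  | [], G => oc :: wordG G
  | n :: t, G => o :: (body (n :: t) ++ c :: wordG G)

/-- The word of a triple with the short forest `F` on the left. -/
def wordF : List (List ℕ) → List ℕ → List (List ℕ) → Word
  | [], T, G => wordT T G
  | t :: F, T, G => s :: (body t ++ wordF F T G)

/-- The word of a triple. -/
def Triple.word (τ : Triple) : Word := wordF τ.F τ.T τ.G

theorem body_cons {n : ℕ} {t : List ℕ} (h : t ≠ []) :
    body (n :: t) = List.replicate (n - 1) u ++ b :: body t := by
  cases t with
  | nil => exact absurd rfl h
  | cons m t => rfl

theorem body_append {t t' : List ℕ} (h : t ≠ []) (h' : t' ≠ []) :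
    body (t ++ t') = body t ++ b :: body t' := by
  induction t with
  | nil => exact absurd rfl h
  | cons n t ih =>
    rw [List.cons_append, body_cons (by simp [h'])]
    by_cases ht : t = []
    · subst ht; rfl
    · rw [ih ht, body_cons ht]; simp

theorem body_merge {p q : ℕ} (hp : 0 < p) (hq : 0 < q) (t t' : List ℕ) :
    body (t ++ [p]) ++ u :: body (q :: t') = body (t ++ (p + q) :: t') := by
  have h1 : body [p] ++ u :: body (q :: t') = body ((p + q) :: t') := by
    have h2 : ∀ x : Word, List.replicate (p - 1) u ++ u :: (List.replicate (q - 1) u ++ x) =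
        List.replicate (p + q - 1) u ++ x := by
      intro x
      rw [show p + q - 1 = (p - 1) + ((q - 1) + 1) by omega, List.replicate_add,
        List.replicate_succ, List.append_assoc, List.cons_append]
    cases t' with
    | nil => simpa [body] using h2 []
    | cons m t' => exact h2 _
  by_cases ht : t = []
  · subst ht; exact h1
  · rw [body_append ht (by simp), body_append ht (by simp), ← h1]; simp

theorem replicate_append_iff {C : Word → Word → Prop}
    (hu : ∀ {w x}, C (u :: w) x ↔ ∃ x', x = u :: x' ∧ C w x') (n : ℕ) (r x : Word) :
    C (List.replicate n u ++ r) x ↔ ∃ r', C r r' ∧ x = List.replicate n u ++ r' := by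
  induction n generalizing x with
  | zero => simp
  | succ n ih =>
    rw [List.replicate_succ, List.cons_append, hu]
    constructor
    · rintro ⟨x', rfl, h⟩
      obtain ⟨r', h', rfl⟩ := (ih x').1 h
      exact ⟨r', h', rfl⟩
    · rintro ⟨r', h', rfl⟩
      exact ⟨_, rfl, (ih _).2 ⟨r', h', rfl⟩⟩

/-- How a differential acts on the word of a tree that is followed by another word: either it
changes the letter `b` between two parts of the tree, or it acts on the rest. -/
theorem body_append_iff {C A : Word → Word → Prop}
    (hu : ∀ {w x}, C (u :: w) x ↔ ∃ x', x = u :: x' ∧ C w x')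
    (hb : ∀ {w x}, C (b :: w) x ↔ A w x ∨ ∃ x', x = b :: x' ∧ C w x') {t : List ℕ} (ht : t ≠ [])
    (r x : Word) :
    C (body t ++ r) x ↔
      (∃ tl tr y, tl ≠ [] ∧ tr ≠ [] ∧ t = tl ++ tr ∧ A (body tr ++ r) y ∧ x = body tl ++ y) ∨
      ∃ r', C r r' ∧ x = body t ++ r' := by
  induction t generalizing x with
  | nil => exact absurd rfl ht
  | cons n t ih =>
    by_cases h : t = []
    · subst h
      simp only [body]
      rw [replicate_append_iff hu]
      constructor
      · exact Or.inr
      · rintro (⟨tl, tr, y, hl, hr, h, -⟩ | h)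
        · exfalso
          cases tl with
          | nil => exact hl rfl
          | cons a tl =>
            have := (List.cons.inj h).2
            exact hr (List.append_eq_nil_iff.1 this.symm).2
        · exact h
    · rw [body_cons h, List.append_assoc, replicate_append_iff hu, List.cons_append]
      constructor
      · rintro ⟨x, hx, rfl⟩
        rcases hb.1 hx with hx | ⟨x', rfl, hx'⟩
        · exact Or.inl ⟨[n], t, x, by simp, h, rfl, hx, rfl⟩
        · rcases (ih h _).1 hx' with ⟨tl, tr, y, hl, hr, rfl, hA, rfl⟩ | ⟨r', hr', rfl⟩
          · exact Or.inl ⟨n :: tl, tr, y, by simp, hr, rfl, hA, by simp [body_cons hl]⟩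
          · exact Or.inr ⟨r', hr', by simp⟩
      · rintro (⟨tl, tr, y, hl, hr, e, hA, rfl⟩ | ⟨r', hr', rfl⟩)
        · cases tl with
          | nil => exact absurd rfl hl
          | cons a tl =>
            obtain ⟨rfl, rfl⟩ := List.cons.inj e
            by_cases htl : tl = []
            · subst htl
              exact ⟨y, hb.2 (Or.inl hA), rfl⟩
            · exact ⟨b :: (body tl ++ y), hb.2 (Or.inr ⟨_, rfl, (ih h _).2
                (Or.inl ⟨tl, tr, y, htl, hr, rfl, hA, rfl⟩)⟩), by simp [body_cons htl]⟩
        · exact ⟨b :: (body t ++ r'), hb.2 (Or.inr ⟨_, rfl, (ih h _).2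
            (Or.inr ⟨r', hr', rfl⟩)⟩), by simp⟩

/-- The letters that a tree contributes to a word where two of its branches are united. -/
theorem exists_merge {t tl tr : List ℕ} (hpos : ∀ n ∈ t, 0 < n) (hl : tl ≠ []) (hr : tr ≠ [])
    (h : t = tl ++ tr) : ∃ v p q v', t = v ++ p :: q :: v' ∧
      ∀ r, body tl ++ u :: (body tr ++ r) = body (v ++ (p + q) :: v') ++ r := by
  obtain ⟨v, p, rfl⟩ := List.eq_nil_or_concat tl |>.resolve_left hl
  cases tr with
  | nil => exact absurd rfl hr
  | cons q v' =>
    subst h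
    refine ⟨v, p, q, v', by simp, fun r => ?_⟩
    rw [← body_merge (hpos p (by simp)) (hpos q (by simp))]
    simp

theorem closeT_append {t : List ℕ} (ht : t ≠ []) (r : Word) :
    closeT (body t ++ c :: r) = body t ++ s :: r := by
  have hrep : ∀ n x, closeT (List.replicate n u ++ x) = List.replicate n u ++ closeT x := by
    intro n x
    induction n with
    | zero => rfl
    | succ n ih => rw [List.replicate_succ, List.cons_append, closeT_u, ih]; rfl
  induction t with
  | nil => exact absurd rfl ht
  | cons n t ih =>
    by_cases h : t = []
    · subst h; simp only [body]; rw [hrep, closeT_c]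
    · rw [body_cons h, List.append_assoc, hrep, List.cons_append, closeT_b, ih h]; simp

/-- The terms of the differential of a triple. -/
def TFacet (τ τ' : Triple) : Prop :=
  UTerm τ τ' ∨ SepF τ τ' ∨ SepG τ τ' ∨ (SepLeft τ τ' ∨ MoveLeft τ τ') ∨
    (SepRight τ τ' ∨ MoveRight τ τ')

theorem facet_iff {n : ℕ} (s s' : Face n) :
    Facet s.1 s'.1 ↔ TFacet (mapI s.1) (mapI s'.1) := by
  obtain ⟨h1, h2, h3, h4, h5⟩ := transformations_iff s s'
  rw [Facet, TFacet, h1, h2, h3, h4, h5]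

theorem cG_b' {w t : Word} :
    CG (b :: w) t ↔ (t = u :: w ∨ t = s :: w) ∨ ∃ t', t = b :: t' ∧ CG w t' := by
  rw [cG_b, or_assoc]

theorem cF_b' {w t : Word} :
    CF (b :: w) t ↔ (t = u :: w ∨ t = s :: w) ∨ ∃ t', t = b :: t' ∧ CF w t' := by
  rw [cF_b, or_assoc]

theorem cT_b' {w t : Word} :
    CT (b :: w) t ↔ (t = u :: w ∨ t = c :: closeT w) ∨ ∃ t', t = b :: t' ∧ CT w t' := by
  rw [cT_b, or_assoc]

/-- The terms of the differential of a short forest. -/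
inductive GMove : List (List ℕ) → List (List ℕ) → Prop
  | merge (A B : List (List ℕ)) (v v' : List ℕ) (p q : ℕ) :
      GMove (A ++ (v ++ p :: q :: v') :: B) (A ++ (v ++ (p + q) :: v') :: B)
  | sep (A B : List (List ℕ)) (tl tr : List ℕ) : tl ≠ [] → tr ≠ [] →
      GMove (A ++ (tl ++ tr) :: B) (A ++ tl :: tr :: B)

theorem GMove.cons {G G' : List (List ℕ)} (h : GMove G G') (t : List ℕ) :
    GMove (t :: G) (t :: G') := by
  cases h with
  | merge A B v v' p q => exact GMove.merge (t :: A) B v v' p q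
  | sep A B tl tr hl hr => exact GMove.sep (t :: A) B tl tr hl hr

theorem exists_gMove_of_cG {G : List (List ℕ)} (hne : ∀ t ∈ G, t ≠ [])
    (hpos : ∀ t ∈ G, ∀ n ∈ t, 0 < n) {w : Word} (h : CG (wordG G) w) :
    ∃ G', GMove G G' ∧ wordG G' = w := by
  induction G generalizing w with
  | nil => exact absurd h cG_nil
  | cons t G ih =>
    rw [wordG, body_append_iff cG_u cG_b' (hne t (by simp))] at h
    rcases h with ⟨tl, tr, y, hl, hr, e, rfl | rfl, rfl⟩ | ⟨r, hr, rfl⟩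
    · obtain ⟨v, p, q, v', rfl, hm⟩ := exists_merge (hpos t (by simp)) hl hr e
      exact ⟨_, GMove.merge [] G v v' p q, (hm _).symm⟩
    · subst e
      exact ⟨_, GMove.sep [] G tl tr hl hr, by simp [wordG]⟩
    · obtain ⟨r, rfl, hr'⟩ := cG_s.1 hr
      obtain ⟨G', hG, rfl⟩ := ih (fun t ht => hne t (by simp [ht]))
        (fun t ht => hpos t (by simp [ht])) hr'
      exact ⟨t :: G', hG.cons t, rfl⟩

theorem cG_of_gMove {G G' : List (List ℕ)} (h : GMove G G') (hne : ∀ t ∈ G, t ≠ [])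
    (hpos : ∀ t ∈ G, ∀ n ∈ t, 0 < n) : CG (wordG G) (wordG G') := by
  have key : ∀ A B B' : List (List ℕ), (∀ t ∈ A, t ≠ []) → CG (wordG B) (wordG B') →
      CG (wordG (A ++ B)) (wordG (A ++ B')) := by
    intro A B B' hA hB
    induction A with
    | nil => exact hB
    | cons t A ih =>
      simp only [List.cons_append, wordG]
      rw [body_append_iff cG_u cG_b' (hA t (by simp))]
      exact Or.inr ⟨_, cG_s.2 ⟨_, rfl, ih fun t ht => hA t (by simp [ht])⟩, rfl⟩
  cases h with
  | merge A B v v' p q =>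
    refine key A _ _ (fun t ht => hne t (by simp [ht])) ?_
    have hp := hpos (v ++ p :: q :: v') (by simp)
    rw [wordG, body_append_iff cG_u cG_b' (by simp)]
    refine Or.inl ⟨v ++ [p], q :: v', _, by simp, by simp, by simp, Or.inl rfl, ?_⟩
    rw [wordG, ← body_merge (hp p (by simp)) (hp q (by simp))]
    simp
  | sep A B tl tr hl hr =>
    refine key A _ _ (fun t ht => hne t (by simp [ht])) ?_
    rw [wordG, body_append_iff cG_u cG_b' (by simp [hl])]
    exact Or.inl ⟨tl, tr, _, hl, hr, rfl, Or.inr rfl, by simp [wordG]⟩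

/-- The terms of the differential of `T` together with the short forest to its right; the first
argument of the resulting triple is what moves to the left. -/
theorem exists_tFacet_of_cF_wordT {T : List ℕ} {G : List (List ℕ)} (hne : ∀ t ∈ G, t ≠ [])
    (hpos : ∀ t ∈ T :: G, ∀ n ∈ t, 0 < n) {w : Word} (h : CF (wordT T G) w) :
    ∃ τ', TFacet ⟨[], T, G⟩ τ' ∧ τ'.word = w := by
  have hG : ∀ G', GMove G G' → TFacet ⟨[], T, G⟩ ⟨[], T, G'⟩ := by
    intro G' h
    cases h with
    | merge A B v v' p q => exact Or.inl (UTerm.G _ _ _ _ _ _ _ _)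
    | sep A B tl tr hl hr => exact Or.inr (Or.inr (Or.inl (SepG.mk _ _ _ _ _ _ hl hr)))
  have hpos' : ∀ t ∈ G, ∀ n ∈ t, 0 < n := fun t ht => hpos t (by simp [ht])
  cases T with
  | nil =>
    obtain ⟨r, rfl, hr⟩ := cF_oc.1 h
    obtain ⟨G', hG', rfl⟩ := exists_gMove_of_cG hne hpos' hr
    exact ⟨⟨[], [], G'⟩, hG G' hG', rfl⟩
  | cons n t =>
    have hT : n :: t ≠ [] := by simp
    have hw : ∀ tl : List ℕ, tl ≠ [] → ∀ G, wordT tl G = o :: (body tl ++ c :: wordG G) := by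
      intro tl htl G
      cases tl with
      | nil => exact absurd rfl htl
      | cons => rfl
    generalize hTe : n :: t = T at h hT hG hpos
    rw [hw T hT] at h
    rcases cF_o.1 h with ⟨x, rfl, hx⟩ | rfl | ⟨x, rfl, hx⟩
    · rcases (body_append_iff cL_u cL_b hT _ _).1 hx with
        ⟨tl, tr, y, hl, hr, rfl, rfl, rfl⟩ | ⟨r, hr, rfl⟩
      · exact ⟨_, Or.inr (Or.inr (Or.inr (Or.inl (Or.inl (SepLeft.mk [] tl tr G hl hr))))),
          by simp [Triple.word, wordF, hw tr hr]⟩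
      · rw [cL_c] at hr
        subst hr
        exact ⟨_, Or.inr (Or.inr (Or.inr (Or.inl (Or.inr (MoveLeft.mk [] T G hT))))), rfl⟩
    · rw [closeT_append hT]
      exact ⟨_, Or.inr (Or.inr (Or.inr (Or.inr (Or.inr (MoveRight.mk [] T G hT))))), rfl⟩
    · rcases (body_append_iff cT_u cT_b' hT _ _).1 hx with
        ⟨tl, tr, y, hl, hr, e, rfl | rfl, rfl⟩ | ⟨r, hr, rfl⟩
      · obtain ⟨v, p, q, v', rfl, hm⟩ := exists_merge (hpos T (by simp)) hl hr e
        exact ⟨_, Or.inl (UTerm.T [] v v' p q G), by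
          rw [hm, Triple.word, wordF, hw _ (by simp)]⟩
      · subst e
        exact ⟨_, Or.inr (Or.inr (Or.inr (Or.inr (Or.inl (SepRight.mk [] tl tr G hl hr))))),
          by simp [Triple.word, wordF, hw tl hl, wordG, closeT_append hr]⟩
      · obtain ⟨r, rfl, hr'⟩ := cT_c.1 hr
        obtain ⟨G', hG', rfl⟩ := exists_gMove_of_cG hne hpos' hr'
        exact ⟨⟨[], T, G'⟩, hG G' hG', by rw [Triple.word, wordF, hw T hT]⟩

theorem TFacet.cons {F G F' G' : List (List ℕ)} {T T' : List ℕ}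
    (h : TFacet ⟨F, T, G⟩ ⟨F', T', G'⟩) (t : List ℕ) :
    TFacet ⟨t :: F, T, G⟩ ⟨t :: F', T', G'⟩ := by
  rcases h with h | h | h | (h | h) | (h | h)
  · refine Or.inl ?_
    cases h with
    | F A B v v' p q => exact UTerm.F (t :: A) B v v' p q _ _
    | T F v v' p q G => exact UTerm.T _ _ _ _ _ _
    | G F T A B v v' p q => exact UTerm.G _ _ _ _ _ _ _ _
  · refine Or.inr (Or.inl ?_)
    cases h with
    | mk A B tl tr _ _ hl hr => exact SepF.mk (t :: A) B tl tr _ _ hl hr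
  · refine Or.inr (Or.inr (Or.inl ?_))
    cases h with
    | mk _ _ A B tl tr hl hr => exact SepG.mk _ _ A B tl tr hl hr
  · refine Or.inr (Or.inr (Or.inr (Or.inl (Or.inl ?_))))
    cases h with
    | mk => exact SepLeft.mk (t :: F) _ _ _ (by assumption) (by assumption)
  · refine Or.inr (Or.inr (Or.inr (Or.inl (Or.inr ?_))))
    cases h with
    | mk _ T _ hT => exact MoveLeft.mk (t :: F) T _ hT
  · refine Or.inr (Or.inr (Or.inr (Or.inr (Or.inl ?_))))
    cases h with
    | mk => exact SepRight.mk _ _ _ _ (by assumption) (by assumption)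
  · refine Or.inr (Or.inr (Or.inr (Or.inr (Or.inr ?_))))
    cases h with
    | mk _ T _ hT => exact MoveRight.mk _ T _ hT

theorem exists_tFacet_of_cF {n : ℕ} {τ : Triple} (hτ : τ.IsTriple n) {w : Word}
    (h : CF τ.word w) : ∃ τ', TFacet τ τ' ∧ τ'.word = w := by
  obtain ⟨F, T, G⟩ := τ
  have hneF := hτ.ne_nil_F
  have hneG := hτ.ne_nil_G
  have hpos := hτ.pos
  clear hτ
  simp only [Triple.word] at h hneF hneG hpos
  induction F generalizing w with
  | nil => exact exists_tFacet_of_cF_wordT hneG hpos h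
  | cons t F ih =>
    obtain ⟨x, rfl, hx⟩ := cF_s.1 h
    rcases (body_append_iff cF_u cF_b' (hneF t (by simp)) _ _).1 hx with
      ⟨tl, tr, y, hl, hr, e, rfl | rfl, rfl⟩ | ⟨r, hr, rfl⟩
    · obtain ⟨v, p, q, v', rfl, hm⟩ := exists_merge (hpos t (by simp)) hl hr e
      exact ⟨_, Or.inl (UTerm.F [] F v v' p q T G), by rw [hm]; rfl⟩
    · subst e
      exact ⟨_, Or.inr (Or.inl (SepF.mk [] F tl tr T G hl hr)), by simp [Triple.word, wordF]⟩
    · obtain ⟨⟨F', T', G'⟩, h1, rfl⟩ := ih hr (fun t ht => hneF t (by simp [ht]))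
        (fun t ht => hpos t (by simp only [List.cons_append, List.mem_cons]; exact Or.inr ht))
      exact ⟨_, h1.cons t, rfl⟩

theorem cF_of_wordF_append {A F F' : List (List ℕ)} {T T' : List ℕ} {G G' : List (List ℕ)}
    (hA : ∀ t ∈ A, t ≠ []) (h : CF (wordF F T G) (wordF F' T' G')) :
    CF (wordF (A ++ F) T G) (wordF (A ++ F') T' G') := by
  induction A with
  | nil => exact h
  | cons t A ih =>
    simp only [List.cons_append, wordF]
    refine cF_s.2 ⟨_, rfl, (body_append_iff cF_u cF_b' (hA t (by simp)) _ _).2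
      (Or.inr ⟨_, ih fun t ht => hA t (by simp [ht]), rfl⟩)⟩

theorem wordT_of_ne_nil {T : List ℕ} (hT : T ≠ []) (G : List (List ℕ)) :
    wordT T G = o :: (body T ++ c :: wordG G) := by
  cases T with
  | nil => exact absurd rfl hT
  | cons => rfl

theorem cF_of_gMove {T : List ℕ} {G G' : List (List ℕ)} (h : CG (wordG G) (wordG G')) :
    CF (wordF [] T G) (wordF [] T G') := by
  cases T with
  | nil => exact cF_oc.2 ⟨_, rfl, h⟩
  | cons n t =>
    exact cF_o.2 (Or.inr (Or.inr ⟨_, rfl, (body_append_iff cT_u cT_b' (by simp) _ _).2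
      (Or.inr ⟨_, cT_c.2 ⟨_, rfl, h⟩, rfl⟩)⟩))

theorem cF_of_tFacet {n : ℕ} {τ τ' : Triple} (hτ : τ.IsTriple n) (h : TFacet τ τ') :
    CF τ.word τ'.word := by
  have hneF := hτ.ne_nil_F
  have hneG := hτ.ne_nil_G
  have hpos := hτ.pos
  clear hτ
  simp only [Triple.word]
  rcases h with h | h | h | (h | h) | (h | h)
  · cases h with
    | F A B v v' p q T G =>
      refine cF_of_wordF_append (fun t ht => hneF t (by simp [ht])) ?_
      have hp := hpos (v ++ p :: q :: v') (by simp)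
      refine cF_s.2 ⟨_, rfl, (body_append_iff cF_u cF_b' (by simp) _ _).2 (Or.inl
        ⟨v ++ [p], q :: v', _, by simp, by simp, by simp, Or.inl rfl, ?_⟩)⟩
      rw [← body_merge (hp p (by simp)) (hp q (by simp))]
      simp
    | T F v v' p q G =>
      have hp := hpos (v ++ p :: q :: v') (by simp)
      have := cF_of_wordF_append (A := F) (F := []) (F' := []) (T := v ++ p :: q :: v')
        (T' := v ++ (p + q) :: v') (G := G) (G' := G) hneF
      simp only [List.append_nil] at this
      refine this ?_
      rw [wordF, wordF, wordT_of_ne_nil (by simp), wordT_of_ne_nil (by simp)]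
      refine cF_o.2 (Or.inr (Or.inr ⟨_, rfl, (body_append_iff cT_u cT_b' (by simp) _ _).2 (Or.inl
        ⟨v ++ [p], q :: v', _, by simp, by simp, by simp, Or.inl rfl, ?_⟩)⟩))
      rw [← body_merge (hp p (by simp)) (hp q (by simp))]
      simp
    | G F T A B v v' p q =>
      have := cF_of_wordF_append (A := F) (F := []) (F' := []) (T := T) (T' := T) hneF
        (cF_of_gMove (T := T) (cG_of_gMove (GMove.merge A B v v' p q) hneG
          fun t ht => hpos t (by simp only [List.mem_append, List.mem_cons] at ht ⊢; tauto)))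
      simpa only [List.append_nil] using this
  · cases h with
    | mk A B tl tr T G hl hr =>
      refine cF_of_wordF_append (fun t ht => hneF t (by simp [ht])) ?_
      exact cF_s.2 ⟨_, rfl, (body_append_iff cF_u cF_b' (by simp [hl]) _ _).2 (Or.inl
        ⟨tl, tr, _, hl, hr, rfl, Or.inr rfl, by simp [wordF]⟩)⟩
  · cases h with
    | mk F T A B tl tr hl hr =>
      have := cF_of_wordF_append (A := F) (F := []) (F' := []) (T := T) (T' := T) hneF
        (cF_of_gMove (T := T) (cG_of_gMove (GMove.sep A B tl tr hl hr) hneG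
          fun t ht => hpos t (by simp only [List.mem_append, List.mem_cons] at ht ⊢; tauto)))
      simpa only [List.append_nil] using this
  · cases h with
    | mk F tl tr G hl hr =>
      have := cF_of_wordF_append (A := F) (F := []) (F' := [tl]) (T := tl ++ tr) (T' := tr)
        (G := G) (G' := G) hneF
      rw [List.append_nil] at this
      refine this ?_
      rw [wordF, wordF, wordF, wordT_of_ne_nil (by simp [hl]), wordT_of_ne_nil hr]
      exact cF_o.2 (Or.inl ⟨_, rfl, (body_append_iff cL_u cL_b (by simp [hl]) _ _).2 (Or.inl
        ⟨tl, tr, _, hl, hr, rfl, rfl, rfl⟩)⟩)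
  · cases h with
    | mk F T G hT =>
      have := cF_of_wordF_append (A := F) (F := []) (F' := [T]) (T := T) (T' := [])
        (G := G) (G' := G) hneF
      rw [List.append_nil] at this
      refine this ?_
      rw [wordF, wordF, wordF, wordT_of_ne_nil hT]
      exact cF_o.2 (Or.inl ⟨_, rfl, (body_append_iff cL_u cL_b hT _ _).2 (Or.inr
        ⟨_, cL_c.2 rfl, rfl⟩)⟩)
  · cases h with
    | mk F tl tr G hl hr =>
      have := cF_of_wordF_append (A := F) (F := []) (F' := []) (T := tl ++ tr) (T' := tl)
        (G := G) (G' := tr :: G) hneF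
      rw [List.append_nil] at this
      refine this ?_
      rw [wordF, wordF, wordT_of_ne_nil (by simp [hl]), wordT_of_ne_nil hl]
      exact cF_o.2 (Or.inr (Or.inr ⟨_, rfl, (body_append_iff cT_u cT_b' (by simp [hl]) _ _).2
        (Or.inl ⟨tl, tr, _, hl, hr, rfl, Or.inr rfl, by rw [closeT_append hr]; rfl⟩)⟩))
  · cases h with
    | mk F T G hT =>
      have := cF_of_wordF_append (A := F) (F := []) (F' := []) (T := T) (T' := [])
        (G := G) (G' := T :: G) hneF
      rw [List.append_nil] at this
      refine this ?_
      rw [wordF, wordF, wordT_of_ne_nil hT]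
      exact cF_o.2 (Or.inr (Or.inl (by rw [closeT_append hT]; rfl)))

theorem isTriple_of_tFacet {n : ℕ} {τ τ' : Triple} (hτ : τ.IsTriple n) (h : TFacet τ τ') :
    τ'.IsTriple n := by
  obtain ⟨hneF, hneG, hpos, hsum⟩ := hτ
  rcases h with h | h | h | (h | h) | (h | h) <;> cases h <;>
    simp only [List.forall_mem_append, List.forall_mem_cons, List.map_append, List.map_cons,
      List.sum_append, List.sum_cons] at hneF hneG hpos hsum <;>
    constructor <;> simp only [List.forall_mem_append, List.forall_mem_cons, List.map_append,
      List.map_cons, List.sum_append, List.sum_cons, List.map_nil, List.sum_nil] <;>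
    first | omega | tauto | (simp_all; done) | (simp_all; tauto)

theorem replicate_append_inj {m n : ℕ} {l l' : Letter} {r r' : Word} (hl : l ≠ u) (hl' : l' ≠ u)
    (h : List.replicate m u ++ l :: r = List.replicate n u ++ l' :: r') :
    m = n ∧ l = l' ∧ r = r' := by
  induction m generalizing n with
  | zero =>
    cases n with
    | zero => simpa using h
    | succ n =>
      rw [List.replicate_succ] at h
      exact absurd (List.cons.inj h).1 hl
  | succ m ih =>
    cases n with
    | zero =>
      rw [List.replicate_succ] at h
      exact absurd (List.cons.inj h).1.symm hl'
    | succ n =>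
      simp only [List.replicate_succ, List.cons_append, List.cons.injEq, true_and] at h
      obtain ⟨h1, h2⟩ := ih h
      exact ⟨by rw [h1], h2⟩

theorem body_append_inj {t t' : List ℕ} (ht : t ≠ []) (ht' : t' ≠ []) (hp : ∀ n ∈ t, 0 < n)
    (hp' : ∀ n ∈ t', 0 < n) {l l' : Letter} {r r' : Word} (hl : l ≠ u ∧ l ≠ b)
    (hl' : l' ≠ u ∧ l' ≠ b) (h : body t ++ l :: r = body t' ++ l' :: r') :
    t = t' ∧ l = l' ∧ r = r' := by
  induction t generalizing t' with
  | nil => exact absurd rfl ht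
  | cons n t ih =>
    cases t' with
    | nil => exact absurd rfl ht'
    | cons m t' =>
      have h1 := hp n (by simp)
      have h2 := hp' m (by simp)
      by_cases hn : t = [] <;> by_cases hm : t' = []
      · subst hn hm
        obtain ⟨h3, h4⟩ := replicate_append_inj hl.1 hl'.1 h
        exact ⟨by rw [show n = m by omega], h4⟩
      · subst hn
        rw [body_cons hm, List.append_assoc] at h
        exact absurd (replicate_append_inj hl.1 (by simp) h).2.1 hl.2
      · subst hm
        rw [body_cons hn, List.append_assoc] at h
        exact absurd (replicate_append_inj (by simp) hl'.1 h).2.1.symm hl'.2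
      · rw [body_cons hn, body_cons hm, List.append_assoc, List.append_assoc] at h
        obtain ⟨h3, -, h4⟩ := replicate_append_inj (by simp) (by simp) h
        obtain ⟨h5, h6⟩ := ih hn hm (fun n h => hp n (by simp [h])) (fun n h => hp' n (by simp [h]))
          h4
        exact ⟨by rw [h5, show n = m by omega], h6⟩

theorem wordG_inj {G G' : List (List ℕ)} (hne : ∀ t ∈ G, t ≠ []) (hne' : ∀ t ∈ G', t ≠ [])
    (hp : ∀ t ∈ G, ∀ n ∈ t, 0 < n) (hp' : ∀ t ∈ G', ∀ n ∈ t, 0 < n)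
    (h : wordG G = wordG G') : G = G' := by
  induction G generalizing G' with
  | nil => cases G' with
    | nil => rfl
    | cons t' G' => simp [wordG] at h
  | cons t G ih => cases G' with
    | nil => simp [wordG] at h
    | cons t' G' =>
      simp only [List.forall_mem_cons] at hne hne' hp hp'
      obtain ⟨h1, -, h2⟩ := body_append_inj hne.1 hne'.1 hp.1 hp'.1 (by simp) (by simp) h
      rw [h1, ih hne.2 hne'.2 hp.2 hp'.2 h2]

theorem exists_wordF_eq_cons (F : List (List ℕ)) (T : List ℕ) (G : List (List ℕ)) :
    ∃ l r, wordF F T G = l :: r ∧ l ≠ u ∧ l ≠ b := by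
  cases F with
  | nil =>
    cases T with
    | nil => exact ⟨_, _, rfl, by simp, by simp⟩
    | cons => exact ⟨_, _, rfl, by simp, by simp⟩
  | cons => exact ⟨_, _, rfl, by simp, by simp⟩

theorem word_inj {n n' : ℕ} {τ τ' : Triple} (hτ : τ.IsTriple n) (hτ' : τ'.IsTriple n')
    (h : τ.word = τ'.word) : τ = τ' := by
  obtain ⟨F, T, G⟩ := τ
  obtain ⟨F', T', G'⟩ := τ'
  obtain ⟨hneF, hneG, hpos, -⟩ := hτ
  obtain ⟨hneF', hneG', hpos', -⟩ := hτ'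
  simp only [Triple.word, List.forall_mem_append, List.forall_mem_cons] at *
  suffices F = F' ∧ T = T' ∧ G = G' by
    obtain ⟨rfl, rfl, rfl⟩ := this
    rfl
  induction F generalizing F' with
  | nil =>
    cases F' with
    | nil =>
      cases T with
      | nil => cases T' with
        | nil =>
          have := wordG_inj hneG hneG' hpos.2.2 hpos'.2.2 (List.cons.inj h).2
          simp [this]
        | cons n' t' => simp [wordF, wordT] at h
      | cons n t => cases T' with
        | nil => simp [wordF, wordT] at h
        | cons n' t' =>
          obtain ⟨h1, -, h2⟩ := body_append_inj (by simp) (by simp) hpos.2.1 hpos'.2.1 (by simp)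
            (by simp) (List.cons.inj h).2
          have := wordG_inj hneG hneG' hpos.2.2 hpos'.2.2 h2
          exact ⟨rfl, h1, this⟩
    | cons t' F' => cases T <;> simp [wordF, wordT] at h
  | cons t F ih =>
    cases F' with
    | nil => cases T' <;> simp [wordF, wordT] at h
    | cons t' F' =>
      simp only [List.forall_mem_cons] at hneF hneF' hpos hpos'
      obtain ⟨l, r, hr, hl⟩ := exists_wordF_eq_cons F T G
      obtain ⟨l', r', hr', hl'⟩ := exists_wordF_eq_cons F' T' G'
      have h0 := (List.cons.inj h).2
      rw [hr, hr'] at h0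
      obtain ⟨rfl, rfl, rfl⟩ := body_append_inj hneF.1 hneF'.1 hpos.1.1 hpos'.1.1 hl hl' h0
      have : F = F' ∧ T = T' ∧ G = G' := by
        refine ih F' (hr.trans hr'.symm) ?_ ?_ ?_ ?_
        exacts [hneF.2, hneF'.2, ⟨hpos.1.2, hpos.2⟩, ⟨hpos'.1.2, hpos'.2⟩]
      simpa using this

theorem vG_wordG (G : List (List ℕ)) : VG (wordG G) := by
  have hrep : ∀ n {x}, VG x → VG (List.replicate n u ++ x) := by
    intro n x hx
    induction n with
    | zero => exact hx
    | succ n ih => exact VG.u ih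
  have hbody : ∀ t {x}, VG x → VG (body t ++ x) := by
    intro t x hx
    induction t with
    | nil => exact hx
    | cons n t ih =>
      by_cases h : t = []
      · subst h; exact hrep _ hx
      · rw [body_cons h, List.append_assoc]; exact hrep _ (VG.b ih)
  induction G with
  | nil => exact VG.nil
  | cons t G ih => exact hbody t (VG.s ih)

theorem vF_word (τ : Triple) : VF τ.word := by
  obtain ⟨F, T, G⟩ := τ
  have hrep : ∀ n {x}, VT x → VT (List.replicate n u ++ x) := by
    intro n x hx
    induction n with
    | zero => exact hx
    | succ n ih => exact VT.u ih
  have hbody : ∀ t {x}, VT x → VT (body t ++ x) := by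
    intro t x hx
    induction t with
    | nil => exact hx
    | cons n t ih =>
      by_cases h : t = []
      · subst h; exact hrep _ hx
      · rw [body_cons h, List.append_assoc]; exact hrep _ (VT.b ih)
  have hrep' : ∀ n {x}, VF x → VF (List.replicate n u ++ x) := by
    intro n x hx
    induction n with
    | zero => exact hx
    | succ n ih => exact VF.u ih
  have hbody' : ∀ t {x}, VF x → VF (body t ++ x) := by
    intro t x hx
    induction t with
    | nil => exact hx
    | cons n t ih =>
      by_cases h : t = []
      · subst h; exact hrep' _ hx
      · rw [body_cons h, List.append_assoc]; exact hrep' _ (VF.b ih)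
  simp only [Triple.word]
  induction F with
  | nil =>
    cases T with
    | nil => exact VF.oc (vG_wordG G)
    | cons n t => exact VF.o (hbody _ (VT.c (vG_wordG G)))
  | cons t F ih => exact VF.s (hbody' t ih)

theorem wdim_body_append {t : List ℕ} (ht : t ≠ []) (x : Word) :
    wdim (body t ++ x) + 1 = t.length + wdim x := by
  have hrep : ∀ n x, wdim (List.replicate n u ++ x) = wdim x := by
    intro n x
    induction n with
    | zero => rfl
    | succ n ih => exact ih
  induction t with
  | nil => exact absurd rfl ht
  | cons n t ih =>
    by_cases h : t = []
    · subst h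
      rw [body, hrep, List.length_singleton, add_comm]
    · rw [body_cons h, List.append_assoc, hrep, List.cons_append, wdim, ih h, List.length_cons]
      omega

/-- The dimension of the word of a triple: the number of branches, minus the number of trees other
than `T`. -/
theorem wdim_word {n : ℕ} {τ : Triple} (hτ : τ.IsTriple n) :
    wdim τ.word + τ.F.length + τ.G.length = ((τ.F ++ τ.T :: τ.G).map List.length).sum := by
  obtain ⟨F, T, G⟩ := τ
  obtain ⟨hneF, hneG, -, -⟩ := hτ
  simp only [Triple.word] at *
  have hG : wdim (wordG G) + G.length = (G.map List.length).sum := by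
    induction G with
    | nil => rfl
    | cons t G ih =>
      simp only [List.forall_mem_cons] at hneG
      have := wdim_body_append hneG.1 (s :: wordG G)
      have := ih hneG.2
      simp only [wordG, List.length_cons, List.map_cons, List.sum_cons]
      simp only [wdim] at *
      omega
  induction F with
  | nil =>
    cases T with
    | nil => simpa [wordF, wordT, wdim] using hG
    | cons m t =>
      have := wdim_body_append (t := m :: t) (by simp) (c :: wordG G)
      simp only [wordF, wordT, List.length_nil, List.nil_append, List.map_cons, List.sum_cons]
      simp only [wdim] at *
      omega
  | cons t F ih =>
    simp only [List.forall_mem_cons] at hneF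
    have := wdim_body_append hneF.1 (wordF F T G)
    have := ih hneF.2
    simp only [wordF, List.length_cons, List.cons_append, List.map_cons, List.sum_cons]
    simp only [wdim] at *
    omega

end

/-! ### Orientations of the freehedron -/

/-- The word of a face. -/
def Face.word {n : ℕ} (s : Face n) : Word := (mapI s.1).word

theorem Face.word_injective {n : ℕ} : Function.Injective (Face.word (n := n)) := by
  intro s s' h
  have := word_inj (isTriple_mapI s.2) (isTriple_mapI s'.2) h
  exact Subtype.ext ((bijOn_mapI n).injOn s.2 s'.2 this)

theorem facet_iff_cF {n : ℕ} (s s' : Face n) : Facet s.1 s'.1 ↔ CF s.word s'.word := by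
  rw [facet_iff]
  refine ⟨cF_of_tFacet (isTriple_mapI s.2), fun h => ?_⟩
  obtain ⟨τ', h1, h2⟩ := exists_tFacet_of_cF (isTriple_mapI s.2) h
  rwa [← word_inj (isTriple_of_tFacet (isTriple_mapI s.2) h1) (isTriple_mapI s'.2) h2]

theorem exists_face_of_isTriple {n : ℕ} {τ : Triple} (h : τ.IsTriple n) :
    ∃ s : Face n, mapI s.1 = τ := by
  obtain ⟨s, hs, rfl⟩ := (bijOn_mapI n).surjOn h
  exact ⟨⟨s, hs⟩, rfl⟩

theorem exists_face_of_cF {n : ℕ} {s : Face n} {w : Word} (h : CF s.word w) :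
    ∃ s' : Face n, s'.word = w := by
  obtain ⟨τ', h1, rfl⟩ := exists_tFacet_of_cF (isTriple_mapI s.2) h
  obtain ⟨s', rfl⟩ := exists_face_of_isTriple (isTriple_of_tFacet (isTriple_mapI s.2) h1)
  exact ⟨s', rfl⟩

theorem card_missing (n : ℕ) (a : ℕ) (gss : List (List ℕ)) (hp : ∀ gs ∈ gss, ∀ g ∈ gs, 0 < g)
    (hne : gss ≠ []) (h : a + (gss.map List.sum).sum ≤ n) :
    ((Finset.range (n + 1)).filter (fun i => ∃ t ∈ stretchesOf a gss, i ∈ t)).card =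
      (gss.map List.length).sum + 1 := by
  have hU : ∀ a, ∀ gss : List (List ℕ), gss ≠ [] → ∀ i, (∃ t ∈ stretchesOf a gss, i ∈ t) ↔
      i ∈ stretch a gss.flatten := by
    intro a gss
    induction gss generalizing a with
    | nil => simp
    | cons g gss ih =>
      intro _ i
      by_cases hg : gss = []
      · subst hg; simp [stretchesOf]
      · rw [List.flatten_cons, stretch_append, Finset.mem_union, ← ih _ hg]
        simp [stretchesOf]
  have hsum : (gss.map List.sum).sum = gss.flatten.sum := List.sum_flatten.symm
  have hpos : ∀ g ∈ gss.flatten, 0 < g := by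
    intro g hg
    obtain ⟨gs, h1, h2⟩ := List.mem_flatten.1 hg
    exact hp gs h1 g h2
  rw [← List.length_flatten, ← card_stretch a _ hpos]
  congr 1
  ext i
  rw [Finset.mem_filter, hU a gss hne, Finset.mem_range]
  refine ⟨fun h => h.2, fun hi => ⟨?_, hi⟩⟩
  have := le_sum_of_mem_stretch hi
  omega

theorem Face.dim_eq {n : ℕ} (s : Face n) : s.dim = wdim s.word := by
  obtain ⟨s, hs⟩ := s
  obtain ⟨τ, hτ, rfl⟩ := exists_expr_of_isNice hs
  have h1 := wdim_word hτ
  have h2 : τ.expr.left.length = τ.F.length := by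
    simp [Triple.expr, length_stretchesOf, gapsOf]
  have h3 : τ.expr.right.length = τ.G.length := by
    simp [Triple.expr, length_stretchesOf, gapsOf]
  have hlen : ∀ F : List (List ℕ), ((gapsOf F).map List.length).sum = (F.map List.length).sum := by
    intro F; simp [gapsOf, List.map_reverse, List.sum_reverse, Function.comp_def]
  have h4 := card_missing n 0 (gapsOf (τ.F ++ τ.T :: τ.G)) (pos_gapsOf hτ.pos)
    (by simp [gapsOf]) (by rw [sum_gapsOf, hτ.leaves, zero_add])
  rw [hlen] at h4
  have h5 := Finset.card_filter_add_card_filter_not (s := Finset.range (n + 1))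
    (fun i => ∃ t ∈ stretchesOf 0 (gapsOf (τ.F ++ τ.T :: τ.G)), i ∈ t)
  rw [h4, Finset.card_range] at h5
  simp only [Face.dim, Face.word, mapI_expr hτ, NExpr.codim, h2, h3, stretches_expr]
  have h6 : (Finset.filter (fun i => ∀ t ∈ stretchesOf 0 (gapsOf (τ.F ++ τ.T :: τ.G)), i ∉ t)
      (Finset.range (n + 1))) = (Finset.filter
      (fun i => ¬ ∃ t ∈ stretchesOf 0 (gapsOf (τ.F ++ τ.T :: τ.G)), i ∈ t)
      (Finset.range (n + 1))) := by
    congr 1; ext i; push Not; rfl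
  rw [h6]
  omega

theorem support_dF_subset {n : ℕ} (s : Face n) :
    ↑(dF' (-1 : ℤ) s.word).support ⊆ Set.range (Face.word (n := n)) := by
  intro w hw
  refine exists_face_of_cF (s := s) ?_
  rw [CF, ← abs_dF, ne_eq, abs_eq_zero]
  simpa using hw

theorem bijOn_support_dF {n : ℕ} (s : Face n) : Set.BijOn (Face.word (n := n))
    (Face.word ⁻¹' ↑(dF' (-1 : ℤ) s.word).support) ↑(dF' (-1 : ℤ) s.word).support := by
  refine ⟨fun s hs => hs, Face.word_injective.injOn, fun w hw => ?_⟩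
  obtain ⟨s', rfl⟩ := support_dF_subset s hw
  exact ⟨s', hw, rfl⟩

/-- The orientation of the freehedron that comes from the differential of words. -/
noncomputable def wordOrientation (n : ℕ) : FreehedronOrientation n where
  bd s := (dF' (-1 : ℤ) s.word).comapDomain Face.word Face.word_injective.injOn
  bd_facet s s' h := by
    rw [facet_iff_cF, CF, ← abs_dF, ne_eq, abs_eq_zero] at h
    have := bdd_dF (η := -1) (by norm_num) s.word s'.word
    rw [Finsupp.comapDomain_apply]
    rw [abs_le] at this
    omega
  bd_not_facet s s' h := by
    rw [facet_iff_cF, CF, ← abs_dF, ne_eq, abs_eq_zero, not_not] at h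
    rwa [Finsupp.comapDomain_apply]
  bd_edge s h := by
    rw [s.dim_eq] at h
    obtain ⟨x, y, -, h1⟩ := dF_edge (vF_word _) (show wdim (mapI s.1).word = 1 by exact_mod_cast h)
    refine (Finsupp.sum_comapDomain Face.word (dF' (-1 : ℤ) s.word) (fun _ c => c)
      (bijOn_support_dF s)).trans ?_
    change (dF' (-1 : ℤ) s.word) = _ at h1
    rw [h1, Finsupp.sum_sub_index (by simp)]
    simp [wd]
  bd_bd s := by
    ext t
    have h := DFunLike.congr_fun (ext_neg_one_dF_dF s.word) t.word
    have key := Finsupp.sum_comapDomain Face.word (dF' (-1 : ℤ) s.word)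
      (fun w c => c • (dF' (-1 : ℤ) w).comapDomain (Face.word (n := n))
        Face.word_injective.injOn)
      (bijOn_support_dF s)
    refine (DFunLike.congr_fun key t).trans ?_
    rw [ext, Finsupp.linearCombination_apply, Finsupp.sum, Finsupp.finsetSum_apply] at h
    rw [Finsupp.sum, Finsupp.finsetSum_apply]
    exact h

theorem wordOrientation_bd {n : ℕ} (s s' : Face n) :
    (wordOrientation n).bd s s' = dF' (-1 : ℤ) s.word s'.word := rfl

/-- Any two orientations of the freehedron differ by signs of the faces. -/
theorem exists_sign_freehedron {n : ℕ} (o o' : FreehedronOrientation n) :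
    ∃ ε : Face n → ℤˣ, ∀ s s', o.bd s s' = ε s * ε s' * o'.bd s s' := by
  refine Orientation.exists_sign (N := n) ?_ ?_ ?_ ?_ ?_ ?_ o o'
  · intro s s' h
    rw [s.dim_eq, s'.dim_eq]
    exact_mod_cast ((facet_iff_cF s s').1 h).wdim (vF_word _)
  · intro s; rw [s.dim_eq]; positivity
  · intro s; rw [Face.dim]; omega
  · intro w x y z t hx hxt hy hyt hz hzt hxy
    simp only [facet_iff_cF] at *
    rcases cF_thin hx hxt hy hyt hz hzt (fun h => hxy (Face.word_injective h)) with h | h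
    · exact Or.inl (Face.word_injective h)
    · exact Or.inr (Face.word_injective h)
  · intro w hw h hh x y hx hy
    simp only [facet_iff_cF] at *
    rw [w.dim_eq] at hw
    -- A function of faces, viewed as a function of words.
    have key := conn_F (vF_word (mapI w.1)) (by exact_mod_cast hw)
      (Function.extend Face.word h 0) ?_ x.word y.word hx hy
    · rwa [Face.word_injective.extend_apply, Face.word_injective.extend_apply] at key
    · intro x y t hx hy hxt hyt
      obtain ⟨x, rfl⟩ := exists_face_of_cF (s := w) hx
      obtain ⟨y, rfl⟩ := exists_face_of_cF (s := w) hy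
      obtain ⟨t, rfl⟩ := exists_face_of_cF hxt
      rw [Face.word_injective.extend_apply, Face.word_injective.extend_apply]
      exact hh x y t hx hy hxt hyt
  · intro w hw x y z hx hy hz hxy
    simp only [facet_iff_cF] at *
    rw [w.dim_eq] at hw
    obtain ⟨v, v', -, h⟩ := dF_edge (vF_word (mapI w.1)) (by exact_mod_cast hw)
    have key : ∀ x : Face n, CF w.word x.word → x.word = v ∨ x.word = v' := by
      intro x hx
      by_contra! hcon
      rw [CF, ← abs_dF, ne_eq, abs_eq_zero] at hx
      change dF' (-1 : ℤ) w.word = _ at h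
      rw [h] at hx
      simp [wd, hcon.1.symm, hcon.2.symm] at hx
    have hxy' : x.word ≠ y.word := fun h => hxy (Face.word_injective h)
    have : z.word = x.word ∨ z.word = y.word := by
      have h1 := key x hx; have h2 := key y hy; have h3 := key z hz
      grind
    rcases this with h | h
    · exact Or.inl (Face.word_injective h)
    · exact Or.inr (Face.word_injective h)

open Mon

/-! ### Monomials -/

theorem fits_iff {c : Col} {ts : List Mon} :
    Fits c ts ↔ ∃ as y, ts = as ++ [y] ∧ (∀ t ∈ as, t.out = Col.a) ∧ y.out = c := by
  constructor
  · intro h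
    rcases List.eq_nil_or_concat ts with rfl | ⟨as, y, rfl⟩
    · simp [Fits] at h
    · rw [List.concat_eq_append] at h ⊢
      simp only [Fits, List.map_append, List.map_cons, List.map_nil, List.length_append,
        List.length_singleton, Nat.add_sub_cancel] at h
      obtain ⟨h1, h2⟩ := List.append_inj h (by simp)
      refine ⟨as, y, rfl, fun t ht => ?_, by simpa using h2⟩
      exact List.eq_of_mem_replicate (h1 ▸ List.mem_map_of_mem ht)
  · rintro ⟨as, y, rfl, h, rfl⟩
    simp only [Fits, List.map_append, List.map_cons, List.map_nil, List.length_append,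
      List.length_singleton, Nat.add_sub_cancel]
    rw [List.eq_replicate_of_mem (l := as.map out) (a := Col.a) (by simpa using h)]
    simp

theorem colL_concat (as : List Mon) (y : Mon) : colL (as ++ [y]) = y.out := by
  simp [colL]

theorem colL_of_forall {ts : List Mon} (h : ∀ t ∈ ts, t.out = Col.a) : colL ts = Col.a := by
  rcases List.eq_nil_or_concat ts with rfl | ⟨as, y, rfl⟩
  · rfl
  · rw [List.concat_eq_append, colL_concat]
    exact h y (by simp)

theorem plug_of_le (op : List Mon → Mon) {as : List Mon} (has : ∀ t ∈ as, t.out = Col.a) (y : Mon)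
    {i j : ℕ} (h : i + j ≤ as.length) :
    plug op (as ++ [y]) i j =
      op (as.take i ++ mu Col.a ((as.drop i).take j) :: (as.drop (i + j) ++ [y])) := by
  rw [plug, List.take_append_of_le_length (by omega), List.drop_append_of_le_length (by omega),
    List.take_append_of_le_length (by simp; omega), List.drop_append_of_le_length (by omega),
    colL_of_forall fun t ht => has t (List.mem_of_mem_drop (List.mem_of_mem_take ht))]

theorem plug_of_eq (op : List Mon → Mon) (as : List Mon) (y : Mon)
    {i j : ℕ} (h : i + j = as.length + 1) (hj : 0 < j) :
    plug op (as ++ [y]) i j = op (as.take i ++ [mu y.out (as.drop i ++ [y])]) := by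
  have h1 : (as.drop i ++ [y]).length = j := by simp; omega
  have h2 : (as ++ [y]).drop (i + j) = [] := List.drop_of_length_le (by simp; omega)
  rw [plug, h2, List.take_append_of_le_length (by omega), List.drop_append_of_le_length (by omega),
    List.take_of_length_le h1.le, colL_concat]

theorem inputsL_append (ts us : List Mon) : inputsL (ts ++ us) = inputsL ts ++ inputsL us := by
  induction ts with
  | nil => simp [inputsL]
  | cons t ts ih => simp [inputsL, ih]

theorem degL_append (ts us : List Mon) : degL (ts ++ us) = degL ts + degL us := by
  induction ts with
  | nil => simp [degL]
  | cons t ts ih => simp [degL, ih, add_assoc]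

/-- The monomial `u` can take the place of `t`: it lies in the same component of the free operad
or of the free bimodule. -/
structure Rep (t u : Mon) : Prop where
  isOp : t.IsOp → u.IsOp
  isBi : t.IsBi → u.IsBi
  out_eq : u.out = t.out
  inputs_eq : u.inputs = t.inputs

theorem Rep.refl (t : Mon) : Rep t t := ⟨id, id, rfl, rfl⟩

theorem Rep.trans {t u v : Mon} (h : Rep t u) (h' : Rep u v) : Rep t v :=
  ⟨h'.isOp ∘ h.isOp, h'.isBi ∘ h.isBi, h'.out_eq.trans h.out_eq, h'.inputs_eq.trans h.inputs_eq⟩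

theorem inputsL_eq_of_forall₂ {ts us : List Mon} (h : List.Forall₂ Rep ts us) :
    inputsL us = inputsL ts := by
  induction h with
  | nil => rfl
  | cons h _ ih => simp only [inputsL, h.inputs_eq, ih]

theorem forall₂_map_out {ts us : List Mon} (h : List.Forall₂ Rep ts us) :
    us.map out = ts.map out := by
  induction h with
  | nil => rfl
  | cons h _ ih => simp only [List.map_cons, h.out_eq, ih]

theorem forall₂_isOp {ts us : List Mon} (h : List.Forall₂ Rep ts us) (ht : ∀ t ∈ ts, t.IsOp) :
    ∀ u ∈ us, u.IsOp := by
  induction h with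
  | nil => simp
  | cons h _ ih =>
    simp only [List.forall_mem_cons] at ht ⊢
    exact ⟨h.isOp ht.1, ih ht.2⟩

theorem forall₂_isBi {ts us : List Mon} (h : List.Forall₂ Rep ts us) (ht : ∀ t ∈ ts, t.IsBi) :
    ∀ u ∈ us, u.IsBi := by
  induction h with
  | nil => simp
  | cons h _ ih =>
    simp only [List.forall_mem_cons] at ht ⊢
    exact ⟨h.isBi ht.1, ih ht.2⟩

theorem Rep.mu {ts us : List Mon} (h : List.Forall₂ Rep ts us) (c : Col) :
    Rep (Mon.mu c ts) (Mon.mu c us) where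
  isOp h' := by
    cases h' with
    | mu _ _ h1 h2 h3 =>
      refine IsOp.mu c us (h.length_eq ▸ h1) ?_ (forall₂_isOp h h3)
      rwa [Fits, forall₂_map_out h, ← h.length_eq]
  isBi h' := by
    cases h' with
    | mu _ _ h1 h2 h3 =>
      refine IsBi.mu c us (h.length_eq ▸ h1) ?_ (forall₂_isBi h h3)
      rwa [Fits, forall₂_map_out h, ← h.length_eq]
  out_eq := rfl
  inputs_eq := by simp only [inputs, inputsL_eq_of_forall₂ h]

theorem Rep.f {ts us : List Mon} (h : List.Forall₂ Rep ts us) (c : Col) :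
    Rep (Mon.f c ts) (Mon.f c us) where
  isOp h' := by cases h'
  isBi h' := by
    cases h' with
    | f _ _ h1 h2 h3 =>
      refine IsBi.f c us (h.length_eq ▸ h1) ?_ (forall₂_isOp h h3)
      rwa [Fits, forall₂_map_out h, ← h.length_eq]
  out_eq := rfl
  inputs_eq := by simp only [inputs, inputsL_eq_of_forall₂ h]

section
variable (k : Type*) [Field k]

/-- Terms of the differential of a tensor product arise by replacing one factor. -/
theorem forall₂_of_mem_support_diffL {ts : List Mon}
    (h : ∀ t ∈ ts, ∀ u ∈ (diff k t).support, Rep t u) :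
    ∀ us ∈ (diffL k ts).support, List.Forall₂ Rep ts us := by
  classical
  induction ts with
  | nil => simp [diffL]
  | cons t ts ih =>
    simp only [List.forall_mem_cons] at h
    intro us hus
    rw [diffL] at hus
    rcases Finset.mem_union.1 (Finsupp.support_add hus) with hus | hus
    · obtain ⟨u, hu, rfl⟩ := Finset.mem_image.1 (Finsupp.mapDomain_support hus)
      exact List.Forall₂.cons (h.1 u hu) (List.forall₂_same.2 fun t _ => Rep.refl t)
    · obtain ⟨vs, hvs, rfl⟩ :=
        Finset.mem_image.1 (Finsupp.mapDomain_support (Finsupp.support_smul hus))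
      exact List.Forall₂.cons (Rep.refl t) (ih h.2 vs hvs)

theorem fits_plug {c : Col} {as : List Mon} (has : ∀ t ∈ as, t.out = Col.a) {y : Mon}
    (hy : y.out = c) {i j : ℕ} (hj : 2 ≤ j) (hij : i + j ≤ (as ++ [y]).length) :
    ∃ l b r, as ++ [y] = l ++ b ++ r ∧ b.length = j ∧ l.length = i ∧ Fits (colL b) b ∧
      Fits c (l ++ Mon.mu (colL b) b :: r) ∧
      ∀ op, plug op (as ++ [y]) i j = op (l ++ Mon.mu (colL b) b :: r) := by
  simp only [List.length_append, List.length_singleton] at hij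
  by_cases h : i + j ≤ as.length
  · have hb : ∀ t ∈ (as.drop i).take j, t.out = Col.a := fun t ht =>
      has t (List.mem_of_mem_drop (List.mem_of_mem_take ht))
    refine ⟨as.take i, (as.drop i).take j, as.drop (i + j) ++ [y], ?_, by simp; omega,
      by simp; omega, ?_, ?_, ?_⟩
    · rw [← List.append_assoc, ← List.drop_drop, List.append_assoc (as.take i),
        List.take_append_drop, List.take_append_drop]
    · rw [colL_of_forall hb, fits_iff]
      have hne : (as.drop i).take j ≠ [] := by
        intro h0
        have := congrArg List.length h0
        simp at this
        omega
      refine ⟨_, _, (List.dropLast_concat_getLast hne).symm,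
        fun t ht => hb t (List.mem_of_mem_dropLast ht), hb _ (List.getLast_mem hne)⟩
    · rw [fits_iff]
      refine ⟨as.take i ++ Mon.mu (colL ((as.drop i).take j)) ((as.drop i).take j) ::
        as.drop (i + j), y, by simp, ?_, hy⟩
      rw [colL_of_forall hb]
      simp only [List.forall_mem_append, List.forall_mem_cons]
      exact ⟨fun t ht => has t (List.mem_of_mem_take ht), rfl,
        fun t ht => has t (List.mem_of_mem_drop ht)⟩
    · intro op
      rw [plug_of_le op has y h, colL_of_forall hb]
  · refine ⟨as.take i, as.drop i ++ [y], [],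
      by rw [List.append_nil, ← List.append_assoc, List.take_append_drop],
      by simp; omega, by simp; omega, ?_, ?_, ?_⟩
    · rw [colL_concat, fits_iff]
      exact ⟨_, y, rfl, fun t ht => has t (List.mem_of_mem_drop ht), rfl⟩
    · rw [fits_iff]
      exact ⟨as.take i, _, rfl, fun t ht => has t (List.mem_of_mem_take ht), by
        rw [colL_concat]; exact hy⟩
    · intro op
      rw [plug_of_eq op as y (by omega) (by omega), colL_concat]

theorem rep_of_mem_support_dMu {c : Col} {ts : List Mon} (h : Fits c ts) {u : Mon}
    (hu : u ∈ (dMu k c ts).support) : Rep (Mon.mu c ts) u := by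
  classical
  obtain ⟨as, y, rfl, has, hy⟩ := fits_iff.1 h
  obtain ⟨i, hi, hu⟩ := Finset.mem_biUnion.1 (Finsupp.support_finsetSum hu)
  obtain ⟨j, hj, hu⟩ := Finset.mem_biUnion.1 (Finsupp.support_finsetSum hu)
  simp only [Finset.mem_filter, Finset.mem_Ico] at hj
  obtain rfl := Finset.mem_singleton.1 (Finsupp.support_single_subset hu)
  obtain ⟨l, b, r, h1, h2, h3, h4, h5, h6⟩ := fits_plug has hy hj.1.1 hj.2
  rw [h6]
  rw [h1] at h hj ⊢
  have hlen : 2 ≤ (l ++ mu (colL b) b :: r).length := by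
    simp only [List.length_append, List.length_cons] at hj ⊢; omega
  refine ⟨fun h' => ?_, fun h' => ?_, rfl, ?_⟩
  · cases h' with
    | mu _ _ _ _ h7 =>
      simp only [List.forall_mem_append] at h7
      refine IsOp.mu c _ hlen h5 ?_
      simp only [List.forall_mem_append, List.forall_mem_cons]
      exact ⟨h7.1.1, IsOp.mu _ _ (by omega) h4 h7.1.2, h7.2⟩
  · cases h' with
    | mu _ _ _ _ h7 =>
      simp only [List.forall_mem_append] at h7
      refine IsBi.mu c _ hlen h5 ?_
      simp only [List.forall_mem_append, List.forall_mem_cons]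
      exact ⟨h7.1.1, IsBi.mu _ _ (by omega) h4 h7.1.2, h7.2⟩
  · simp [inputs, inputsL_append, inputsL]

theorem exists_of_flatten_eq_concat {L : List (List Mon)} {as : List Mon} {y : Mon}
    (h : L.flatten = as ++ [y]) (hL : ∀ b ∈ L, b ≠ []) :
    ∃ L' as', L = L' ++ [as' ++ [y]] ∧ as = L'.flatten ++ as' := by
  rcases List.eq_nil_or_concat L with rfl | ⟨L', b, rfl⟩
  · simp at h
  · rw [List.concat_eq_append] at *
    rcases List.eq_nil_or_concat b with rfl | ⟨as', z, rfl⟩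
    · exact absurd rfl (hL [] (by simp))
    · rw [List.concat_eq_append] at *
      simp only [List.flatten_append, List.flatten_cons, List.flatten_nil, List.append_nil,
        ← List.append_assoc] at h
      obtain ⟨h1, h2⟩ := List.append_inj' h (by simp)
      obtain rfl : z = y := by simpa using h2
      exact ⟨L', as', rfl, h1.symm⟩

theorem splitWrtComposition_ne_nil {ts : List Mon} {r : Composition ts.length} :
    ∀ b ∈ ts.splitWrtComposition r, b ≠ [] := by
  intro b hb h0
  have := List.length_pos_of_mem_splitWrtComposition hb
  simp [h0] at this

theorem rep_of_mem_support_dF {c : Col} {ts : List Mon} (h : Fits c ts) {u : Mon}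
    (hu : u ∈ (dF k c ts).support) : Rep (Mon.f c ts) u := by
  classical
  obtain ⟨as, y, rfl, has, hy⟩ := fits_iff.1 h
  rcases Finset.mem_union.1 (Finsupp.support_sub hu) with hu | hu
  · obtain ⟨i, hi, hu⟩ := Finset.mem_biUnion.1 (Finsupp.support_finsetSum hu)
    obtain ⟨j, hj, hu⟩ := Finset.mem_biUnion.1 (Finsupp.support_finsetSum hu)
    simp only [Finset.mem_filter, Finset.mem_Icc] at hj
    obtain rfl := Finset.mem_singleton.1 (Finsupp.support_single_subset hu)
    obtain ⟨l, b, r, h1, h2, h3, h4, h5, h6⟩ := fits_plug has hy hj.1.1 hj.2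
    rw [h6]
    rw [h1] at h hj ⊢
    refine { isOp := fun h' => (nomatch h'), isBi := fun h' => ?_, out_eq := rfl, inputs_eq := ?_ }
    · cases h' with
      | f _ _ _ _ h7 =>
        simp only [List.forall_mem_append] at h7
        refine IsBi.f c _ (by simp; omega) h5 ?_
        simp only [List.forall_mem_append, List.forall_mem_cons]
        exact ⟨h7.1.1, IsOp.mu _ _ (by omega) h4 h7.1.2, h7.2⟩
    · simp [inputs, inputsL_append, inputsL]
  · obtain ⟨r, hr, hu⟩ := Finset.mem_biUnion.1 (Finsupp.support_finsetSum hu)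
    obtain rfl := Finset.mem_singleton.1 (Finsupp.support_single_subset hu)
    simp only [Finset.mem_filter] at hr
    have h1 := List.flatten_splitWrtComposition _ r
    have hlen := List.length_splitWrtComposition (as ++ [y]) r
    have hL := splitWrtComposition_ne_nil (r := r)
    generalize (as ++ [y]).splitWrtComposition r = L at h1 hlen hL
    have hin : ∀ L : List (List Mon),
        inputsL (L.map fun b => Mon.f (colL b) b) = inputsL L.flatten := by
      intro L
      induction L with
      | nil => rfl
      | cons b L ih => simp [inputsL, inputs, inputsL_append, ih]
    refine { isOp := fun h' => (nomatch h'), isBi := fun h' => ?_, out_eq := rfl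
             inputs_eq := by simp only [inputs, hin, h1] }
    cases h' with
    | f _ _ _ _ h7 =>
      have h8 : ∀ b ∈ L, ∀ t ∈ b, t.IsOp := by
        intro b hb t ht
        exact h7 t (h1 ▸ List.mem_flatten.2 ⟨b, hb, ht⟩)
      obtain ⟨L', as', rfl, rfl⟩ := exists_of_flatten_eq_concat h1 hL
      have h9 : ∀ b ∈ L', ∀ t ∈ b, t.out = Col.a := fun b hb t ht =>
        has t (List.mem_append_left _ (List.mem_flatten.2 ⟨b, hb, ht⟩))
      refine IsBi.mu c _ (by rw [List.length_map, hlen]; exact hr.2) ?_ ?_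
      · rw [fits_iff]
        refine ⟨L'.map (fun b => Mon.f (colL b) b), Mon.f (colL (as' ++ [y])) (as' ++ [y]), by simp,
          ?_, by rw [colL_concat]; exact hy⟩
        intro t ht
        obtain ⟨b, hb, rfl⟩ := List.mem_map.1 ht
        exact colL_of_forall (h9 b hb)
      · intro t ht
        obtain ⟨b, hb, rfl⟩ := List.mem_map.1 ht
        refine IsBi.f _ _ (List.length_pos_iff.2 (hL b hb)) ?_ (h8 b hb)
        rcases List.mem_append.1 hb with hb' | hb'
        · rw [colL_of_forall (h9 b hb'), fits_iff]
          refine ⟨_, _, (List.dropLast_concat_getLast (hL b hb)).symm,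
            fun t ht => h9 b hb' t (List.mem_of_mem_dropLast ht),
            h9 b hb' _ (List.getLast_mem (hL b hb))⟩
        · obtain rfl := List.mem_singleton.1 hb'
          rw [colL_concat, fits_iff]
          exact ⟨as', y, rfl, fun t ht => has t (List.mem_append_right _ ht), rfl⟩

theorem rep_of_mem_support_add {t : Mon} {x y : Mon →₀ k} (hx : ∀ u ∈ x.support, Rep t u)
    (hy : ∀ u ∈ y.support, Rep t u) : ∀ u ∈ (x + y).support, Rep t u := by
  classical
  intro u hu
  rcases Finset.mem_union.1 (Finsupp.support_add hu) with hu | hu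
  · exact hx u hu
  · exact hy u hu

theorem rep_of_isOp {t : Mon} (ht : t.IsOp) : ∀ u ∈ (diff k t).support, Rep t u := by
  classical
  induction ht with
  | inp c => simp [diff]
  | mu c ts h1 h2 h3 ih =>
    rw [diff]
    refine rep_of_mem_support_add k (fun u => rep_of_mem_support_dMu k h2) fun u hu => ?_
    obtain ⟨us, hus, rfl⟩ :=
      Finset.mem_image.1 (Finsupp.mapDomain_support (Finsupp.support_smul hu))
    exact Rep.mu (forall₂_of_mem_support_diffL k ih us hus) c

/-- The differential of the free bimodule preserves its components. -/
theorem rep_of_isBi {t : Mon} (ht : t.IsBi) : ∀ u ∈ (diff k t).support, Rep t u := by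
  classical
  induction ht with
  | f c ts h1 h2 h3 =>
    rw [diff]
    refine rep_of_mem_support_add k (fun u => rep_of_mem_support_dF k h2) fun u hu => ?_
    obtain ⟨us, hus, rfl⟩ :=
      Finset.mem_image.1 (Finsupp.mapDomain_support (Finsupp.support_smul hu))
    exact Rep.f (forall₂_of_mem_support_diffL k (fun t ht => rep_of_isOp k (h3 t ht)) us hus) c
  | mu c ts h1 h2 h3 ih =>
    rw [diff]
    refine rep_of_mem_support_add k (fun u => rep_of_mem_support_dMu k h2) fun u hu => ?_
    obtain ⟨us, hus, rfl⟩ :=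
      Finset.mem_image.1 (Finsupp.mapDomain_support (Finsupp.support_smul hu))
    exact Rep.mu (forall₂_of_mem_support_diffL k ih us hus) c

end

/-! ### Words of trees and weights of monomials -/

section PushWord

variable {R : Type*} [CommRing R]

/-- Put a word in front of every word of a linear combination of words. -/
noncomputable def pushW (w : Word) : (Word →₀ R) →ₗ[R] (Word →₀ R) :=
  Finsupp.lmapDomain R R (fun v => w ++ v)

theorem pushW_wd (w v : Word) : pushW w (wd v : Word →₀ R) = wd (w ++ v) := by
  simp [pushW, wd]

@[simp] theorem pushW_nil (x : Word →₀ R) : pushW [] x = x := by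
  simp only [pushW, Finsupp.lmapDomain_apply, List.nil_append]
  exact Finsupp.mapDomain_id

theorem pushW_append (w w' : Word) (x : Word →₀ R) : pushW (w ++ w') x = pushW w (pushW w' x) := by
  simp only [pushW, Finsupp.lmapDomain_apply, ← Finsupp.mapDomain_comp]
  congr 1
  funext v
  simp

theorem pushW_cons (l : Letter) (w : Word) (x : Word →₀ R) :
    pushW (l :: w) x = push l (pushW w x) := by
  simp only [pushW, push, Finsupp.lmapDomain_apply, ← Finsupp.mapDomain_comp]
  congr 1

variable {D E : (Word →₀ R) →ₗ[R] (Word →₀ R)} {η : R}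

theorem map_pushW_replicate (hu : ∀ x, D (push .u x) = push .u (D x)) (n : ℕ) (x : Word →₀ R) :
    D (pushW (List.replicate n .u) x) = pushW (List.replicate n .u) (D x) := by
  induction n with
  | zero => simp
  | succ n ih => rw [List.replicate_succ, pushW_cons, hu, ih, pushW_cons]

/-- A differential acts on the word of a tree by the Leibniz rule: `E` describes how it acts on
one letter `b`. -/
theorem map_pushW_body (hu : ∀ x, D (push .u x) = push .u (D x))
    (hb : ∀ x, D (push .b x) = E x + η • push .b (D x)) {cs : List ℕ} (hcs : cs ≠ [])
    (x : Word →₀ R) :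
    D (pushW (body cs) x) =
      ∑ i ∈ Finset.range (cs.length - 1),
        η ^ i • pushW (body (cs.take (i + 1))) (E (pushW (body (cs.drop (i + 1))) x)) +
      η ^ (cs.length - 1) • pushW (body cs) (D x) := by
  induction cs with
  | nil => exact absurd rfl hcs
  | cons n t ih =>
    rcases t with _ | ⟨m, t⟩
    · simp [body, map_pushW_replicate hu]
    · have hne : m :: t ≠ [] := by simp
      have ih := ih hne
      simp only [List.length_cons, Nat.add_sub_cancel] at ih ⊢
      rw [body_cons hne, pushW_append, pushW_cons, map_pushW_replicate hu, hb, ih,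
        Finset.sum_range_succ']
      simp only [map_add, smul_add, map_smul, map_sum, Finset.smul_sum, smul_smul, pow_zero,
        one_smul, ← pow_succ', List.take_succ_cons, List.drop_succ_cons, List.take_zero,
        List.drop_zero, pushW_append, pushW_cons]
      simp only [pushW_append, pushW_cons, body]
      abel

end PushWord

section Weight

variable (k : Type*) [Field k]

mutual
/-- The weight of a monomial: `1` if it consists of operations `μ_2` and `f_1`, and `0` otherwise. It
is used for monomials with output of colour `a`, which have weight `0` if they vanish in `T`. -/
def wt : Mon → k
  | inp _ => 1
  | mu _ ts => if ts.length = 2 then wtL ts else 0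
  | f _ ts => if ts.length = 1 then wtL ts else 0
/-- The product of the weights of a list of monomials. -/
def wtL : List Mon → k
  | [] => 1
  | t :: ts => wt t * wtL ts
end

variable {k}

theorem wtL_append (ts us : List Mon) : wtL k (ts ++ us) = wtL k ts * wtL k us := by
  induction ts with
  | nil => simp [wtL]
  | cons t ts ih => simp [wtL, ih, mul_assoc]

theorem wtL_eq_zero_of_mem {t : Mon} {ts : List Mon} (h : t ∈ ts) (h0 : wt k t = 0) :
    wtL k ts = 0 := by
  induction ts with
  | nil => simp at h
  | cons u ts ih =>
    rcases List.mem_cons.1 h with rfl | h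
    · simp [wtL, h0]
    · simp [wtL, ih h]

mutual
theorem deg_eq_zero_of_wt_ne_zero : (t : Mon) → wt k t ≠ 0 → t.deg = 0
  | inp _, _ => by simp [deg]
  | mu _ ts, h => by
    rw [wt] at h
    split at h
    · next h2 => simp [deg, h2, degL_eq_zero_of_wtL_ne_zero ts h]
    · exact absurd rfl h
  | f _ ts, h => by
    rw [wt] at h
    split at h
    · next h2 => simp [deg, h2, degL_eq_zero_of_wtL_ne_zero ts h]
    · exact absurd rfl h
theorem degL_eq_zero_of_wtL_ne_zero : (ts : List Mon) → wtL k ts ≠ 0 → degL ts = 0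
  | [], _ => by simp [degL]
  | t :: ts, h => by
    rw [wtL, mul_ne_zero_iff] at h
    simp [degL, deg_eq_zero_of_wt_ne_zero t h.1, degL_eq_zero_of_wtL_ne_zero ts h.2]
end

theorem sgn_add (x y : ℤ) : sgn k (x + y) = sgn k x * sgn k y := by
  simp [sgn, Int.negOnePow_add]

theorem sgn_natCast (n : ℕ) : sgn k (n : ℤ) = (-1) ^ n := by
  simp [sgn, Int.negOnePow_def]

theorem sgn_two_mul (x : ℤ) : sgn k (2 * x) = 1 := by
  simp [sgn]

theorem sgn_zero : sgn k 0 = 1 := by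
  simp [sgn]

theorem sgn_eq_of_eq_add {e : ℤ} {n : ℕ} (m : ℤ) (h : e = n + 2 * m) : sgn k e = (-1) ^ n := by
  rw [h, sgn_add, sgn_natCast, sgn_two_mul, mul_one]

theorem plug_append (op : List Mon → Mon) (l b r : List Mon) :
    plug op (l ++ (b ++ r)) l.length b.length = op (l ++ mu (colL b) b :: r) := by
  simp [plug, ← List.drop_drop]

theorem exists_append_of_add_le {α : Type*} {ts : List α} {i j : ℕ} (h : i + j ≤ ts.length) :
    ∃ l b r, ts = l ++ (b ++ r) ∧ b.length = j ∧ l.length = i :=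
  ⟨ts.take i, (ts.drop i).take j, (ts.drop i).drop j, by simp, by simp; omega, by simp; omega⟩

theorem wt_plug_mu (c : Col) {ts : List Mon} {i j : ℕ} (hj : 2 ≤ j) (hij : i + j ≤ ts.length) :
    wt k (plug (Mon.mu c) ts i j) = if ts.length = 3 ∧ j = 2 then wtL k ts else 0 := by
  obtain ⟨l, b, r, rfl, rfl, rfl⟩ := exists_append_of_add_le hij
  simp only [plug_append, List.length_append, wt, List.length_cons, wtL_append, wtL]
  split_ifs <;> first | rfl | (exfalso; omega) | ring

theorem wt_plug_f (c : Col) {ts : List Mon} {i j : ℕ} (hj : 2 ≤ j) (hij : i + j ≤ ts.length) :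
    wt k (plug (Mon.f c) ts i j) = if ts.length = 2 ∧ j = 2 then wtL k ts else 0 := by
  obtain ⟨l, b, r, rfl, rfl, rfl⟩ := exists_append_of_add_le hij
  simp only [plug_append, List.length_append, wt, List.length_cons, wtL_append, wtL]
  split_ifs <;> first | rfl | (exfalso; omega) | ring

theorem linearCombination_dMu {M : Type*} [AddCommGroup M] [Module k M] (Φ : Mon → M) (c : Col)
    (ts : List Mon) :
    Finsupp.linearCombination k Φ (dMu k c ts) =
      ∑ i ∈ Finset.range ts.length,
        ∑ j ∈ (Finset.Ico 2 ts.length).filter (fun j => i + j ≤ ts.length),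
          (- sgn k (plugExp ts i j)) • Φ (plug (Mon.mu c) ts i j) := by
  simp only [dMu, map_sum, Finsupp.linearCombination_single]

theorem linearCombination_dF {M : Type*} [AddCommGroup M] [Module k M] (Φ : Mon → M) (c : Col)
    (ts : List Mon) :
    Finsupp.linearCombination k Φ (dF k c ts) =
      ∑ i ∈ Finset.range ts.length,
        ∑ j ∈ (Finset.Icc 2 ts.length).filter (fun j => i + j ≤ ts.length),
          sgn k (plugExp ts i j) • Φ (plug (Mon.f c) ts i j) -
      ∑ r ∈ (Finset.univ : Finset (Composition ts.length)).filter (fun r => 2 ≤ r.length),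
        sgn k (blockExp (ts.splitWrtComposition r)) •
          Φ (Mon.mu c ((ts.splitWrtComposition r).map (fun b => Mon.f (Mon.colL b) b))) := by
  simp only [dF, map_sum, map_sub, Finsupp.linearCombination_single]

theorem linearCombination_wt_dMu (c : Col) (ts : List Mon) :
    Finsupp.linearCombination k (wt k) (dMu k c ts) = 0 := by
  rw [linearCombination_dMu]
  have h : ∀ i ∈ Finset.range ts.length,
      ∑ j ∈ (Finset.Ico 2 ts.length).filter (fun j => i + j ≤ ts.length),
          (- sgn k (plugExp ts i j)) • wt k (plug (Mon.mu c) ts i j) =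
      ∑ j ∈ (Finset.Ico 2 ts.length).filter (fun j => i + j ≤ ts.length),
          (- sgn k (plugExp ts i j)) * if ts.length = 3 ∧ j = 2 then wtL k ts else 0 := by
    intro i _
    refine Finset.sum_congr rfl fun j hj => ?_
    simp only [Finset.mem_filter, Finset.mem_Ico] at hj
    rw [wt_plug_mu c hj.1.1 hj.2, smul_eq_mul]
  rw [Finset.sum_congr rfl h]
  by_cases h3 : ts.length = 3
  · have h4 : Finset.Ico 2 3 = {2} := rfl
    by_cases h0 : wtL k ts = 0
    · simp [h0]
    -- the two ways to insert `μ_2` into `μ_3`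
    · obtain ⟨x, y, z, rfl⟩ := List.length_eq_three.1 h3
      have hx : deg x = 0 := deg_eq_zero_of_wt_ne_zero (k := k) x fun h => h0 (by simp [wtL, h])
      simp [Finset.sum_range_succ, h4, Finset.filter_singleton, plugExp, sgn]
  · simp [h3]

theorem wtL_map_f {L : List (List Mon)} (h : ∀ b ∈ L, b.length = 1) :
    wtL k (L.map fun b => Mon.f (colL b) b) = wtL k L.flatten := by
  induction L with
  | nil => rfl
  | cons b L ih =>
    simp only [List.forall_mem_cons] at h
    simp [wtL, wt, wtL_append, ih h.2, h.1]

theorem wtL_map_f_eq_zero {L : List (List Mon)} (h : ¬ ∀ b ∈ L, b.length = 1) :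
    wtL k (L.map fun b => Mon.f (colL b) b) = 0 := by
  push Not at h
  obtain ⟨b, hb, h⟩ := h
  exact wtL_eq_zero_of_mem (List.mem_map_of_mem hb) (by simp [wt, h])

theorem blockExp_eq_zero {L : List (List Mon)} {b' : List Mon} (h : ∀ b ∈ L, b.length = 1)
    (hdeg : ∀ b ∈ L, degL b = 0) : blockExp (L ++ [b']) = 0 := by
  induction L with
  | nil => simp [blockExp]
  | cons b L ih =>
    simp only [List.forall_mem_cons] at h hdeg
    simp [blockExp, h.1, hdeg.1, ih h.2 hdeg.2]

theorem linearCombination_wt_dF (c : Col) (ts : List Mon) :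
    Finsupp.linearCombination k (wt k) (dF k c ts) = 0 := by
  rw [linearCombination_dF]
  have h : ∀ i ∈ Finset.range ts.length,
      ∑ j ∈ (Finset.Icc 2 ts.length).filter (fun j => i + j ≤ ts.length),
          sgn k (plugExp ts i j) • wt k (plug (Mon.f c) ts i j) =
      ∑ j ∈ (Finset.Icc 2 ts.length).filter (fun j => i + j ≤ ts.length),
          sgn k (plugExp ts i j) * if ts.length = 2 ∧ j = 2 then wtL k ts else 0 := by
    intro i _
    refine Finset.sum_congr rfl fun j hj => ?_
    simp only [Finset.mem_filter, Finset.mem_Icc] at hj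
    rw [wt_plug_f c hj.1.1 hj.2, smul_eq_mul]
  rw [Finset.sum_congr rfl h]
  have h' : ∀ r : Composition ts.length,
      sgn k (blockExp (ts.splitWrtComposition r)) •
        wt k (Mon.mu c ((ts.splitWrtComposition r).map (fun b => Mon.f (Mon.colL b) b))) =
        if ts.length = 2 ∧ r.length = 2 then wtL k ts else 0 := by
    intro r
    have hlen := List.length_splitWrtComposition ts r
    have hflat := List.flatten_splitWrtComposition ts r
    have hne := splitWrtComposition_ne_nil (r := r)
    generalize ts.splitWrtComposition r = L at hlen hflat hne
    subst hflat
    rw [wt, List.length_map, hlen]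
    by_cases hr : r.length = 2
    · obtain ⟨b₁, b₂, rfl⟩ := List.length_eq_two.1 (hlen.trans hr)
      have h1 := List.length_pos_iff.2 (hne b₁ (by simp))
      have h2 := List.length_pos_iff.2 (hne b₂ (by simp))
      by_cases hL : ∀ b ∈ [b₁, b₂], b.length = 1
      · have h3 : [b₁, b₂].flatten.length = 2 := by
          simp [hL b₁ (by simp), hL b₂ (by simp)]
        simp only [hr, wtL_map_f hL, h3, and_self, if_true, smul_eq_mul]
        by_cases h0 : wtL k [b₁, b₂].flatten = 0
        · rw [h0, mul_zero]
        · have h4 : degL b₁ = 0 := degL_eq_zero_of_wtL_ne_zero (k := k) b₁ fun h => h0 (by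
            simp [wtL_append, h])
          rw [show [b₁, b₂] = [b₁] ++ [b₂] from rfl,
            blockExp_eq_zero (by simpa using hL b₁ (by simp)) (by simpa using h4), sgn_zero,
            one_mul]
      · rw [wtL_map_f_eq_zero hL]
        have h3 : [b₁, b₂].flatten.length ≠ 2 := by
          intro h3
          simp only [List.flatten_cons, List.flatten_nil, List.append_nil, List.length_append] at h3
          exact hL (by simp only [List.forall_mem_cons]; exact ⟨by omega, by omega, by simp⟩)
        simp only [hr, if_true, smul_zero, and_true, if_neg h3]
    · simp [hr]
  simp only [h']
  by_cases h2 : ts.length = 2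
  · have h4 : (Finset.univ : Finset (Composition ts.length)).filter (fun r => 2 ≤ r.length) =
        {Composition.ones ts.length} := by
      ext r
      have := r.length_le
      simp only [Finset.mem_filter, Finset.mem_univ, true_and, Finset.mem_singleton,
        Composition.eq_ones_iff_length]
      omega
    rw [h4]
    obtain ⟨x, y, rfl⟩ := List.length_eq_two.1 h2
    simp [Finset.sum_range_succ, Finset.filter_singleton, plugExp, sgn]
  · simp [h2]

mutual
/-- The associativity of `μ^a_2` and the compatibility of `f^a_1` with `μ^a_2` hold for weights:
the weight of a monomial is a cocycle. -/
theorem linearCombination_wt_diff : (t : Mon) →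
    Finsupp.linearCombination k (wt k) (diff k t) = 0
  | inp _ => by simp [diff]
  | mu c ts => by
    rw [diff, map_add, linearCombination_wt_dMu, zero_add, map_smul,
      Finsupp.linearCombination_mapDomain]
    have := linearCombination_wtL_diffL ts fun n => if n = 2 then 1 else 0
    simp only [ite_mul, one_mul, zero_mul] at this
    simp only [Function.comp_def, wt, this, smul_zero]
  | f c ts => by
    rw [diff, map_add, linearCombination_wt_dF, zero_add, map_smul,
      Finsupp.linearCombination_mapDomain]
    have := linearCombination_wtL_diffL ts fun n => if n = 1 then 1 else 0
    simp only [ite_mul, one_mul, zero_mul] at this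
    simp only [Function.comp_def, wt, this, smul_zero]
theorem linearCombination_wtL_diffL : (ts : List Mon) → (g : ℕ → k) →
    Finsupp.linearCombination k (fun us => g us.length * wtL k us) (diffL k ts) = 0
  | [], g => by simp [diffL]
  | t :: ts, g => by
    rw [diffL, map_add, map_smul, Finsupp.linearCombination_mapDomain,
      Finsupp.linearCombination_mapDomain]
    have h1 := linearCombination_wt_diff t
    have h2 := linearCombination_wtL_diffL ts fun n => g (n + 1) * wt k t
    simp only [Function.comp_def, List.length_cons, wtL, ← mul_assoc, h2, smul_zero, add_zero]
    rw [Finsupp.linearCombination_apply, Finsupp.sum] at h1 ⊢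
    simp only [smul_eq_mul] at h1 ⊢
    calc _ = (∑ u ∈ (diff k t).support, diff k t u * wt k u) * (g (ts.length + 1) * wtL k ts) := by
          rw [Finset.sum_mul]
          exact Finset.sum_congr rfl fun _ _ => by ring
      _ = 0 := by rw [h1, zero_mul]
end

end Weight

/-! ### The word of a monomial -/

/-- The number of inputs of a monomial. -/
def leaves (t : Mon) : ℕ := t.inputs.length

/-- The letters of the tree `T` of a triple. -/
def headT : List ℕ → Word
  | [] => [.oc]
  | n :: cs => .o :: (body (n :: cs) ++ [.c])

section Operation

variable (k : Type*) [Field k]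

mutual
/-- The word of a monomial of the free operad with output of colour `m`, multiplied by the weights
of the monomials of colour `a` that are plugged into its operations `μ^m`. The word depends only on
the numbers of leaves of these monomials. The free operad has no operations `f`, so that the value
there is irrelevant. -/
noncomputable def opG : Mon → Word →₀ k
  | inp _ => wd []
  | mu _ ts => wtL k ts.dropLast • pushW (body (ts.dropLast.map leaves)) (push .s (opGLast ts))
  | f _ _ => 0
/-- The value of `opG` at the last monomial of a list. -/
noncomputable def opGLast : List Mon → Word →₀ k
  | [] => 0
  | t :: ts => if ts.isEmpty then opG t else opGLast ts
end

mutual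
/-- The word of a monomial of the free bimodule with output of colour `m`, multiplied by the weights
of the monomials of colour `a` that are plugged into its operations `μ^m` and `f^m`. -/
noncomputable def opF : Mon → Word →₀ k
  | inp _ => 0
  | mu _ ts => wtL k ts.dropLast • push .s (pushW (body (ts.dropLast.map leaves)) (opFLast ts))
  | f _ ts => wtL k ts.dropLast • pushW (headT (ts.dropLast.map leaves)) (opGLast k ts)
/-- The value of `opF` at the last monomial of a list. -/
noncomputable def opFLast : List Mon → Word →₀ k
  | [] => 0
  | t :: ts => if ts.isEmpty then opF t else opFLast ts
end

variable {k}

theorem opGLast_concat (as : List Mon) (y : Mon) : opGLast k (as ++ [y]) = opG k y := by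
  induction as with
  | nil => simp [opGLast]
  | cons a as ih => simp [opGLast, ih]

theorem opFLast_concat (as : List Mon) (y : Mon) : opFLast k (as ++ [y]) = opF k y := by
  induction as with
  | nil => simp [opFLast]
  | cons a as ih => simp [opFLast, ih]

theorem opG_mu (c : Col) (as : List Mon) (y : Mon) : opG k (mu c (as ++ [y])) =
    wtL k as • pushW [] (pushW (body (as.map leaves)) (pushW [.s] (opG k y))) := by
  simp [opG, opGLast_concat, pushW_cons]

theorem opF_mu (c : Col) (as : List Mon) (y : Mon) : opF k (mu c (as ++ [y])) =
    wtL k as • pushW [.s] (pushW (body (as.map leaves)) (pushW [] (opF k y))) := by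
  simp [opF, opFLast_concat, pushW_cons]

theorem opF_f (c : Col) (as : List Mon) (y : Mon) : opF k (f c (as ++ [y])) =
    wtL k as • pushW (headT (as.map leaves)) (opG k y) := by
  simp [opF, opGLast_concat]

/-- A monomial with output of colour `a` and with at least one input, such that all terms of its
differential have the same number of inputs. -/
structure Good (k : Type*) [Field k] (t : Mon) : Prop where
  out_eq : t.out = Col.a
  leaves_pos : 0 < leaves t
  leaves_eq : ∀ u ∈ (diff k t).support, leaves u = leaves t

/-- Let `Ψ` see the monomials of colour `a` in a list only through their weights and their numbers of
leaves. Then their differentials do not contribute, because the weight is a cocycle. No sign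
appears, because monomials of nonzero weight have degree `0`. -/
theorem linearCombination_diffL_concat {M : Type*} [AddCommGroup M] [Module k M]
    {as : List Mon} (has : ∀ t ∈ as, Good k t) (y : Mon) {Ψ : List Mon → M}
    {Θ : List ℕ → Mon → M} (h : ∀ us z, Ψ (us ++ [z]) = wtL k us • Θ (us.map leaves) z) :
    Finsupp.linearCombination k Ψ (diffL k (as ++ [y])) =
      wtL k as • Finsupp.linearCombination k (Θ (as.map leaves)) (diff k y) := by
  induction as generalizing Ψ Θ with
  | nil =>
    have h' : ∀ z, Ψ [z] = Θ [] z := fun z => by simpa [wtL] using h [] z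
    simp [diffL, Finsupp.linearCombination_mapDomain, Function.comp_def, h', wtL]
  | cons a as ih =>
    simp only [List.forall_mem_cons] at has
    rw [List.cons_append, diffL, map_add, map_smul, Finsupp.linearCombination_mapDomain,
      Finsupp.linearCombination_mapDomain]
    have h1 : Finsupp.linearCombination k (Ψ ∘ fun u => u :: (as ++ [y])) (diff k a) = 0 := by
      rw [Finsupp.linearCombination_apply, Finsupp.sum]
      calc _ = ∑ u ∈ (diff k a).support, (diff k a u * wt k u) •
            (wtL k as • Θ ((a :: as).map leaves) y) := by
            refine Finset.sum_congr rfl fun u hu => ?_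
            have h2 := h (u :: as) y
            rw [List.cons_append] at h2
            simp only [Function.comp_apply, h2, wtL, List.map_cons, has.1.leaves_eq u hu,
              smul_smul, mul_assoc]
        _ = 0 := by
            have h2 := linearCombination_wt_diff (k := k) a
            rw [Finsupp.linearCombination_apply, Finsupp.sum] at h2
            simp only [smul_eq_mul] at h2
            rw [← Finset.sum_smul, h2, zero_smul]
    rw [h1, zero_add, ih has.2 (Ψ := Ψ ∘ fun us => a :: us)
      (Θ := fun cs z => wt k a • Θ (leaves a :: cs) z) fun us z => by
        have h2 := h (a :: us) z
        rw [List.cons_append] at h2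
        simp only [Function.comp_apply, h2, wtL, List.map_cons, smul_smul, mul_comm]]
    have h3 : Finsupp.linearCombination k (fun z => wt k a • Θ (leaves a :: as.map leaves) z)
        (diff k y) =
        wt k a • Finsupp.linearCombination k (Θ (leaves a :: as.map leaves)) (diff k y) := by
      simp only [Finsupp.linearCombination_apply, Finsupp.sum, Finset.smul_sum]
      exact Finset.sum_congr rfl fun _ _ => smul_comm _ _ _
    rw [h3, smul_smul, smul_smul, List.map_cons, wtL]
    by_cases h0 : wt k a = 0
    · simp [h0]
    · rw [deg_eq_zero_of_wt_ne_zero a h0, sgn_zero, one_mul, mul_comm]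

theorem sum_filter_add_le {M : Type*} [AddCommMonoid M] {b : ℕ} (F : ℕ → ℕ → M)
    (h : ∀ i j, 2 < j → i + j ≤ b → F i j = 0) (i : ℕ) :
    ∑ j ∈ (Finset.Icc 2 (b + 1)).filter (fun j => i + j ≤ b + 1), F i j =
      (if i < b - 1 then F i 2 else 0) + (if i < b then F i (b + 1 - i) else 0) := by
  have h1 : ∀ j ∈ (Finset.Icc 2 (b + 1)).filter (fun j => i + j ≤ b + 1), F i j =
      (if j = 2 then if i < b - 1 then F i 2 else 0 else 0) +
        (if j = b + 1 - i then F i (b + 1 - i) else 0) := by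
    intro j hj
    simp only [Finset.mem_filter, Finset.mem_Icc] at hj
    by_cases h2 : j = b + 1 - i
    · rw [if_pos h2, ← h2]
      split_ifs
      · omega
      · rw [zero_add]
      · rw [zero_add]
    · rw [if_neg h2]
      by_cases h3 : j = 2
      · rw [if_pos h3, if_pos (by omega), h3, add_zero]
      · rw [if_neg h3, h i j (by omega) (by omega), zero_add]
  rw [Finset.sum_congr rfl h1, Finset.sum_add_distrib, Finset.sum_ite_eq', Finset.sum_ite_eq']
  simp only [Finset.mem_filter, Finset.mem_Icc]
  congr 1
  · split_ifs <;> first | rfl | omega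
  · split_ifs <;> first | rfl | omega

/-- In a double sum over `i` and `j` with `i + j ≤ b + 1` only the summands with `j = 2` and those
with `i + j = b + 1` remain if the others vanish. -/
theorem sum_sum_Icc {M : Type*} [AddCommMonoid M] {b : ℕ} (F : ℕ → ℕ → M)
    (h : ∀ i j, 2 < j → i + j ≤ b → F i j = 0) :
    ∑ i ∈ Finset.range (b + 1),
      ∑ j ∈ (Finset.Icc 2 (b + 1)).filter (fun j => i + j ≤ b + 1), F i j =
    ∑ i ∈ Finset.range (b - 1), F i 2 + ∑ i ∈ Finset.range b, F i (b + 1 - i) := by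
  simp only [sum_filter_add_le F h, Finset.sum_add_distrib, Finset.sum_ite,
    Finset.sum_const_zero, add_zero]
  congr 1
  · congr 1; ext i; simp only [Finset.mem_filter, Finset.mem_range]; omega
  · congr 1; ext i; simp only [Finset.mem_filter, Finset.mem_range]; omega

theorem sum_sum_Ico {M : Type*} [AddCommMonoid M] {b : ℕ} (F : ℕ → ℕ → M)
    (h : ∀ i j, 2 < j → i + j ≤ b → F i j = 0) :
    ∑ i ∈ Finset.range (b + 1),
      ∑ j ∈ (Finset.Ico 2 (b + 1)).filter (fun j => i + j ≤ b + 1), F i j =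
    ∑ i ∈ Finset.range (b - 1), F i 2 + ∑ i ∈ Finset.range (b - 1), F (i + 1) (b - i) := by
  have h1 := sum_sum_Icc (b := b) (fun i j => if j = b + 1 then 0 else F i j) fun i j hj hij => by
    simp only [h i j hj hij, ite_self]
  have h2 : ∀ i, ∑ j ∈ (Finset.Ico 2 (b + 1)).filter (fun j => i + j ≤ b + 1), F i j =
      ∑ j ∈ (Finset.Icc 2 (b + 1)).filter (fun j => i + j ≤ b + 1),
        if j = b + 1 then 0 else F i j := by
    intro i
    rw [Finset.sum_ite, Finset.sum_const_zero, zero_add, Finset.filter_filter]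
    congr 1
    ext j
    simp only [Finset.mem_filter, Finset.mem_Icc, Finset.mem_Ico]
    omega
  simp only [h2, h1]
  congr 1
  · refine Finset.sum_congr rfl fun i hi => if_neg ?_
    have := Finset.mem_range.1 hi
    omega
  · cases b with
    | zero => simp
    | succ b =>
      rw [Finset.sum_range_succ', if_pos (by omega), add_zero]
      refine Finset.sum_congr rfl fun i hi => ?_
      have := Finset.mem_range.1 hi
      rw [if_neg (by omega), show b + 1 + 1 - (i + 1) = b + 1 - i by omega]

end Operation

/-! ### The differential of a monomial as a differential of words -/

section Operation

variable {k : Type*} [Field k]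

theorem sgn_plugExp_two (ts : List Mon) (i : ℕ) : sgn k (plugExp ts i 2) = (-1) ^ i :=
  sgn_eq_of_eq_add ((ts.length : ℤ) - i - 2) (by simp [plugExp])

theorem wtL_take_mul_drop (as : List Mon) (i : ℕ) :
    wtL k (as.take i) * wtL k (as.drop i) = wtL k as := by
  rw [← wtL_append, List.take_append_drop]

/-- The Koszul sign in `plugExp` plays no role, because monomials of nonzero weight have degree
`0`. -/
theorem sgn_plugExp_last (as : List Mon) (y : Mon) {i j : ℕ} (h : i + j = as.length + 1)
    (hj : 0 < j) : sgn k (plugExp (as ++ [y]) i j) * wtL k as = (-1) ^ i * wtL k as := by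
  by_cases h0 : wtL k as = 0
  · simp [h0]
  · have h1 : degL (as.take i) = 0 := degL_eq_zero_of_wtL_ne_zero (k := k) _ fun h1 => h0 (by
      rw [← wtL_take_mul_drop as i, h1, zero_mul])
    congr 1
    refine sgn_eq_of_eq_add 0 ?_
    have h2 : (as ++ [y]).take i = as.take i := List.take_append_of_le_length (by omega)
    have h3 : ((as ++ [y]).length : ℤ) - i - j = 0 := by
      simp only [List.length_append, List.length_singleton]; omega
    rw [plugExp, h2, h1, h3]
    ring

theorem leaves_mu (c : Col) (ts : List Mon) : leaves (mu c ts) = (ts.map leaves).sum := by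
  simp only [leaves, inputs]
  induction ts with
  | nil => simp [inputsL]
  | cons t ts ih => simp [inputsL, ih, leaves]

theorem leaves_f (c : Col) (ts : List Mon) : leaves (f c ts) = (ts.map leaves).sum := by
  rw [← leaves_mu c]
  rfl

/-- To plug an operation `μ^a_2` into an operation `μ^m` or `f^m` means to unite two branches. -/
theorem exists_plug_two {as : List Mon} (has : ∀ t ∈ as, Good k t) {i : ℕ}
    (h : i + 2 ≤ as.length) :
    ∃ as', (∀ op y, plug op (as ++ [y]) i 2 = op (as' ++ [y])) ∧ wtL k as' = wtL k as ∧
      as' ≠ [] ∧ ∀ x : Word →₀ k, pushW (body (as'.map leaves)) x =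
        pushW (body ((as.map leaves).take (i + 1)))
          (push .u (pushW (body ((as.map leaves).drop (i + 1))) x)) := by
  obtain ⟨l, b, r, rfl, hb, rfl⟩ := exists_append_of_add_le h
  obtain ⟨p, q, rfl⟩ := List.length_eq_two.1 hb
  refine ⟨l ++ mu Col.a [p, q] :: r, fun op y => ?_, ?_, by simp, fun x => ?_⟩
  · rw [plug_of_le op (fun t ht => (has t ht).out_eq) y h]
    simp [← List.drop_drop]
  · simp [wtL_append, wtL, wt, mul_assoc]
  · have h1 : ((l ++ ([p, q] ++ r)).map leaves).take (l.length + 1) =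
        l.map leaves ++ [leaves p] := by
      simp [List.take_append, List.take_of_length_le]
    have h2 : ((l ++ ([p, q] ++ r)).map leaves).drop (l.length + 1) =
        leaves q :: r.map leaves := by
      simp [List.drop_append, List.drop_of_length_le]
    rw [h1, h2, ← pushW_cons, ← pushW_append, body_merge (has p (by simp)).leaves_pos
      (has q (by simp)).leaves_pos]
    simp [leaves_mu]

theorem wtL_plug_eq_zero (l b r : List Mon) (h : b.length ≠ 2) :
    wtL k (l ++ mu Col.a b :: r) = 0 :=
  wtL_eq_zero_of_mem (t := mu Col.a b) (by simp) (by simp [wt, h])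

/-- Compatibility of an operation `Φ` with the differentials carries over to the result of an
operation `μ^m`. The words `P` and `Q` say where `Φ` puts the letter `s`. -/
theorem linearCombination_diff_mu {D : (Word →₀ k) →ₗ[k] (Word →₀ k)} {Φ : Mon → Word →₀ k}
    {P Q : Word} (hu : ∀ x, D (push .u x) = push .u (D x))
    (hb : ∀ x, D (push .b x) =
      ((-1 : k) • push .u + push .s : (Word →₀ k) →ₗ[k] (Word →₀ k)) x + (-1 : k) • push .b (D x))
    (hP : ∀ x, D (pushW P x) = pushW P (D x)) (hQ : ∀ x, D (pushW Q x) = pushW Q (D x))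
    (hPQ : ∀ x : Word →₀ k, pushW Q (pushW P x) = push .s x)
    (hΦ : ∀ as y, Φ (mu Col.m (as ++ [y])) =
      wtL k as • pushW P (pushW (body (as.map leaves)) (pushW Q (Φ y))))
    {as : List Mon} (has : ∀ t ∈ as, Good k t) (hne : as ≠ []) {y : Mon} (hy : y.out = Col.m)
    (ih : Finsupp.linearCombination k Φ (diff k y) = D (Φ y)) :
    Finsupp.linearCombination k Φ (diff k (mu Col.m (as ++ [y]))) =
      D (Φ (mu Col.m (as ++ [y]))) := by
  obtain ⟨b, hlen⟩ : ∃ b, as.length = b + 1 :=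
    Nat.exists_eq_succ_of_ne_zero fun h => hne (List.length_eq_zero_iff.1 h)
  have h1 : Finsupp.linearCombination k (fun us => Φ (mu Col.m us)) (diffL k (as ++ [y])) =
      wtL k as • pushW P (pushW (body (as.map leaves)) (pushW Q (D (Φ y)))) := by
    rw [linearCombination_diffL_concat has y (Θ := fun cs z =>
      (pushW P ∘ₗ pushW (body cs) ∘ₗ pushW Q) (Φ z)) hΦ, ← ih]
    have := Finsupp.apply_linearCombination k (pushW P ∘ₗ pushW (body (as.map leaves)) ∘ₗ pushW Q)
      Φ (diff k y)
    rw [Function.comp_def] at this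
    rw [← this]
    rfl
  rw [diff, map_add, map_smul, Finsupp.linearCombination_mapDomain, Function.comp_def, h1,
    linearCombination_dMu]
  simp only [List.length_append, List.length_singleton, hlen]
  rw [sum_sum_Ico]
  · rw [hΦ, map_smul, hP, map_pushW_body hu hb (by simpa using hne)]
    have h2 : sgn k (2 - ((b + 1 + 1 : ℕ) : ℤ)) = (-1) ^ b :=
      sgn_eq_of_eq_add (-b) (by push_cast; ring)
    -- inserting `μ^a_2` unites two branches
    have h3 : ∀ i ∈ Finset.range b,
        (-sgn k (plugExp (as ++ [y]) i 2)) • Φ (plug (mu Col.m) (as ++ [y]) i 2) =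
        wtL k as • (-1 : k) ^ i • pushW P (pushW (body ((as.map leaves).take (i + 1)))
          (-push .u (pushW (body ((as.map leaves).drop (i + 1))) (pushW Q (Φ y))))) := by
      intro i hi
      have := Finset.mem_range.1 hi
      obtain ⟨as', h4, h5, -, h6⟩ := exists_plug_two has (i := i) (by omega)
      rw [h4, hΦ, h5, h6, sgn_plugExp_two]
      simp only [map_neg, smul_neg, neg_smul]
      rw [smul_comm]
    -- inserting `μ^m` at the end separates the tree
    have h4 : ∀ i ∈ Finset.range b,
        (-sgn k (plugExp (as ++ [y]) (i + 1) (b + 1 - i))) •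
          Φ (plug (mu Col.m) (as ++ [y]) (i + 1) (b + 1 - i)) =
        wtL k as • (-1 : k) ^ i • pushW P (pushW (body ((as.map leaves).take (i + 1)))
          (push .s (pushW (body ((as.map leaves).drop (i + 1))) (pushW Q (Φ y))))) := by
      intro i hi
      have := Finset.mem_range.1 hi
      rw [plug_of_eq _ _ _ (by omega) (by omega), hy, hΦ, hΦ]
      simp only [map_smul, smul_smul, hPQ, List.map_take, List.map_drop]
      congr 1
      rw [wtL_take_mul_drop, neg_mul, sgn_plugExp_last _ _ (by omega) (by omega)]
      ring
    simp only [Nat.add_sub_cancel]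
    rw [Finset.sum_congr rfl h3, Finset.sum_congr rfl h4, h2]
    simp only [List.length_map, hlen, Nat.add_sub_cancel, hQ, map_add, map_sum, map_smul,
      smul_add, Finset.smul_sum, LinearMap.add_apply, LinearMap.smul_apply, neg_smul, one_smul,
      Finset.sum_add_distrib, map_neg, smul_neg, add_assoc]
    rw [smul_comm (wtL k as)]
  -- all other terms contain some `μ^a_j` with `j > 2`
  · intro i j hj hij
    rw [plug_of_le _ (fun t ht => (has t ht).out_eq) y (by omega), ← List.cons_append,
      ← List.append_assoc, hΦ, wtL_plug_eq_zero _ _ _ (by simp; omega), zero_smul, smul_zero]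

theorem headT_of_ne_nil {cs : List ℕ} (h : cs ≠ []) : headT cs = .o :: (body cs ++ [.c]) := by
  cases cs with
  | nil => exact absurd rfl h
  | cons n cs => rfl

theorem pushW_headT {cs : List ℕ} (h : cs ≠ []) (x : Word →₀ k) :
    pushW (headT cs) x = push .o (pushW (body cs) (push .c x)) := by
  rw [headT_of_ne_nil h, pushW_cons, pushW_append, pushW_cons, pushW_nil]

theorem ext_eq_of_forall {f : Word → Word →₀ k} {g : (Word →₀ k) →ₗ[k] (Word →₀ k)}
    (h : ∀ w, f w = g (wd w)) (x : Word →₀ k) : ext f x = g x := by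
  have : f = g ∘ fun w => wd w := funext h
  rw [this, ← Finsupp.apply_linearCombination]
  congr 1
  exact ext_wd_eq x

theorem ext_push_of_forall {f : Word → Word →₀ k} {l : Letter}
    {g : (Word →₀ k) →ₗ[k] (Word →₀ k)} (h : ∀ w, f (l :: w) = g (wd w)) (x : Word →₀ k) :
    ext f (push l x) = g x := by
  rw [ext_push, ext_eq_of_forall h]

theorem ext_openT_body {cs : List ℕ} (h : cs ≠ []) (x : Word →₀ k) :
    ext openT (pushW (body cs) (push .c x)) =
      ∑ i ∈ Finset.range (cs.length - 1), pushW (body (cs.take (i + 1)))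
        (push .o (pushW (body (cs.drop (i + 1))) (push .c x))) +
      pushW (body cs) (push .oc x) := by
  rw [map_pushW_body (E := push .o) (η := (1 : k)) ?_ ?_ h]
  · simp only [one_pow, one_smul]
    rw [ext_push_of_forall (g := push .oc)]
    intro w; simp [openT]
  · intro x
    rw [ext_push_of_forall (g := push .u ∘ₗ ext openT) fun w => by simp [openT]]
    rfl
  · intro x
    rw [ext_push_of_forall (g := push .o + push .b ∘ₗ ext openT) fun w => by simp [openT]]
    simp

theorem KT_body {cs : List ℕ} (h : cs ≠ []) (x : Word →₀ k) :
    KT (pushW (body cs) (push .c x)) = pushW (body cs) (push .s x) := by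
  rw [map_pushW_body (E := 0) (η := (1 : k)) ?_ ?_ h]
  · simp only [one_pow, one_smul, LinearMap.zero_apply, map_zero, Finset.sum_const_zero, zero_add]
    rw [ext_push_of_forall (g := push .s)]
    intro w; simp [closeT, push_wd]
  · intro x
    rw [ext_push_of_forall (g := push .u ∘ₗ KT) fun w => by simp [closeT, push_wd]]
    rfl
  · intro x
    rw [ext_push_of_forall (g := push .b ∘ₗ KT) fun w => by simp [closeT, push_wd]]
    simp

theorem ext_dT_body {cs : List ℕ} (h : cs ≠ []) (x : Word →₀ k) :
    ext (dT' (-1)) (pushW (body cs) (push .c x)) =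
      ∑ i ∈ Finset.range (cs.length - 1), (-1 : k) ^ i • pushW (body (cs.take (i + 1)))
        (push .u (pushW (body (cs.drop (i + 1))) (push .c x)) -
          push .c (pushW (body (cs.drop (i + 1))) (push .s x))) +
      (-1 : k) ^ cs.length • pushW (body cs) (push .c (ext (dG (-1)) x)) := by
  rw [map_pushW_body (E := push .u + (-1 : k) • push .c ∘ₗ KT) (η := (-1 : k)) ?_ ?_ h]
  · congr 1
    · refine Finset.sum_congr rfl fun i hi => ?_
      have hi := Finset.mem_range.1 hi
      have h' : cs.drop (i + 1) ≠ [] := by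
        intro h'
        have := congrArg List.length h'
        simp at this
        omega
      simp only [LinearMap.add_apply, LinearMap.smul_apply, LinearMap.comp_apply, KT_body h',
        neg_smul, one_smul, sub_eq_add_neg]
    · rw [ext_push_of_forall (g := (-1 : k) • push .c ∘ₗ ext (dG (-1))) fun w => by simp [dT']]
      simp only [LinearMap.smul_apply, LinearMap.comp_apply, map_smul, smul_smul, ← pow_succ]
      rw [Nat.sub_add_cancel (List.length_pos_iff.2 h)]
  · intro x
    rw [ext_push_of_forall (g := push .u ∘ₗ ext (dT' (-1))) fun w => by simp [dT']]
    rfl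
  · intro x
    rw [ext_push_of_forall (g := push .u + (-1 : k) • push .c ∘ₗ KT +
      (-1 : k) • push .b ∘ₗ ext (dT' (-1))) fun w => by simp [dT']]
    simp

/-- The differential of a word that begins with the letters of the tree `T`. -/
theorem ext_dF_headT (cs : List ℕ) (x : Word →₀ k) :
    ext (dF' (-1)) (pushW (headT cs) x) =
      ∑ i ∈ Finset.range (cs.length - 1), (-1 : k) ^ i • push .o (pushW (body (cs.take (i + 1)))
        (push .u (pushW (body (cs.drop (i + 1))) (push .c x)))) +
      ∑ i ∈ Finset.range cs.length, (-1 : k) ^ i • pushW (headT (cs.take i))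
        (pushW (body (cs.drop i)) (push .s x)) -
      ∑ i ∈ Finset.range cs.length, push .s (pushW (body (cs.take (i + 1)))
        (pushW (headT (cs.drop (i + 1))) x)) +
      (-1 : k) ^ cs.length • pushW (headT cs) (ext (dG (-1)) x) := by
  by_cases h : cs = []
  · subst h
    simp only [headT, pushW_cons, pushW_nil]
    rw [ext_push_of_forall (g := push .oc ∘ₗ ext (dG (-1))) fun w => by simp [dF']]
    simp
  · obtain ⟨b, hlen⟩ : ∃ b, cs.length = b + 1 :=
      Nat.exists_eq_succ_of_ne_zero fun h' => h (List.length_eq_zero_iff.1 h')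
    rw [pushW_headT h, ext_push_of_forall (g := (-1 : k) • push .s ∘ₗ ext openT + push .oc ∘ₗ KT +
      push .o ∘ₗ ext (dT' (-1))) fun w => by simp [dF']]
    simp only [LinearMap.add_apply, LinearMap.smul_apply, LinearMap.comp_apply]
    rw [ext_openT_body h, KT_body h, ext_dT_body h]
    have h1 : ∑ i ∈ Finset.range cs.length, (-1 : k) ^ i • pushW (headT (cs.take i))
        (pushW (body (cs.drop i)) (push .s x)) =
        -∑ i ∈ Finset.range (cs.length - 1), (-1 : k) ^ i • push .o
          (pushW (body (cs.take (i + 1))) (push .c (pushW (body (cs.drop (i + 1))) (push .s x)))) +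
        push .oc (pushW (body cs) (push .s x)) := by
      rw [hlen, Finset.sum_range_succ', ← Finset.sum_neg_distrib, Nat.add_sub_cancel]
      congr 1
      · refine Finset.sum_congr rfl fun i hi => ?_
        have h' : cs.take (i + 1) ≠ [] := by
          simpa using h
        rw [pushW_headT h', pow_succ, mul_neg_one, neg_smul]
      · simp [headT, pushW_cons]
    have h2 : ∑ i ∈ Finset.range cs.length, push .s (pushW (body (cs.take (i + 1)))
        (pushW (headT (cs.drop (i + 1))) x)) =
        ∑ i ∈ Finset.range (cs.length - 1), push .s (pushW (body (cs.take (i + 1)))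
          (push .o (pushW (body (cs.drop (i + 1))) (push .c x)))) +
        push .s (pushW (body cs) (push .oc x)) := by
      rw [hlen, Finset.sum_range_succ, Nat.add_sub_cancel]
      congr 1
      · refine Finset.sum_congr rfl fun i hi => ?_
        have hi := Finset.mem_range.1 hi
        have h' : cs.drop (i + 1) ≠ [] := by
          intro h'
          have := congrArg List.length h'
          simp at this
          omega
        rw [pushW_headT h']
      · rw [← hlen, List.take_length, List.drop_length]
        simp [headT, pushW_cons]
    rw [h1, h2, pushW_headT h]
    simp only [map_add, map_sum, map_smul, map_sub, smul_sub, Finset.sum_sub_distrib, neg_smul,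
      one_smul]
    abel

/-- In a sum over compositions only the compositions `(1, …, 1, b - i)` remain if the other
summands vanish. -/
theorem sum_composition {M : Type*} [AddCommMonoid M] {b N : ℕ} (hN : N = b + 1)
    (F : Composition N → M) (g : ℕ → M)
    (h0 : ∀ r : Composition N, 2 ≤ r.length →
      (∀ i < b, r.blocks ≠ List.replicate (i + 1) 1 ++ [b - i]) → F r = 0)
    (h1 : ∀ i < b, ∀ r : Composition N,
      r.blocks = List.replicate (i + 1) 1 ++ [b - i] → F r = g i) :
    ∑ r ∈ (Finset.univ : Finset (Composition N)).filter (fun r => 2 ≤ r.length), F r =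
      ∑ i ∈ Finset.range b, g i := by
  classical
  subst hN
  have hsum : ∀ i < b, (List.replicate (i + 1) 1 ++ [b - i]).sum = b + 1 := by
    intro i hi
    simp
    omega
  let e : ℕ → Composition (b + 1) := fun i =>
    if hi : i < b then ⟨List.replicate (i + 1) 1 ++ [b - i], by
      intro j hj
      simp only [List.mem_append, List.mem_replicate, List.mem_singleton] at hj
      omega, hsum i hi⟩ else Composition.ones _
  have he : ∀ i < b, (e i).blocks = List.replicate (i + 1) 1 ++ [b - i] := by
    intro i hi
    simp only [e, dif_pos hi]
  symm
  refine Finset.sum_of_injOn e ?_ ?_ ?_ ?_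
  · intro i hi j hj hij
    have hi := Finset.mem_range.1 hi
    have hj := Finset.mem_range.1 hj
    have := congrArg (fun r => r.blocks.length) hij
    simpa [he i hi, he j hj] using this
  · intro i hi
    have hi := Finset.mem_range.1 hi
    simp only [Finset.coe_filter, Set.mem_ofPred_eq, Finset.mem_univ, true_and,
      Composition.length, he i hi]
    simp
  · intro r hr hr'
    simp only [Finset.mem_filter, Finset.mem_univ, true_and] at hr
    refine h0 r hr fun i hi hri => hr' ⟨i, by simpa using hi, ?_⟩
    ext1
    rw [he i hi, hri]
  · intro i hi
    have hi := Finset.mem_range.1 hi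
    exact (h1 i hi _ (he i hi)).symm

theorem map_leaves_map_f {L : List (List Mon)} (h : ∀ b ∈ L, b.length = 1) :
    (L.map fun b => Mon.f (colL b) b).map leaves = L.flatten.map leaves := by
  induction L with
  | nil => rfl
  | cons b L ih =>
    simp only [List.forall_mem_cons] at h
    obtain ⟨t, rfl⟩ := List.length_eq_one_iff.1 h.1
    simp only [List.map_cons, ih h.2, leaves_f, List.flatten_cons, List.map_nil,
      List.sum_singleton, List.singleton_append]

theorem length_flatten_of_forall {L : List (List Mon)} (h : ∀ b ∈ L, b.length = 1) :
    L.flatten.length = L.length := by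
  rw [List.length_flatten, List.map_congr_left h]
  simp

/-- The terms `μ_r (f_{i_1} ⊗ … ⊗ f_{i_r})` of the differential of `f`: only those with
`i_1 = … = i_{r-1} = 1` remain. -/
theorem sum_splitWrtComposition {as : List Mon} {y : Mon} (hy : y.out = Col.m) :
    ∑ r ∈ (Finset.univ : Finset (Composition (as ++ [y]).length)).filter (fun r => 2 ≤ r.length),
      sgn k (blockExp ((as ++ [y]).splitWrtComposition r)) •
        opF k (mu Col.m (((as ++ [y]).splitWrtComposition r).map fun b => Mon.f (colL b) b)) =
    ∑ i ∈ Finset.range as.length, wtL k as • push .s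
      (pushW (body ((as.map leaves).take (i + 1)))
        (pushW (headT ((as.map leaves).drop (i + 1))) (opG k y))) := by
  refine sum_composition (by simp) _ _ ?_ ?_
  · intro r hr hblocks
    have hlen := List.map_length_splitWrtComposition (as ++ [y]) r
    have hflat := List.flatten_splitWrtComposition (as ++ [y]) r
    have hne := splitWrtComposition_ne_nil (r := r)
    generalize (as ++ [y]).splitWrtComposition r = L at hlen hflat hne
    obtain ⟨L', as', rfl, has⟩ := exists_of_flatten_eq_concat hflat hne
    have h0 : ¬ ∀ b ∈ L', b.length = 1 := by
      intro h
      have h1 := length_flatten_of_forall h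
      have h2 : as.length = L'.length + as'.length := by rw [has, List.length_append, h1]
      have h3 : 2 ≤ L'.length + 1 := by
        rw [Composition.length, ← hlen] at hr
        simpa using hr
      refine hblocks (L'.length - 1) (by omega) ?_
      rw [← hlen, List.map_append, List.map_congr_left h, List.map_const', Nat.sub_add_cancel
        (by omega)]
      simp only [List.map_cons, List.map_nil, List.length_append, List.length_singleton]
      congr 2
      omega
    rw [List.map_append, List.map_singleton, opF_mu, wtL_map_f_eq_zero h0, zero_smul, smul_zero]
  · intro i hi r hblocks
    have hlen := List.map_length_splitWrtComposition (as ++ [y]) r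
    have hflat := List.flatten_splitWrtComposition (as ++ [y]) r
    have hne := splitWrtComposition_ne_nil (r := r)
    generalize (as ++ [y]).splitWrtComposition r = L at hlen hflat hne
    obtain ⟨L', as', rfl, has⟩ := exists_of_flatten_eq_concat hflat hne
    rw [hblocks, List.map_append] at hlen
    obtain ⟨h1, -⟩ := List.append_inj' hlen (by simp)
    have h2 : L'.length = i + 1 := by simpa using congrArg List.length h1
    have h3 : ∀ b ∈ L', b.length = 1 := fun b hb =>
      List.eq_of_mem_replicate (h1 ▸ List.mem_map_of_mem hb)
    have h4 := length_flatten_of_forall h3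
    have h5 : (as.map leaves).take (i + 1) = L'.flatten.map leaves := by
      rw [has, List.map_append, List.take_left' (by simp only [List.length_map]; omega)]
    have h6 : (as.map leaves).drop (i + 1) = as'.map leaves := by
      rw [has, List.map_append, List.drop_left' (by simp only [List.length_map]; omega)]
    rw [List.map_append, List.map_singleton, opF_mu, wtL_map_f h3, map_leaves_map_f h3, colL_concat,
      hy, opF_f, h5, h6]
    simp only [map_smul, smul_smul, pushW_cons, pushW_nil]
    congr 1
    rw [← wtL_append, ← has]
    by_cases h0 : wtL k as = 0
    · rw [h0, mul_zero]
    · rw [blockExp_eq_zero h3, sgn_zero, one_mul]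
      intro b hb
      refine degL_eq_zero_of_wtL_ne_zero (k := k) b fun hb0 => h0 ?_
      obtain ⟨X, Y, rfl⟩ := List.append_of_mem hb
      rw [has]
      simp [wtL_append, hb0]

/-- Compatibility with the differentials carries over to the result of an operation `f^m`. -/
theorem linearCombination_diff_f {as : List Mon} (has : ∀ t ∈ as, Good k t) {y : Mon}
    (hy : y.out = Col.m)
    (ih : Finsupp.linearCombination k (opG k) (diff k y) = ext (dG (-1)) (opG k y)) :
    Finsupp.linearCombination k (opF k) (diff k (f Col.m (as ++ [y]))) =
      ext (dF' (-1)) (opF k (f Col.m (as ++ [y]))) := by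
  have h1 : Finsupp.linearCombination k (fun us => opF k (f Col.m us)) (diffL k (as ++ [y])) =
      wtL k as • pushW (headT (as.map leaves)) (ext (dG (-1)) (opG k y)) := by
    rw [linearCombination_diffL_concat has y (Θ := fun cs z => pushW (headT cs) (opG k z))
      (opF_f Col.m), ← ih]
    have := Finsupp.apply_linearCombination k (pushW (headT (as.map leaves))) (opG k) (diff k y)
    rw [Function.comp_def] at this
    rw [← this]
  rw [diff, map_add, map_smul, Finsupp.linearCombination_mapDomain, Function.comp_def, h1,
    linearCombination_dF, sum_splitWrtComposition hy]
  simp only [List.length_append, List.length_singleton]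
  rw [sum_sum_Icc]
  · rw [opF_f, map_smul, ext_dF_headT]
    have h2 : sgn k (1 - ((as.length + 1 : ℕ) : ℤ)) = (-1) ^ as.length :=
      sgn_eq_of_eq_add (-as.length) (by push_cast; ring)
    -- inserting `μ^a_2` unites two branches of `T`
    have h3 : ∀ i ∈ Finset.range (as.length - 1),
        sgn k (plugExp (as ++ [y]) i 2) • opF k (plug (f Col.m) (as ++ [y]) i 2) =
        wtL k as • (-1 : k) ^ i • push .o (pushW (body ((as.map leaves).take (i + 1)))
          (push .u (pushW (body ((as.map leaves).drop (i + 1))) (push .c (opG k y))))) := by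
      intro i hi
      have := Finset.mem_range.1 hi
      obtain ⟨as', h4, h5, h6, h7⟩ := exists_plug_two has (i := i) (by omega)
      rw [h4, opF_f, h5, pushW_headT (by simpa using h6), h7, sgn_plugExp_two, smul_comm]
    -- inserting `μ^m` at the end makes a right part of `T` a tree of `G`
    have h4 : ∀ i ∈ Finset.range as.length,
        sgn k (plugExp (as ++ [y]) i (as.length + 1 - i)) •
          opF k (plug (f Col.m) (as ++ [y]) i (as.length + 1 - i)) =
        wtL k as • (-1 : k) ^ i • pushW (headT ((as.map leaves).take i))
          (pushW (body ((as.map leaves).drop i)) (push .s (opG k y))) := by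
      intro i hi
      have := Finset.mem_range.1 hi
      rw [plug_of_eq _ _ _ (by omega) (by omega), hy, opF_f, opG_mu]
      simp only [map_smul, smul_smul, pushW_nil, pushW_cons, List.map_take, List.map_drop]
      congr 1
      rw [wtL_take_mul_drop, sgn_plugExp_last _ _ (by omega) (by omega), mul_comm]
    rw [Finset.sum_congr rfl h3, Finset.sum_congr rfl h4, h2]
    simp only [List.length_map, smul_add, smul_sub, Finset.smul_sum]
    rw [smul_comm (wtL k as) ((-1 : k) ^ as.length)]
  -- all other terms contain some `μ^a_j` with `j > 2`
  · intro i j hj hij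
    rw [plug_of_le _ (fun t ht => (has t ht).out_eq) y (by omega), ← List.cons_append,
      ← List.append_assoc, opF_f, wtL_plug_eq_zero _ _ _ (by simp; omega), zero_smul, smul_zero]

theorem leaves_pos_of_isOp {t : Mon} (h : t.IsOp) : 0 < leaves t := by
  induction h with
  | inp c => simp [leaves, inputs]
  | mu c ts h1 h2 h3 ih =>
    rw [leaves_mu]
    refine List.sum_pos _ (by simpa using ih) ?_
    intro h; simp at h; simp [h] at h1

theorem leaves_pos_of_isBi {t : Mon} (h : t.IsBi) : 0 < leaves t := by
  induction h with
  | f c ts h1 h2 h3 =>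
    rw [leaves_f]
    refine List.sum_pos _ (by simpa using fun t ht => leaves_pos_of_isOp (h3 t ht)) ?_
    intro h; simp at h; simp [h] at h1
  | mu c ts h1 h2 h3 ih =>
    rw [leaves_mu]
    refine List.sum_pos _ (by simpa using ih) ?_
    intro h; simp at h; simp [h] at h1

theorem good_of_isOp {t : Mon} (h : t.IsOp) (ha : t.out = Col.a) : Good k t :=
  ⟨ha, leaves_pos_of_isOp h, fun u hu => by rw [leaves, leaves, (rep_of_isOp k h u hu).inputs_eq]⟩

theorem good_of_isBi {t : Mon} (h : t.IsBi) (ha : t.out = Col.a) : Good k t :=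
  ⟨ha, leaves_pos_of_isBi h, fun u hu => by rw [leaves, leaves, (rep_of_isBi k h u hu).inputs_eq]⟩

/-- The map `opG` is compatible with the differentials. -/
theorem linearCombination_opG_diff {t : Mon} (h : t.IsOp) (hm : t.out = Col.m) :
    Finsupp.linearCombination k (opG k) (diff k t) = ext (dG (-1)) (opG k t) := by
  induction h with
  | inp c => simp [diff, opG, dG]
  | mu c ts h1 h2 h3 ih =>
    obtain rfl : c = Col.m := hm
    obtain ⟨as, y, rfl, has, hy⟩ := fits_iff.1 h2
    refine linearCombination_diff_mu (P := []) (Q := [.s]) ?_ ?_ ?_ ?_ ?_ (opG_mu Col.m) ?_ ?_ hy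
      (ih y (by simp) hy)
    · intro x
      rw [ext_push_of_forall (g := push .u ∘ₗ ext (dG (-1))) fun w => by simp [dG]]
      rfl
    · intro x
      rw [ext_push_of_forall (g := (-1 : k) • push .u + push .s +
        (-1 : k) • push .b ∘ₗ ext (dG (-1))) fun w => by simp [dG]]
      simp
    · simp
    · intro x
      rw [pushW_cons, pushW_cons,
        ext_push_of_forall (g := push .s ∘ₗ ext (dG (-1))) fun w => by simp [dG]]
      simp
    · simp [pushW_cons]
    · exact fun t ht => good_of_isOp (h3 t (by simp [ht])) (has t ht)
    · rintro rfl; simp at h1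

/-- The map `opF` is compatible with the differentials. -/
theorem linearCombination_opF_diff {t : Mon} (h : t.IsBi) (hm : t.out = Col.m) :
    Finsupp.linearCombination k (opF k) (diff k t) = ext (dF' (-1)) (opF k t) := by
  induction h with
  | f c ts h1 h2 h3 =>
    obtain rfl : c = Col.m := hm
    obtain ⟨as, y, rfl, has, hy⟩ := fits_iff.1 h2
    exact linearCombination_diff_f (fun t ht => good_of_isOp (h3 t (by simp [ht])) (has t ht)) hy
      (linearCombination_opG_diff (h3 y (by simp)) hy)
  | mu c ts h1 h2 h3 ih =>
    obtain rfl : c = Col.m := hm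
    obtain ⟨as, y, rfl, has, hy⟩ := fits_iff.1 h2
    refine linearCombination_diff_mu (P := [.s]) (Q := []) ?_ ?_ ?_ ?_ ?_ (opF_mu Col.m) ?_ ?_ hy
      (ih y (by simp) hy)
    · intro x
      rw [ext_push_of_forall (g := push .u ∘ₗ ext (dF' (-1))) fun w => by simp [dF']]
      rfl
    · intro x
      rw [ext_push_of_forall (g := (-1 : k) • push .u + push .s +
        (-1 : k) • push .b ∘ₗ ext (dF' (-1))) fun w => by simp [dF']]
      simp
    · intro x
      rw [pushW_cons, pushW_cons,
        ext_push_of_forall (g := push .s ∘ₗ ext (dF' (-1))) fun w => by simp [dF']]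
      simp
    · simp
    · simp [pushW_cons]
    · exact fun t ht => good_of_isBi (h3 t (by simp [ht])) (has t ht)
    · rintro rfl; simp at h1

/-! ### Monomials that vanish in `T` -/

theorem isOp_mu_iff {c : Col} {ts : List Mon} :
    (mu c ts).IsOp ↔ 2 ≤ ts.length ∧ Fits c ts ∧ ∀ t ∈ ts, t.IsOp :=
  ⟨fun h => by cases h with | mu _ _ h1 h2 h3 => exact ⟨h1, h2, h3⟩,
    fun h => IsOp.mu c ts h.1 h.2.1 h.2.2⟩

theorem not_isOp_f {c : Col} {ts : List Mon} : ¬ (f c ts).IsOp := fun h => nomatch h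

theorem isBi_mu_iff {c : Col} {ts : List Mon} :
    (mu c ts).IsBi ↔ 2 ≤ ts.length ∧ Fits c ts ∧ ∀ t ∈ ts, t.IsBi :=
  ⟨fun h => by cases h with | mu _ _ h1 h2 h3 => exact ⟨h1, h2, h3⟩,
    fun h => IsBi.mu c ts h.1 h.2.1 h.2.2⟩

theorem isBi_f_iff {c : Col} {ts : List Mon} :
    (f c ts).IsBi ↔ 1 ≤ ts.length ∧ Fits c ts ∧ ∀ t ∈ ts, t.IsOp :=
  ⟨fun h => by cases h with | f _ _ h1 h2 h3 => exact ⟨h1, h2, h3⟩,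
    fun h => IsBi.f c ts h.1 h.2.1 h.2.2⟩

theorem fits_a_iff {ts : List Mon} : Fits Col.a ts ↔ ts ≠ [] ∧ ∀ t ∈ ts, t.out = Col.a := by
  rw [fits_iff]
  constructor
  · rintro ⟨as, y, rfl, h1, h2⟩
    simp only [List.forall_mem_append, List.forall_mem_singleton]
    exact ⟨by simp, h1, h2⟩
  · rintro ⟨h1, h2⟩
    refine ⟨_, _, (List.dropLast_concat_getLast h1).symm,
      fun t ht => h2 t (List.mem_of_mem_dropLast ht), h2 _ (List.getLast_mem h1)⟩

theorem wt_eq_zero_of_killed {t : Mon} (h : t.Killed) (ht : t.IsOp ∨ t.IsBi)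
    (ha : t.out = Col.a) : wt k t = 0 := by
  induction h with
  | mu ts h => rw [wt, if_neg (by omega)]
  | f ts h => rw [wt, if_neg (by omega)]
  | in_mu c ts t hts _ ih =>
    obtain rfl : c = Col.a := ha
    have h0 : wt k t = 0 := by
      rw [isOp_mu_iff, isBi_mu_iff, fits_a_iff] at ht
      rcases ht with ht | ht
      · exact ih (Or.inl (ht.2.2 t hts)) (ht.2.1.2 t hts)
      · exact ih (Or.inr (ht.2.2 t hts)) (ht.2.1.2 t hts)
    rw [wt, wtL_eq_zero_of_mem hts h0, ite_self]
  | in_f c ts t hts _ ih =>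
    obtain rfl : c = Col.a := ha
    have h0 : wt k t = 0 := by
      rw [isBi_f_iff, fits_a_iff] at ht
      rcases ht with ht | ht
      · exact absurd ht not_isOp_f
      · exact ih (Or.inl (ht.2.2 t hts)) (ht.2.1.2 t hts)
    rw [wt, wtL_eq_zero_of_mem hts h0, ite_self]

theorem opG_eq_zero_of_killed {t : Mon} (h : t.Killed) (ht : t.IsOp) (hm : t.out = Col.m) :
    opG k t = 0 := by
  induction h with
  | mu ts h => cases hm
  | f ts h => cases hm
  | in_mu c ts t hts h ih =>
    rw [isOp_mu_iff, fits_iff] at ht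
    obtain ⟨-, ⟨as, y, rfl, has, hy⟩, ht⟩ := ht
    obtain rfl : c = Col.m := hm
    rw [opG_mu]
    rcases List.mem_append.1 hts with hts' | hts'
    · rw [wtL_eq_zero_of_mem hts' (wt_eq_zero_of_killed h (Or.inl (ht t hts)) (has t hts')),
        zero_smul]
    · obtain rfl := List.mem_singleton.1 hts'
      simp [ih (ht t hts) hy]
  | in_f c ts t hts _ ih => exact absurd ht not_isOp_f

theorem opF_eq_zero_of_killed {t : Mon} (h : t.Killed) (ht : t.IsBi) (hm : t.out = Col.m) :
    opF k t = 0 := by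
  induction h with
  | mu ts h => cases hm
  | f ts h => cases hm
  | in_mu c ts t hts h ih =>
    rw [isBi_mu_iff, fits_iff] at ht
    obtain ⟨-, ⟨as, y, rfl, has, hy⟩, ht⟩ := ht
    obtain rfl : c = Col.m := hm
    rw [opF_mu]
    rcases List.mem_append.1 hts with hts' | hts'
    · rw [wtL_eq_zero_of_mem hts' (wt_eq_zero_of_killed h (Or.inr (ht t hts)) (has t hts')),
        zero_smul]
    · obtain rfl := List.mem_singleton.1 hts'
      simp [ih (ht t hts) hy]
  | in_f c ts t hts h _ =>
    rw [isBi_f_iff, fits_iff] at ht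
    obtain ⟨-, ⟨as, y, rfl, has, hy⟩, ht⟩ := ht
    obtain rfl : c = Col.m := hm
    rw [opF_f]
    rcases List.mem_append.1 hts with hts' | hts'
    · rw [wtL_eq_zero_of_mem hts' (wt_eq_zero_of_killed h (Or.inl (ht t hts)) (has t hts')),
        zero_smul]
    · obtain rfl := List.mem_singleton.1 hts'
      simp [opG_eq_zero_of_killed h (ht t hts) hy]

end Operation

/-! ### Relations between monomials -/

section Relations

variable (k : Type*) [Field k]

/-- The combinations of monomials that contain some `μ^a_i` with `i > 2` or some `f^a_i` with
`i > 1`. -/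
noncomputable def killedSpan : Submodule k (Mon →₀ k) := Finsupp.supported k k {t | t.Killed}

/-- The relation `t = t'` holds in `T` because, up to killed monomials, `t - t'` is a multiple of
the differential of a killed monomial. -/
structure Step (t t' : Mon) : Prop where
  rep : Rep t t'
  deg_eq : t'.deg = t.deg
  exists_killed : ∃ κ : Mon, κ.Killed ∧ Rep t κ ∧ ∃ σ : k, σ ≠ 0 ∧
    diff k κ - σ • (Finsupp.single t 1 - Finsupp.single t' 1) ∈ killedSpan k

variable {k}

theorem single_mem_killedSpan {t : Mon} (h : t.Killed) (x : k) :
    Finsupp.single t x ∈ killedSpan k := Finsupp.single_mem_supported k x h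

theorem sgn_ne_zero (e : ℤ) : sgn k e ≠ 0 := by
  rcases Int.even_or_odd e with h | h
  · simp [sgn, Int.negOnePow_even e h]
  · simp [sgn, Int.negOnePow_odd e h]

theorem killed_plug {op : List Mon → Mon}
    (hop : ∀ ts, (∃ t ∈ ts, t.Killed) → (op ts).Killed) {ts : List Mon}
    (h : ∃ t ∈ ts, t.Killed) (i j : ℕ) : (plug op ts i j).Killed := by
  obtain ⟨t, ht, hk⟩ := h
  apply hop
  have h1 : ts = ts.take i ++ ((ts.drop i).take j ++ ts.drop (i + j)) := by
    rw [← List.drop_drop, List.take_append_drop, List.take_append_drop]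
  rw [h1] at ht
  rcases List.mem_append.1 ht with ht | ht
  · exact ⟨t, List.mem_append_left _ ht, hk⟩
  rcases List.mem_append.1 ht with ht | ht
  · exact ⟨_, List.mem_append_right _ (List.mem_cons_self), Killed.in_mu _ _ t ht hk⟩
  · exact ⟨t, List.mem_append_right _ (List.mem_cons_of_mem _ ht), hk⟩

theorem killed_mu (c : Col) (ts : List Mon) (h : ∃ t ∈ ts, t.Killed) : (mu c ts).Killed :=
  let ⟨t, ht, hk⟩ := h
  Killed.in_mu c ts t ht hk

theorem killed_f (c : Col) (ts : List Mon) (h : ∃ t ∈ ts, t.Killed) : (f c ts).Killed :=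
  let ⟨t, ht, hk⟩ := h
  Killed.in_f c ts t ht hk

theorem dMu_mem_killedSpan (c : Col) {ts : List Mon} (h : ∃ t ∈ ts, t.Killed) :
    dMu k c ts ∈ killedSpan k :=
  Submodule.sum_mem _ fun _ _ => Submodule.sum_mem _ fun _ _ =>
    single_mem_killedSpan (killed_plug (killed_mu c) h _ _) _

theorem dF_mem_killedSpan (c : Col) {ts : List Mon} (h : ∃ t ∈ ts, t.Killed) :
    dF k c ts ∈ killedSpan k := by
  refine Submodule.sub_mem _ (Submodule.sum_mem _ fun _ _ => Submodule.sum_mem _ fun _ _ =>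
    single_mem_killedSpan (killed_plug (killed_f c) h _ _) _) (Submodule.sum_mem _ fun r _ =>
      single_mem_killedSpan (killed_mu c _ ?_) _)
  obtain ⟨t, ht, hk⟩ := h
  rw [← List.flatten_splitWrtComposition ts r] at ht
  obtain ⟨b, hb, ht⟩ := List.mem_flatten.1 ht
  exact ⟨_, List.mem_map_of_mem hb, Killed.in_f _ _ t ht hk⟩

/-- The differential of a tensor product, up to terms in which the factor `t` is unchanged. -/
theorem diffL_append_sub_mem (l : List Mon) (t : Mon) (r : List Mon) :
    diffL k (l ++ t :: r) - sgn k (degL l) • Finsupp.mapDomain (fun u => l ++ u :: r) (diff k t) ∈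
      Finsupp.supported k k {us : List Mon | t ∈ us} := by
  have hmap : ∀ (g : List Mon → List Mon) (x : List Mon →₀ k) (P : List Mon → Prop),
      (∀ us ∈ x.support, P (g us)) → Finsupp.mapDomain g x ∈ Finsupp.supported k k {us | P us} := by
    classical
    intro g x P h us hus
    obtain ⟨vs, hvs, rfl⟩ := Finset.mem_image.1 (Finsupp.mapDomain_support hus)
    exact h vs hvs
  induction l with
  | nil =>
    simp only [List.nil_append, diffL, degL, sgn_zero, one_smul, add_sub_cancel_left]
    exact Submodule.smul_mem _ _ (hmap _ _ _ fun us _ => by simp)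
  | cons a l ih =>
    rw [List.cons_append, diffL, degL, sgn_add, add_sub_assoc, mul_smul, ← smul_sub]
    refine Submodule.add_mem _ ?_ (Submodule.smul_mem _ _ ?_)
    · classical
      intro us hus
      obtain ⟨v, hv, rfl⟩ := Finset.mem_image.1 (Finsupp.mapDomain_support hus)
      simp
    · have h1 : Finsupp.mapDomain (fun u => a :: l ++ u :: r) (diff k t) =
          Finsupp.mapDomain (fun us => a :: us)
            (Finsupp.mapDomain (fun u => l ++ u :: r) (diff k t)) := by
        rw [← Finsupp.mapDomain_comp]; rfl
      have h2 := (Finsupp.lmapDomain k k fun us : List Mon => a :: us).map_sub (diffL k (l ++ t :: r))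
        (sgn k (degL l) • Finsupp.mapDomain (fun u => l ++ u :: r) (diff k t))
      rw [map_smul] at h2
      simp only [Finsupp.lmapDomain_apply] at h2
      rw [h1, ← h2]
      exact hmap _ _ _ fun us hus => List.mem_cons_of_mem _ (ih hus)

theorem mapDomain_mem_killedSpan {op : List Mon → Mon} {P : List Mon → Prop}
    (hop : ∀ ts, P ts → (op ts).Killed) {x : List Mon →₀ k}
    (hx : x ∈ Finsupp.supported k k {us | P us}) : Finsupp.mapDomain op x ∈ killedSpan k := by
  classical
  intro us hus
  obtain ⟨vs, hvs, rfl⟩ := Finset.mem_image.1 (Finsupp.mapDomain_support hus)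
  exact hop _ (hx hvs)

theorem Step.congr {t t' : Mon} (h : Step k t t') (l r : List Mon) {op : List Mon → Mon}
    {dop : List Mon → Mon →₀ k} {e : ℤ}
    (hop : ∀ ts, (∃ t ∈ ts, t.Killed) → (op ts).Killed)
    (hdop : ∀ ts, (∃ t ∈ ts, t.Killed) → dop ts ∈ killedSpan k)
    (hdiff : ∀ t, diff k (op (l ++ t :: r)) = dop (l ++ t :: r) +
      sgn k e • Finsupp.mapDomain op (diffL k (l ++ t :: r)))
    (hrep : ∀ u, Rep t u → Rep (op (l ++ t :: r)) (op (l ++ u :: r)))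
    (hdeg : (op (l ++ t' :: r)).deg = (op (l ++ t :: r)).deg) :
    Step k (op (l ++ t :: r)) (op (l ++ t' :: r)) := by
  obtain ⟨κ, hκ, hr, σ, hσ, hd⟩ := h.exists_killed
  refine ⟨hrep _ h.rep, hdeg, op (l ++ κ :: r), hop _ ⟨κ, by simp, hκ⟩, hrep _ hr,
    sgn k e * sgn k (degL l) * σ,
    mul_ne_zero (mul_ne_zero (sgn_ne_zero _) (sgn_ne_zero _)) hσ, ?_⟩
  have h1 := mapDomain_mem_killedSpan (op := op) (P := fun us => κ ∈ us)
    (fun ts hts => hop ts ⟨κ, hts, hκ⟩) (diffL_append_sub_mem (k := k) l κ r)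
  have h2 : Finsupp.mapDomain (fun u => op (l ++ u :: r))
      (diff k κ - σ • (Finsupp.single t 1 - Finsupp.single t' 1)) ∈ killedSpan k := by
    classical
    intro us hus
    obtain ⟨v, hv, rfl⟩ := Finset.mem_image.1 (Finsupp.mapDomain_support hus)
    exact hop _ ⟨v, by simp, hd hv⟩
  rw [hdiff]
  have h3 : dop (l ++ κ :: r) + sgn k e • Finsupp.mapDomain op (diffL k (l ++ κ :: r)) -
      (sgn k e * sgn k (degL l) * σ) •
        (Finsupp.single (op (l ++ t :: r)) 1 - Finsupp.single (op (l ++ t' :: r)) 1) =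
      dop (l ++ κ :: r) + sgn k e • Finsupp.mapDomain op (diffL k (l ++ κ :: r) -
        sgn k (degL l) • Finsupp.mapDomain (fun u => l ++ u :: r) (diff k κ)) +
      (sgn k e * sgn k (degL l)) • Finsupp.mapDomain (fun u => op (l ++ u :: r))
        (diff k κ - σ • (Finsupp.single t 1 - Finsupp.single t' 1)) := by
    have h4 (x : Mon →₀ k) : Finsupp.mapDomain (fun u => op (l ++ u :: r)) x =
        Finsupp.lmapDomain k k op (Finsupp.lmapDomain k k (fun u => l ++ u :: r) x) := by
      simp only [Finsupp.lmapDomain_apply, ← Finsupp.mapDomain_comp]; rfl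
    rw [h4]
    simp only [← Finsupp.lmapDomain_apply k k, map_sub, map_smul]
    simp only [Finsupp.lmapDomain_apply, Finsupp.mapDomain_single]
    module
  rw [h3]
  exact Submodule.add_mem _ (Submodule.add_mem _ (hdop _ ⟨κ, by simp, hκ⟩)
    (Submodule.smul_mem _ _ h1)) (Submodule.smul_mem _ _ h2)

theorem forall₂_append_cons {t u : Mon} (h : Rep t u) (l r : List Mon) :
    List.Forall₂ Rep (l ++ t :: r) (l ++ u :: r) :=
  List.rel_append (List.forall₂_same.2 fun t _ => Rep.refl t)
    (List.Forall₂.cons h (List.forall₂_same.2 fun t _ => Rep.refl t))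

theorem Step.mu {t t' : Mon} (h : Step k t t') (c : Col) (l r : List Mon) :
    Step k (mu c (l ++ t :: r)) (mu c (l ++ t' :: r)) :=
  h.congr l r (killed_mu c) (fun _ => dMu_mem_killedSpan c)
    (e := 2 - ((l ++ t :: r).length : ℤ)) (fun u => by
      rw [diff]; simp only [List.length_append, List.length_cons])
    (fun u hu => Rep.mu (forall₂_append_cons hu l r) c)
    (by simp [deg, degL_append, degL, h.deg_eq])

theorem Step.f {t t' : Mon} (h : Step k t t') (c : Col) (l r : List Mon) :
    Step k (f c (l ++ t :: r)) (f c (l ++ t' :: r)) :=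
  h.congr l r (killed_f c) (fun _ => dF_mem_killedSpan c)
    (e := 1 - ((l ++ t :: r).length : ℤ)) (fun u => by
      rw [diff]; simp only [List.length_append, List.length_cons])
    (fun u hu => Rep.f (forall₂_append_cons hu l r) c)
    (by simp [deg, degL_append, degL, h.deg_eq])

theorem length_of_mem_support_diffL (ts : List Mon) :
    diffL k ts ∈ Finsupp.supported k k {us : List Mon | us.length = ts.length} := by
  classical
  induction ts with
  | nil => simp [diffL]
  | cons t ts ih =>
    rw [diffL]
    refine Submodule.add_mem _ ?_ (Submodule.smul_mem _ _ ?_)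
    · intro us hus
      obtain ⟨v, hv, rfl⟩ := Finset.mem_image.1 (Finsupp.mapDomain_support hus)
      simp
    · intro us hus
      obtain ⟨v, hv, rfl⟩ := Finset.mem_image.1 (Finsupp.mapDomain_support hus)
      simpa using ih hv

theorem out_mu (c : Col) (ts : List Mon) : (mu c ts).out = c := rfl

theorem out_f (c : Col) (ts : List Mon) : (f c ts).out = c := rfl

/-- `μ^a_2` is associative in `T`. -/
theorem step_assoc {x y z : Mon} (hx : x.out = Col.a) (hy : y.out = Col.a) (hz : z.out = Col.a) :
    Step k (mu Col.a [mu Col.a [x, y], z]) (mu Col.a [x, mu Col.a [y, z]]) := by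
  refine ⟨⟨?_, ?_, rfl, ?_⟩, ?_, mu Col.a [x, y, z], Killed.mu _ (by simp), ⟨?_, ?_, rfl, ?_⟩,
    -1, by simp, ?_⟩
  · simp +contextual [isOp_mu_iff, fits_a_iff, out_mu, hx, hy, hz, and_assoc]
  · simp +contextual [isBi_mu_iff, fits_a_iff, out_mu, hx, hy, hz, and_assoc]
  · simp [inputs, inputsL]
  · simp [deg, degL, add_assoc]
  · simp +contextual [isOp_mu_iff, fits_a_iff, out_mu, hx, hy, hz, and_assoc]
  · simp +contextual [isBi_mu_iff, fits_a_iff, out_mu, hx, hy, hz, and_assoc]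
  · simp [inputs, inputsL]
  · have h1 : dMu k Col.a [x, y, z] = (-1 : k) • (Finsupp.single (mu Col.a [mu Col.a [x, y], z]) 1 -
        Finsupp.single (mu Col.a [x, mu Col.a [y, z]]) 1) := by
      have h4 : Finset.Ico 2 3 = {2} := rfl
      simp [dMu, Finset.sum_range_succ, h4, Finset.filter_singleton, plugExp, sgn, plug, colL, hy,
        hz, sub_eq_add_neg, add_comm]
    rw [diff, h1, add_sub_cancel_left]
    exact Submodule.smul_mem _ _ (mapDomain_mem_killedSpan (P := fun us => us.length = 3)
      (fun ts hts => Killed.mu _ (by omega)) (length_of_mem_support_diffL [x, y, z]))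

/-- `f^a_1` is multiplicative in `T`. -/
theorem step_mul {x y : Mon} (hx : x.out = Col.a) (hy : y.out = Col.a) :
    Step k (f Col.a [mu Col.a [x, y]]) (mu Col.a [f Col.a [x], f Col.a [y]]) := by
  refine ⟨⟨?_, ?_, rfl, ?_⟩, ?_, f Col.a [x, y], Killed.f _ (by simp), ⟨?_, ?_, rfl, ?_⟩,
    1, by simp, ?_⟩
  · simp [not_isOp_f]
  · simp +contextual [isBi_mu_iff, isBi_f_iff, isOp_mu_iff, fits_a_iff, out_mu, out_f, hx, hy]
  · simp [inputs, inputsL]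
  · simp [deg, degL]
  · simp [not_isOp_f]
  · simp +contextual [isBi_f_iff, isOp_mu_iff, fits_a_iff, out_mu, hx, hy]
  · simp [inputs, inputsL]
  · have h1 : dF k Col.a [x, y] = (1 : k) • (Finsupp.single (f Col.a [mu Col.a [x, y]]) 1 -
        Finsupp.single (mu Col.a [f Col.a [x], f Col.a [y]]) 1) := by
      have h2 : (Finset.univ : Finset (Composition [x, y].length)).filter (fun r => 2 ≤ r.length) =
          {Composition.ones [x, y].length} := by
        ext r
        have := r.length_le
        simp only [Finset.mem_filter, Finset.mem_univ, true_and, Finset.mem_singleton,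
          Composition.eq_ones_iff_length]
        simp only [List.length_cons, List.length_nil] at this ⊢
        omega
      have h3 : [x, y].splitWrtComposition (Composition.ones [x, y].length) = [[x], [y]] := rfl
      rw [dF, h2, Finset.sum_singleton, h3]
      simp [Finset.sum_range_succ, Finset.filter_singleton, plugExp, sgn, plug, colL, hx, hy,
        blockExp]
    rw [diff, h1, add_sub_cancel_left]
    exact Submodule.smul_mem _ _ (mapDomain_mem_killedSpan (P := fun us => us.length = 2)
      (fun ts hts => Killed.f _ (by omega)) (length_of_mem_support_diffL [x, y]))

end Relations

/-! ### Normal forms -/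

section NormalForm

variable (k : Type*) [Field k]

/-- The monomial `t` can be rewritten as `t'` by the associativity of `μ^a_2` and the
multiplicativity of `f^a_1`. -/
def Red : Mon → Mon → Prop := Relation.ReflTransGen (Step k)

variable {k}

theorem Red.rep {t t' : Mon} (h : Red k t t') : Rep t t' := by
  induction h with
  | refl => exact Rep.refl t
  | tail _ h ih => exact ih.trans h.rep

theorem Red.deg_eq {t t' : Mon} (h : Red k t t') : t'.deg = t.deg := by
  induction h with
  | refl => rfl
  | tail _ h ih => exact h.deg_eq.trans ih

theorem Red.of_forall₂ {op : List Mon → Mon}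
    (hop : ∀ l r t t', Red k t t' → Red k (op (l ++ t :: r)) (op (l ++ t' :: r)))
    {ts ts' : List Mon} (h : List.Forall₂ (Red k) ts ts') (l : List Mon) :
    Red k (op (l ++ ts)) (op (l ++ ts')) := by
  induction h generalizing l with
  | nil => exact Relation.ReflTransGen.refl
  | @cons t t' ts ts' h _ ih =>
    have := ih (l ++ [t'])
    rw [List.append_assoc, List.append_assoc] at this
    exact (hop l ts t t' h).trans this

theorem Red.mu {ts ts' : List Mon} (h : List.Forall₂ (Red k) ts ts') (c : Col) :
    Red k (Mon.mu c ts) (Mon.mu c ts') :=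
  Red.of_forall₂ (op := Mon.mu c) (fun l r _ _ h' =>
    Relation.ReflTransGen.lift (fun t => Mon.mu c (l ++ t :: r)) (fun _ _ h'' => Step.mu h'' c l r) _ _ h') h []

theorem Red.f {ts ts' : List Mon} (h : List.Forall₂ (Red k) ts ts') (c : Col) :
    Red k (Mon.f c ts) (Mon.f c ts') :=
  Red.of_forall₂ (op := Mon.f c) (fun l r _ _ h' =>
    Relation.ReflTransGen.lift (fun t => Mon.f c (l ++ t :: r)) (fun _ _ h'' => Step.f h'' c l r) _ _ h') h []

theorem Red.refl (t : Mon) : Red k t t := Relation.ReflTransGen.refl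

theorem out_comb {x : Mon} (hx : x.out = Col.a) (r : ℕ) : (comb x r).out = Col.a := by
  cases r with
  | zero => exact hx
  | succ r => rfl

/-- The product of two iterated products is an iterated product. -/
theorem red_mu_comb {x : Mon} (hx : x.out = Col.a) (i j : ℕ) :
    Red k (mu Col.a [comb x i, comb x j]) (comb x (i + j + 1)) := by
  induction i with
  | zero => rw [Nat.zero_add]; exact Red.refl _
  | succ i ih =>
    refine (Relation.ReflTransGen.single
      (step_assoc hx (out_comb hx i) (out_comb hx j))).trans ?_
    rw [show i + 1 + j + 1 = (i + j + 1) + 1 by omega]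
    exact Red.mu (.cons (Red.refl _) (.cons ih .nil)) _

theorem red_f_comb (i : ℕ) :
    Red k (f Col.a [comb (inp Col.a) i]) (comb (f Col.a [inp Col.a]) i) := by
  induction i with
  | zero => exact Red.refl _
  | succ i ih =>
    exact (Relation.ReflTransGen.single (step_mul rfl (out_comb rfl i))).trans
      (Red.mu (.cons (Red.refl _) (.cons ih .nil)) _)

theorem exists_red_comb_mu {ts : List Mon} (h : ¬ (mu Col.a ts).Killed) (h2 : 2 ≤ ts.length)
    {x : Mon} (hx : x.out = Col.a) (ih : ∀ t ∈ ts, ∃ r, Red k t (comb x r)) :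
    ∃ r, Red k (mu Col.a ts) (comb x r) := by
  have h3 : ts.length = 2 := le_antisymm (not_lt.1 fun h' => h (Killed.mu ts h')) h2
  obtain ⟨p, q, rfl⟩ := List.length_eq_two.1 h3
  obtain ⟨i, hi⟩ := ih p (by simp)
  obtain ⟨j, hj⟩ := ih q (by simp)
  exact ⟨_, (Red.mu (.cons hi (.cons hj .nil)) _).trans (red_mu_comb hx i j)⟩

theorem exists_red_comb_of_isOp {t : Mon} (ht : t.IsOp) (ha : t.out = Col.a) (hk : ¬ t.Killed) :
    ∃ r, Red k t (comb (inp Col.a) r) := by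
  induction ht with
  | inp c =>
    obtain rfl : c = Col.a := ha
    exact ⟨0, Red.refl _⟩
  | mu c ts h1 h2 h3 ih =>
    obtain rfl : c = Col.a := ha
    exact exists_red_comb_mu hk h1 rfl fun t ht =>
      ih t ht ((fits_a_iff.1 h2).2 t ht) fun h => hk (Killed.in_mu _ _ t ht h)

theorem exists_red_comb_of_isBi {t : Mon} (ht : t.IsBi) (ha : t.out = Col.a) (hk : ¬ t.Killed) :
    ∃ r, Red k t (comb (f Col.a [inp Col.a]) r) := by
  induction ht with
  | f c ts h1 h2 h3 =>
    obtain rfl : c = Col.a := ha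
    have h4 : ts.length = 1 := le_antisymm (not_lt.1 fun h' => hk (Killed.f ts h')) h1
    obtain ⟨p, rfl⟩ := List.length_eq_one_iff.1 h4
    obtain ⟨i, hi⟩ := exists_red_comb_of_isOp (k := k) (h3 p (by simp))
      ((fits_a_iff.1 h2).2 p (by simp)) fun h => hk (Killed.in_f _ _ p (by simp) h)
    exact ⟨i, (Red.f (.cons hi .nil) _).trans (red_f_comb i)⟩
  | mu c ts h1 h2 h3 ih =>
    obtain rfl : c = Col.a := ha
    exact exists_red_comb_mu hk h1 rfl fun t ht =>
      ih t ht ((fits_a_iff.1 h2).2 t ht) fun h => hk (Killed.in_mu _ _ t ht h)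

theorem exists_branches {x : Mon} {as : List Mon} (h : ∀ t ∈ as, ∃ r, Red k t (comb x r)) :
    ∃ cs : List ℕ, (∀ c ∈ cs, 0 < c) ∧ cs.length = as.length ∧
      List.Forall₂ (Red k) as (cs.map fun c => comb x (c - 1)) := by
  induction as with
  | nil => exact ⟨[], by simp, rfl, .nil⟩
  | cons a as ih =>
    simp only [List.forall_mem_cons] at h
    obtain ⟨r, hr⟩ := h.1
    obtain ⟨cs, h1, h2, h3⟩ := ih h.2
    refine ⟨(r + 1) :: cs, ?_, by simp [h2], .cons (by simpa using hr) h3⟩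
    simp only [List.forall_mem_cons]
    exact ⟨by omega, h1⟩

theorem forall₂_concat {as as' : List Mon} {y y' : Mon} (h : List.Forall₂ (Red k) as as')
    (hy : Red k y y') : List.Forall₂ (Red k) (as ++ [y]) (as' ++ [y']) :=
  List.rel_append h (.cons hy .nil)

theorem exists_red_of_isOp {t : Mon} (ht : t.IsOp) (hm : t.out = Col.m) (hk : ¬ t.Killed) :
    ∃ G : List (List ℕ), (∀ t ∈ G, t ≠ []) ∧ (∀ t ∈ G, ∀ c ∈ t, 0 < c) ∧
      Red k t (G.foldr (muTree (inp Col.a)) (inp Col.m)) := by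
  induction ht with
  | inp c =>
    obtain rfl : c = Col.m := hm
    exact ⟨[], by simp, by simp, Red.refl _⟩
  | mu c ts h1 h2 h3 ih =>
    obtain rfl : c = Col.m := hm
    obtain ⟨as, y, rfl, has, hy⟩ := fits_iff.1 h2
    obtain ⟨G, hG1, hG2, hG3⟩ := ih y (by simp) hy fun h => hk (Killed.in_mu _ _ y (by simp) h)
    obtain ⟨cs, hcs1, hcs2, hcs3⟩ := exists_branches (k := k) (x := inp Col.a) fun t ht =>
      exists_red_comb_of_isOp (h3 t (by simp [ht])) (has t ht) fun h =>
        hk (Killed.in_mu _ _ t (by simp [ht]) h)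
    refine ⟨cs :: G, ?_, by simpa using ⟨hcs1, hG2⟩, Red.mu (forall₂_concat hcs3 hG3) _⟩
    simp only [List.forall_mem_cons]
    refine ⟨?_, hG1⟩
    rintro rfl
    simp [← hcs2] at h1

/-- Every monomial that is not killed is equal to the operation of a triple in `T`. -/
theorem exists_red_mon {t : Mon} (ht : t.IsBi) (hm : t.out = Col.m) (hk : ¬ t.Killed) :
    ∃ τ : Triple, τ.IsTriple ((τ.F ++ τ.T :: τ.G).map List.sum).sum ∧ Red k t τ.mon := by
  induction ht with
  | f c ts h1 h2 h3 =>
    obtain rfl : c = Col.m := hm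
    obtain ⟨as, y, rfl, has, hy⟩ := fits_iff.1 h2
    obtain ⟨G, hG1, hG2, hG3⟩ := exists_red_of_isOp (k := k) (h3 y (by simp)) hy fun h =>
      hk (Killed.in_f _ _ y (by simp) h)
    obtain ⟨cs, hcs1, hcs2, hcs3⟩ := exists_branches (k := k) (x := inp Col.a) fun t ht =>
      exists_red_comb_of_isOp (h3 t (by simp [ht])) (has t ht) fun h =>
        hk (Killed.in_f _ _ t (by simp [ht]) h)
    refine ⟨⟨[], cs, G⟩, ⟨by simp, hG1, by simpa using ⟨hcs1, hG2⟩, rfl⟩,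
      Red.f (forall₂_concat hcs3 hG3) _⟩
  | mu c ts h1 h2 h3 ih =>
    obtain rfl : c = Col.m := hm
    obtain ⟨as, y, rfl, has, hy⟩ := fits_iff.1 h2
    obtain ⟨⟨F, T, G⟩, ⟨hF, hG, hpos, -⟩, hτ⟩ := ih y (by simp) hy fun h =>
      hk (Killed.in_mu _ _ y (by simp) h)
    obtain ⟨cs, hcs1, hcs2, hcs3⟩ := exists_branches (k := k) (x := f Col.a [inp Col.a])
      fun t ht => exists_red_comb_of_isBi (h3 t (by simp [ht])) (has t ht) fun h =>
        hk (Killed.in_mu _ _ t (by simp [ht]) h)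
    refine ⟨⟨cs :: F, T, G⟩, ⟨?_, hG, ?_, rfl⟩, Red.mu (forall₂_concat hcs3 hτ) _⟩
    · simp only [List.forall_mem_cons]
      refine ⟨?_, hF⟩
      rintro rfl
      simp [← hcs2] at h1
    · simp only [List.cons_append, List.forall_mem_cons]
      exact ⟨hcs1, hpos⟩

/-! ### The operation of a triple -/

theorem inputs_comb {x : Mon} (hx : x.inputs = [Col.a]) (r : ℕ) :
    (comb x r).inputs = List.replicate (r + 1) Col.a := by
  induction r with
  | zero => exact hx
  | succ r ih => simp [comb, inputs, inputsL, hx, ih, List.replicate_succ]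

theorem inputsL_branches {x : Mon} (hx : x.inputs = [Col.a]) {t : List ℕ} (ht : ∀ c ∈ t, 0 < c) :
    inputsL (t.map fun c => comb x (c - 1)) = List.replicate t.sum Col.a := by
  induction t with
  | nil => simp [inputsL]
  | cons c t ih =>
    simp only [List.forall_mem_cons] at ht
    rw [List.map_cons, inputsL, inputs_comb hx, ih ht.2, Nat.sub_add_cancel ht.1, List.sum_cons,
      List.replicate_add]

theorem out_inp (c : Col) : (inp c).out = c := rfl

theorem isOp_comb (r : ℕ) : (comb (inp Col.a) r).IsOp := by
  induction r with
  | zero => exact IsOp.inp _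
  | succ r ih =>
    simp [comb, isOp_mu_iff, fits_a_iff, ih, out_comb (x := inp Col.a) rfl r, IsOp.inp, out_inp]

theorem isBi_comb (r : ℕ) : (comb (f Col.a [inp Col.a]) r).IsBi := by
  have h : (f Col.a [inp Col.a]).IsBi := by simp [isBi_f_iff, fits_a_iff, IsOp.inp, out]
  induction r with
  | zero => exact h
  | succ r ih =>
    simp [comb, isBi_mu_iff, fits_a_iff, ih, out_comb (x := f Col.a [inp Col.a]) rfl r, h, out_f]

theorem wt_comb {x : Mon} (hx : wt k x = 1) (r : ℕ) : wt k (comb x r) = 1 := by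
  induction r with
  | zero => exact hx
  | succ r ih => simp [comb, wt, wtL, hx, ih]

theorem wtL_branches {x : Mon} (hx : wt k x = 1) (t : List ℕ) :
    wtL k (t.map fun c => comb x (c - 1)) = 1 := by
  induction t with
  | nil => rfl
  | cons c t ih => simp [wtL, ih, wt_comb hx]

-- The weight over `ℚ` serves only to see that the operations are `μ_2` and `f_1`, of degree `0`.
theorem degL_branches {x : Mon} (hx : wt ℚ x = 1) (t : List ℕ) :
    degL (t.map fun c => comb x (c - 1)) = 0 :=
  degL_eq_zero_of_wtL_ne_zero (k := ℚ) _ (by simp [wtL_branches hx])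

theorem fits_branches {x y : Mon} (hx : x.out = Col.a) (hy : y.out = Col.m) (t : List ℕ) :
    Fits Col.m (t.map (fun c => comb x (c - 1)) ++ [y]) :=
  fits_iff.2 ⟨_, y, rfl, by simp [out_comb hx], hy⟩

theorem leaves_branches {x : Mon} (hx : x.inputs = [Col.a]) {t : List ℕ} (ht : ∀ c ∈ t, 0 < c) :
    (t.map fun c => comb x (c - 1)).map leaves = t := by
  rw [List.map_map]
  refine (List.map_congr_left fun c hc => ?_).trans (List.map_id t)
  simp [leaves, inputs_comb hx, Nat.sub_add_cancel (ht c hc)]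

theorem out_foldr_muTree {x y : Mon} (hy : y.out = Col.m) (G : List (List ℕ)) :
    (G.foldr (muTree x) y).out = Col.m := by
  cases G with
  | nil => exact hy
  | cons t G => rfl

/-- The part of the operation of a triple that comes from the trees to the right of `T`. -/
theorem foldr_muTree_inp {G : List (List ℕ)} (hne : ∀ t ∈ G, t ≠ [])
    (hpos : ∀ t ∈ G, ∀ c ∈ t, 0 < c) {y : Mon} (hy : y = G.foldr (muTree (inp Col.a)) (inp Col.m)) :
    y.IsOp ∧ y.inputs = List.replicate (G.map List.sum).sum Col.a ++ [Col.m] ∧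
      opG k y = wd (wordG G) ∧ y.deg = G.length - (G.map List.length).sum := by
  subst hy
  induction G with
  | nil => simp [IsOp.inp, inputs, opG, wordG, deg]
  | cons t G ih =>
    simp only [List.forall_mem_cons] at hne hpos
    obtain ⟨h1, h2, h3, h4⟩ := ih hne.2 hpos.2
    have hlen := List.length_pos_iff.2 hne.1
    rw [List.foldr_cons, muTree]
    refine ⟨?_, ?_, ?_, ?_⟩
    · refine IsOp.mu _ _ (by simp; omega) (fits_branches rfl (out_foldr_muTree rfl G) t) ?_
      simp only [List.forall_mem_append, List.forall_mem_singleton, List.forall_mem_map]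
      exact ⟨fun c _ => isOp_comb _, h1⟩
    · rw [inputs, inputsL_append, inputsL_branches rfl hpos.1, inputsL, inputsL, h2]
      simp only [List.append_nil, List.map_cons, List.sum_cons, List.replicate_add,
        List.append_assoc]
    · rw [opG_mu, wtL_branches rfl, leaves_branches rfl hpos.1, h3]
      simp [pushW_wd, wordG]
    · rw [deg, degL_append, degL_branches rfl, degL, degL, h4]
      simp only [List.length_append, List.length_map, List.length_nil, List.length_cons,
        List.map_cons, List.sum_cons]
      push_cast
      ring

/-- The operation of a triple is a monomial of the free bimodule, and its word is the word of the
triple. -/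
theorem mon_spec {n : ℕ} {τ : Triple} (hτ : τ.IsTriple n) :
    τ.mon ∈ biSet n ∧ opF k τ.mon = wd τ.word ∧ τ.mon.deg = -(wdim τ.word : ℤ) := by
  have hw := wdim_word hτ
  obtain ⟨F, T, G⟩ := τ
  obtain ⟨hF, hG, hpos, rfl⟩ := hτ
  simp only [List.forall_mem_append, List.forall_mem_cons] at hpos
  replace hF : ∀ t ∈ F, t ≠ [] := hF
  replace hG : ∀ t ∈ G, t ≠ [] := hG
  obtain ⟨h1, h2, h3, h4⟩ := foldr_muTree_inp (k := k) hG hpos.2.2 rfl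
  simp only [Triple.word, Triple.mon, biSet, Set.mem_ofPred_eq] at hw ⊢
  set y := G.foldr (muTree (inp Col.a)) (inp Col.m) with hy
  have hyo : y.out = Col.m := out_foldr_muTree rfl G
  suffices h : ∀ z, z = F.foldr (muTree (f Col.a [inp Col.a])) (fTree T y) →
      z.IsBi ∧ z.inputs = List.replicate ((F ++ T :: G).map List.sum).sum Col.a ++ [Col.m] ∧
      opF k z = wd (wordF F T G) ∧
      z.deg = F.length + G.length - (((F ++ T :: G).map List.length).sum : ℕ) by
    obtain ⟨h5, h6, h7, h8⟩ := h _ rfl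
    refine ⟨⟨h5, out_foldr_muTree rfl F, h6⟩, h7, ?_⟩
    rw [h8]
    omega
  clear hw
  rintro z rfl
  induction F with
  | nil =>
    rw [List.foldr_nil, fTree]
    refine ⟨?_, ?_, ?_, ?_⟩
    · refine IsBi.f _ _ (by simp) (fits_branches rfl hyo T) ?_
      simp only [List.forall_mem_append, List.forall_mem_singleton, List.forall_mem_map]
      exact ⟨fun c _ => isOp_comb _, h1⟩
    · rw [inputs, inputsL_append, inputsL_branches rfl hpos.2.1, inputsL, inputsL, h2]
      simp only [List.append_nil, List.map_cons, List.sum_cons, List.replicate_add,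
        List.append_assoc, List.nil_append]
    · rw [opF_f, wtL_branches rfl, leaves_branches rfl hpos.2.1, h3]
      cases T <;> simp [pushW_wd, wordF, wordT, headT]
    · rw [deg, degL_append, degL_branches rfl, degL, degL, h4]
      simp only [List.length_append, List.length_map, List.length_nil, List.length_cons,
        List.map_cons, List.sum_cons, List.nil_append]
      push_cast
      ring
  | cons t F ih =>
    simp only [List.forall_mem_cons] at hF hpos
    obtain ⟨h5, h6, h7, h8⟩ := ih ⟨hpos.1.2, hpos.2⟩ hF.2
    have hlen := List.length_pos_iff.2 hF.1
    rw [List.foldr_cons, muTree]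
    refine ⟨?_, ?_, ?_, ?_⟩
    · refine IsBi.mu _ _ (by simp; omega) (fits_branches rfl (out_foldr_muTree rfl F) t) ?_
      simp only [List.forall_mem_append, List.forall_mem_singleton, List.forall_mem_map]
      exact ⟨fun c _ => isBi_comb _, h5⟩
    · rw [inputs, inputsL_append, inputsL_branches rfl hpos.1.1, inputsL, inputsL, h6]
      simp only [List.append_nil, List.map_cons, List.sum_cons, List.replicate_add,
        List.append_assoc, List.cons_append]
    · rw [opF_mu, wtL_branches (by simp [wt, wtL]), leaves_branches rfl hpos.1.1, h7]
      simp [pushW_wd, wordF]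
    · rw [deg, degL_append, degL_branches (by simp [wt, wtL]), degL, degL, h8]
      simp only [List.length_append, List.length_map, List.length_nil, List.length_cons,
        List.map_cons, List.sum_cons, List.cons_append]
      push_cast
      ring

end NormalForm

/-! ### The isomorphism -/

section Cast

variable (k : Type*) [Field k]

/-- The image in `k` of the integer coefficients. -/
noncomputable def castCoeff : (Word →₀ ℤ) →+ (Word →₀ k) :=
  Finsupp.mapRange.addMonoidHom (Int.castAddHom k)

variable {k}

theorem castCoeff_apply (x : Word →₀ ℤ) (w : Word) : castCoeff k x w = (x w : k) := rfl

theorem castCoeff_push (l : Letter) (x : Word →₀ ℤ) :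
    castCoeff k (push l x) = push l (castCoeff k x) := by
  ext w
  rcases w with _ | ⟨l', w⟩
  · simp [castCoeff_apply]
  · by_cases h : l = l'
    · subst h; simp [castCoeff_apply]
    · simp [castCoeff_apply, h]

theorem castCoeff_wd (w : Word) : castCoeff k (wd w) = wd w := by
  simp [castCoeff, wd]

theorem castCoeff_dG (w : Word) : castCoeff k (dG (-1) w) = dG (-1) w := by
  induction w with
  | nil => simp [dG]
  | cons l w ih => cases l <;> simp [dG, castCoeff_push, castCoeff_wd, ih]

theorem castCoeff_openT (w : Word) : castCoeff k (openT w) = openT w := by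
  induction w with
  | nil => simp [openT]
  | cons l w ih => cases l <;> simp [openT, castCoeff_push, castCoeff_wd, ih]

theorem castCoeff_dT (w : Word) : castCoeff k (dT' (-1) w) = dT' (-1) w := by
  induction w with
  | nil => simp [dT']
  | cons l w ih => cases l <;> simp [dT', castCoeff_push, castCoeff_wd, castCoeff_dG, ih]

/-- The coefficients of the differential of words are integers. -/
theorem castCoeff_dF (w : Word) : castCoeff k (dF' (-1) w) = dF' (-1) w := by
  induction w with
  | nil => simp [dF']
  | cons l w ih =>
    cases l <;>
      simp [dF', castCoeff_push, castCoeff_wd, castCoeff_dG, castCoeff_openT, castCoeff_dT, ih]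

end Cast

section Iso

variable (k : Type*) [Field k] (n : ℕ)

/-- The map from `M_∞^Col(a^n, m; m)` to combinations of words. -/
noncomputable def opMInf : MInf k n →ₗ[k] (Word →₀ k) :=
  Finsupp.linearCombination k fun t : (biSet n : Set Mon) => opF k t.1

variable {k n}

theorem opMInf_lsubtypeDomain {x : Mon →₀ k} (hx : ∀ t ∈ x.support, t ∈ biSet n) :
    opMInf k n (Finsupp.lsubtypeDomain (R := k) (biSet n) x) =
      Finsupp.linearCombination k (opF k) x := by
  rw [opMInf, Finsupp.linearCombination_apply, Finsupp.linearCombination_apply]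
  exact Finsupp.sum_subtypeDomain_index (h := fun t c => c • opF k t) hx

theorem lsubtypeDomain_single (t : (biSet n : Set Mon)) (c : k) :
    Finsupp.lsubtypeDomain (R := k) (biSet n) (Finsupp.single t.1 c) = Finsupp.single t c := by
  classical
  ext u
  change Finsupp.single t.1 c u.1 = _
  simp only [Finsupp.single_apply, Subtype.ext_iff]

theorem mem_biSet_of_rep {t u : Mon} (ht : t ∈ biSet n) (h : Rep t u) : u ∈ biSet n :=
  ⟨h.isBi ht.1, h.out_eq.trans ht.2.1, h.inputs_eq.trans ht.2.2⟩

theorem dMInf_single (t : (biSet n : Set Mon)) :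
    dMInf k n (Finsupp.single t 1) = Finsupp.lsubtypeDomain (R := k) (biSet n) (diff k t.1) := by
  simp [dMInf]

/-- `opMInf` is a map of complexes. Since `diff` stays in the component, `dMInf` discards
nothing. -/
theorem opMInf_dMInf (x : MInf k n) :
    opMInf k n (dMInf k n x) = ext (dF' (-1)) (opMInf k n x) := by
  have h : opMInf k n ∘ₗ dMInf k n = ext (dF' (-1)) ∘ₗ opMInf k n := by
    refine Finsupp.lhom_ext' fun t => LinearMap.ext_ring ?_
    simp only [LinearMap.comp_apply, Finsupp.lsingle_apply, dMInf_single]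
    rw [opMInf_lsubtypeDomain fun u hu => mem_biSet_of_rep t.2 (rep_of_isBi k t.2.1 u hu),
      linearCombination_opF_diff t.2.1 t.2.2.1]
    simp [opMInf]
  exact LinearMap.congr_fun h x

/-- The kernel of `opMInf` contains the killed monomials and is closed under the differential. -/
theorem relations_le_ker : relations k n ≤ LinearMap.ker (opMInf k n) := by
  refine sInf_le ⟨?_, ?_⟩
  · rw [Submodule.span_le]
    rintro x ⟨t, ht, rfl⟩
    simp [opMInf, opF_eq_zero_of_killed ht t.2.1 t.2.2.1]
  · intro x hx
    rw [LinearMap.mem_ker] at hx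
    rw [Submodule.mem_comap, LinearMap.mem_ker, opMInf_dMInf, hx, map_zero]

variable (k n)

/-- The map from `T(a^n, m; m)` to combinations of words. -/
noncomputable def opT : TComplex k n →ₗ[k] (Word →₀ k) :=
  (relations k n).liftQ (opMInf k n) relations_le_ker

variable {k n}

theorem opT_dT (x : TComplex k n) : opT k n (dT k n x) = ext (dF' (-1)) (opT k n x) := by
  obtain ⟨y, rfl⟩ := (relations k n).mkQ_surjective x
  exact opMInf_dMInf y

theorem classT_eq (t : (biSet n : Set Mon)) :
    classT k n t.1 = (relations k n).mkQ (Finsupp.single t 1) := by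
  rw [classT, lsubtypeDomain_single]

theorem opT_classT {t : Mon} (ht : t ∈ biSet n) : opT k n (classT k n t) = opF k t := by
  rw [classT_eq ⟨t, ht⟩, opT, Submodule.mkQ_apply, Submodule.liftQ_apply]
  simp [opMInf]

theorem killed_mem_relations {t : (biSet n : Set Mon)} (h : t.1.Killed) (c : k) :
    Finsupp.single t c ∈ relations k n := by
  rw [relations, Submodule.mem_sInf]
  intro N hN
  rw [← mul_one c, ← smul_eq_mul, ← Finsupp.smul_single]
  exact N.smul_mem c (hN.1 (Submodule.subset_span ⟨t, h, rfl⟩))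

theorem classT_of_killed {t : Mon} (ht : t ∈ biSet n) (h : t.Killed) : classT k n t = 0 := by
  rw [classT_eq ⟨t, ht⟩, Submodule.mkQ_apply, Submodule.Quotient.mk_eq_zero]
  exact killed_mem_relations h 1

theorem lsubtypeDomain_mem_relations {x : Mon →₀ k} (hx : x ∈ killedSpan k) :
    Finsupp.lsubtypeDomain (R := k) (biSet n) x ∈ relations k n := by
  rw [← Finsupp.sum_single (Finsupp.lsubtypeDomain (R := k) (biSet n) x)]
  refine Submodule.sum_mem _ fun t ht => killed_mem_relations (hx ?_) _
  have h := Finsupp.mem_support_iff.1 ht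
  exact Finsupp.mem_support_iff.2 h

theorem classT_eq_of_step {t t' : Mon} (ht : t ∈ biSet n) (h : Step k t t') :
    classT k n t = classT k n t' := by
  obtain ⟨κ, hκ, hr, σ, hσ, hd⟩ := h.exists_killed
  have h1 := lsubtypeDomain_mem_relations (n := n) hd
  have h2 := relations_le_comap k n (killed_mem_relations (t := ⟨κ, mem_biSet_of_rep ht hr⟩) hκ 1)
  rw [Submodule.mem_comap, dMInf_single] at h2
  have h3 := Submodule.sub_mem _ h2 h1
  rw [← map_sub, sub_sub_cancel, map_smul, Submodule.smul_mem_iff _ hσ, map_sub] at h3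
  rw [← sub_eq_zero, classT, classT, ← map_sub, Submodule.mkQ_apply,
    Submodule.Quotient.mk_eq_zero]
  exact h3

theorem classT_eq_of_red {t t' : Mon} (ht : t ∈ biSet n) (h : Red k t t') :
    classT k n t = classT k n t' := by
  induction h with
  | refl => rfl
  | tail h h' ih => exact ih.trans (classT_eq_of_step (mem_biSet_of_rep ht (Red.rep h)) h')

/-- Every monomial is zero in `T` or equal to the operation of the triple of a face. -/
theorem classT_eq_zero_or {t : Mon} (ht : t ∈ biSet n) : classT k n t = 0 ∨
    ∃ s : Face n, s.dim = -t.deg ∧ classT k n t = classT k n (mapI s.1).mon := by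
  by_cases hk : t.Killed
  · exact Or.inl (classT_of_killed ht hk)
  · obtain ⟨τ, hτ, hr⟩ := exists_red_mon (k := k) ht.1 ht.2.1 hk
    have h1 := (mon_spec (k := k) hτ).1.2.2
    rw [hr.rep.inputs_eq, ht.2.2] at h1
    have h2 : n = ((τ.F ++ τ.T :: τ.G).map List.sum).sum := by
      simpa using congrArg List.length h1
    rw [← h2] at hτ
    obtain ⟨s, rfl⟩ := exists_face_of_isTriple hτ
    refine Or.inr ⟨s, ?_, classT_eq_of_red ht hr⟩
    rw [← hr.deg_eq, (mon_spec (k := k) hτ).2.2, neg_neg, Face.dim_eq]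
    rfl

variable (k n)

/-- The map from chains to `T(a^n, m; m)` that sends a face to the operation of its triple. -/
noncomputable def toT : Chains k n →ₗ[k] TComplex k n :=
  Finsupp.linearCombination k fun s => classT k n (mapI s.1).mon

variable {k n}

theorem Face.isTriple (s : Face n) : (mapI s.1).IsTriple n := (bijOn_mapI n).mapsTo s.2

theorem opT_toT (x : Chains k n) : opT k n (toT k n x) = Finsupp.mapDomain Face.word x := by
  have h : opT k n ∘ₗ toT k n = Finsupp.lmapDomain k k Face.word := by
    refine Finsupp.lhom_ext' fun s => LinearMap.ext_ring ?_
    have h1 := mon_spec (k := k) s.isTriple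
    simp only [LinearMap.comp_apply, Finsupp.lsingle_apply, toT,
      Finsupp.linearCombination_single, one_smul, opT_classT h1.1, h1.2.1,
      Finsupp.lmapDomain_apply, Finsupp.mapDomain_single]
    rfl
  exact LinearMap.congr_fun h x

theorem toT_injective : Function.Injective (toT k n) := by
  intro x y h
  refine Finsupp.mapDomain_injective Face.word_injective ?_
  rw [← opT_toT, ← opT_toT, h]

theorem toT_surjective : Function.Surjective (toT k n) := by
  intro x
  obtain ⟨y, rfl⟩ := (relations k n).mkQ_surjective x
  induction y using Finsupp.induction_linear with
  | zero => exact ⟨0, by simp⟩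
  | add y z hy hz =>
    obtain ⟨a, ha⟩ := hy
    obtain ⟨b, hb⟩ := hz
    exact ⟨a + b, by rw [map_add, map_add, ha, hb]⟩
  | single t c =>
    rw [← mul_one c, ← smul_eq_mul, ← Finsupp.smul_single, map_smul, ← classT_eq]
    rcases classT_eq_zero_or (k := k) t.2 with h | ⟨s, -, h⟩
    · exact ⟨0, by simp [h]⟩
    · exact ⟨c • Finsupp.single s 1, by simp [toT, h]⟩

/-- Since `toT` is surjective, this follows from the injectivity of its composition with `opT`. -/
theorem opT_injective : Function.Injective (opT k n) := by
  intro x y h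
  obtain ⟨x, rfl⟩ := toT_surjective x
  obtain ⟨y, rfl⟩ := toT_surjective y
  rw [opT_toT, opT_toT] at h
  rw [Finsupp.mapDomain_injective Face.word_injective h]

/-- For the orientation that is given by words, the signs `ε(s)` are not needed. -/
theorem toT_boundary (x : Chains k n) :
    toT k n (boundary k (wordOrientation n) x) = dT k n (toT k n x) := by
  have h : toT k n ∘ₗ boundary k (wordOrientation n) = dT k n ∘ₗ toT k n := by
    refine Finsupp.lhom_ext' fun s => LinearMap.ext_ring (opT_injective ?_)
    simp only [LinearMap.comp_apply, Finsupp.lsingle_apply]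
    rw [opT_dT, opT_toT, opT_toT, Finsupp.mapDomain_single]
    change _ = ext (dF' (-1)) (wd s.word)
    rw [ext_wd, ← castCoeff_dF]
    simp only [boundary, Finsupp.linearCombination_single, one_smul]
    ext w
    by_cases hw : w ∈ Set.range (Face.word (n := n))
    · obtain ⟨s', rfl⟩ := hw
      rw [Finsupp.mapDomain_apply Face.word_injective, castCoeff_apply, Finsupp.mapRange_apply,
        wordOrientation_bd]
    · rw [Finsupp.mapDomain_of_notMem_range _ _ hw, castCoeff_apply]
      have h0 : dF' (-1 : ℤ) s.word w = 0 := by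
        by_contra h0
        exact hw (support_dF_subset s (Finsupp.mem_support_iff.2 h0))
      rw [h0, Int.cast_zero]
  exact LinearMap.congr_fun h x

theorem intCast_units_mul_self (e : ℤˣ) : (((e : ℤˣ) : ℤ) : k) * ((e : ℤ) : k) = 1 := by
  rw [← Int.cast_mul, Int.units_coe_mul_self, Int.cast_one]

variable (k) in
/-- The automorphism of the chains that multiplies every face `s` by a sign `ε s`. -/
noncomputable def signEquiv (ε : Face n → ℤˣ) : Chains k n ≃ₗ[k] Chains k n :=
  LinearEquiv.ofInvolutive
    (Finsupp.linearCombination k fun s => Finsupp.single s (((ε s : ℤˣ) : ℤ) : k)) fun x => by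
      induction x using Finsupp.induction_linear with
      | zero => simp
      | add x y hx hy => rw [map_add, map_add, hx, hy]
      | single s c =>
        rw [Finsupp.linearCombination_single, Finsupp.smul_single, Finsupp.linearCombination_single,
          Finsupp.smul_single, smul_eq_mul, smul_eq_mul, mul_assoc, intCast_units_mul_self, mul_one]

theorem signEquiv_single (ε : Face n → ℤˣ) (s : Face n) :
    signEquiv k ε (Finsupp.single s 1) = (((ε s : ℤˣ) : ℤ) : k) • Finsupp.single s 1 := by
  change Finsupp.linearCombination k (fun s => Finsupp.single s (((ε s : ℤˣ) : ℤ) : k))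
    (Finsupp.single s 1) = _
  simp

theorem boundary_single (o : FreehedronOrientation n) (s s' : Face n) :
    boundary k o (Finsupp.single s 1) s' = ((o.bd s s' : ℤ) : k) := by
  simp [boundary]

theorem signEquiv_apply (ε : Face n → ℤˣ) (x : Chains k n) (s : Face n) :
    signEquiv k ε x s = (((ε s : ℤˣ) : ℤ) : k) * x s := by
  induction x using Finsupp.induction_linear with
  | zero => simp
  | add x y hx hy => rw [map_add, Finsupp.add_apply, hx, hy, Finsupp.add_apply, mul_add]
  | single s' c =>
    have h : Finsupp.single s' c = c • Finsupp.single s' (1 : k) := by simp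
    rw [h, map_smul, signEquiv_single]
    by_cases hs : s' = s
    · subst hs; simp [mul_comm]
    · simp [Finsupp.single_eq_of_ne' hs]

/-- Changing the orientations of the faces changes the boundary by conjugation with signs. -/
theorem signEquiv_boundary {o o' : FreehedronOrientation n} {ε : Face n → ℤˣ}
    (h : ∀ s s', o.bd s s' = ε s * ε s' * o'.bd s s') (x : Chains k n) :
    signEquiv k ε (boundary k o x) = boundary k o' (signEquiv k ε x) := by
  have h : (signEquiv k ε : Chains k n →ₗ[k] Chains k n) ∘ₗ boundary k o =
      boundary k o' ∘ₗ (signEquiv k ε : Chains k n →ₗ[k] Chains k n) := by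
    refine Finsupp.lhom_ext' fun s => LinearMap.ext_ring ?_
    ext s'
    simp only [LinearMap.comp_apply, Finsupp.lsingle_apply, LinearEquiv.coe_coe]
    rw [signEquiv_apply, signEquiv_single, map_smul, Finsupp.smul_apply, boundary_single,
      boundary_single, h, smul_eq_mul]
    push_cast
    linear_combination (((ε s : ℤˣ) : ℤ) : k) * ((o'.bd s s' : ℤ) : k) *
      intCast_units_mul_self (k := k) (ε s')
  exact LinearMap.congr_fun h x

theorem map_chainsOfDim {e : Chains k n →ₗ[k] TComplex k n} {ε : Face n → ℤˣ}
    (he : ∀ s : Face n, e (Finsupp.single s 1) =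
      (((ε s : ℤˣ) : ℤ) : k) • classT k n (mapI s.1).mon) (p : ℤ) :
    (chainsOfDim k n p).map e = tOfDegree k n (-p) := by
  rw [chainsOfDim, tOfDegree, Finsupp.supported_eq_span_single, Finsupp.supported_eq_span_single,
    Submodule.map_span, Submodule.map_span]
  refine le_antisymm (Submodule.span_le.2 ?_) (Submodule.span_le.2 ?_)
  · rintro _ ⟨_, ⟨s, rfl, rfl⟩, rfl⟩
    have h := mon_spec (k := k) s.isTriple
    rw [he]
    refine Submodule.smul_mem _ _ (Submodule.subset_span
      ⟨_, ⟨⟨(mapI s.1).mon, h.1⟩, ?_, rfl⟩, (classT_eq _).symm⟩)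
    change (mapI s.1).mon.deg = -s.dim
    rw [h.2.2, s.dim_eq]
    rfl
  · rintro _ ⟨_, ⟨t, ht, rfl⟩, rfl⟩
    change t.1.deg = -p at ht
    rw [← classT_eq]
    rcases classT_eq_zero_or (k := k) t.2 with h | ⟨s, hs, h⟩
    · rw [h]; exact Submodule.zero_mem _
    · rw [ht, neg_neg] at hs
      have h1 : classT k n t.1 = (((ε s : ℤˣ) : ℤ) : k) • e (Finsupp.single s 1) := by
        rw [he, smul_smul, intCast_units_mul_self, one_smul, h]
      rw [h1]
      exact Submodule.smul_mem _ _ (Submodule.subset_span ⟨_, ⟨s, hs, rfl⟩, rfl⟩)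

theorem exists_iso (o : FreehedronOrientation n) :
    ∃ (ε : Face n → ℤˣ) (e : Chains k n ≃ₗ[k] TComplex k n),
      (∀ s : Face n, e (Finsupp.single s 1) =
        (((ε s : ℤˣ) : ℤ) : k) • classT k n (mapI s.1).mon) ∧
      (∀ p : ℤ, (chainsOfDim k n p).map (e : Chains k n →ₗ[k] _) = tOfDegree k n (-p)) ∧
      ∀ c : Chains k n, e (boundary k o c) = dT k n (e c) := by
  obtain ⟨ε, hε⟩ := exists_sign_freehedron o (wordOrientation n)
  let e : Chains k n ≃ₗ[k] TComplex k n :=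
    (signEquiv k ε).trans (LinearEquiv.ofBijective (toT k n) ⟨toT_injective, toT_surjective⟩)
  have he : ∀ x, e x = toT k n (signEquiv k ε x) := fun x => rfl
  have hs : ∀ s : Face n, e (Finsupp.single s 1) =
      (((ε s : ℤˣ) : ℤ) : k) • classT k n (mapI s.1).mon := by
    intro s
    rw [he, signEquiv_single, map_smul]
    simp [toT]
  refine ⟨ε, e, hs, map_chainsOfDim hs, fun c => ?_⟩
  rw [he, he, signEquiv_boundary hε, toT_boundary]

end Iso
end Freehedra

theorem mainTheorem1 (k : Type*) [Field k] (n : ℕ) :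
    -- `I` is a bijection from nice `n`-expressions to triples with `n` leaves
    Set.BijOn Freehedra.mapI {s | s.IsNice n} {τ | τ.IsTriple n} ∧
    -- face transformations correspond to the terms of the differential
    (∀ s s' : Freehedra.Face n,
      (Freehedra.Drop s.1 s'.1 ↔
        Freehedra.UTerm (Freehedra.mapI s.1) (Freehedra.mapI s'.1)) ∧
      (Freehedra.InnerBreakLeft s.1 s'.1 ↔
        Freehedra.SepF (Freehedra.mapI s.1) (Freehedra.mapI s'.1)) ∧
      (Freehedra.InnerBreakRight s.1 s'.1 ↔
        Freehedra.SepG (Freehedra.mapI s.1) (Freehedra.mapI s'.1)) ∧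
      (Freehedra.RightOuterBreak s.1 s'.1 ↔
        Freehedra.SepLeft (Freehedra.mapI s.1) (Freehedra.mapI s'.1) ∨
        Freehedra.MoveLeft (Freehedra.mapI s.1) (Freehedra.mapI s'.1)) ∧
      (Freehedra.LeftOuterBreak s.1 s'.1 ↔
        Freehedra.SepRight (Freehedra.mapI s.1) (Freehedra.mapI s'.1) ∨
        Freehedra.MoveRight (Freehedra.mapI s.1) (Freehedra.mapI s'.1))) ∧
    -- the faces can be oriented, and for all orientations `I` gives, up to the sign of each basis
    -- element, an isomorphism of complexes
    Nonempty (Freehedra.FreehedronOrientation n) ∧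
    ∀ o : Freehedra.FreehedronOrientation n,
      ∃ (ε : Freehedra.Face n → ℤˣ)
        (e : Freehedra.Chains k n ≃ₗ[k] Freehedra.TComplex k n),
        (∀ s : Freehedra.Face n,
          e (Finsupp.single s 1) =
            (((ε s : ℤˣ) : ℤ) : k) • Freehedra.classT k n (Freehedra.mapI s.1).mon) ∧
        (∀ p : ℤ, (Freehedra.chainsOfDim k n p).map (e : Freehedra.Chains k n →ₗ[k] _) =
          Freehedra.tOfDegree k n (-p)) ∧
        (∀ c : Freehedra.Chains k n,
          e (Freehedra.boundary k o c) = Freehedra.dT k n (e c)) := by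
  exact ⟨Freehedra.bijOn_mapI n, Freehedra.transformations_iff, ⟨Freehedra.wordOrientation n⟩,
    Freehedra.exists_iso⟩
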